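/- **Setting.** Let $\mathcal D(\mathbb Z_2)$ be the braided fusion category with simple objects $m^ke^l$ ($k,l\in\mathbb Z_2$, $f=me$), trivial associator and braiding $c_{m^{k_1}e^{l_1},m^{k_2}e^{l_2}}=(-1)^{l_1k_2}$; let $G=\mathbb Z_2=\{1,-1\}$. Objects of the twisted sector of $\mathbb Z_2\text{-Vect}\boxtimes\mathcal D(\mathbb Z_2)$ carry a tilde. A ($\mathbb Z_2$-)zesting datum consists of a normalised 2-cocycle $\lambda$ on $G$ with values in the simple objects of $\mathcal D(\mathbb Z_2)$ (the fractionalisation) and scalars $\nu_{g,h,k}\in\mathbb C^\times$, $\nu_{g,1,k}=1$, with $$\nu_{g,h,k}\,\nu_{g,hk,l}\,\nu_{h,k,l}=\nu_{gh,k,l}\,\nu_{g,h,kl}\,c_{\lambda(g,h),\lambda(k,l)} ;$$ its defectification is $p=\nu_{-1,-1,-1}$; for $a_1,a_2,a_3\in\mathbb Z_4$ put $p(a_1,a_2,a_3)=p$ if all $a_i$ are odd and $1$ otherwise. The zested extension has simple objects $(g,x)$, product $(g,x)\otimes(h,y)=(gh,x\otimes y\otimes\lambda(g,h))$, associator $c_{\lambda(g,h),z}\,\nu_{g,h,k}$,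 braiding $c_{x,y}$, and a $\mathbb Z_2$-action that is trivial on objects and morphisms, with coherence scalars, for objects $X,Y$ of degrees $g,h$, $$(\rho^2_k)_{X,Y}=\nu_{g,h,k}^{-1}\nu_{g,k,h}\nu_{k,g,h}^{-1},\qquad (\rho^2_{h,k})_X=c_{x,\lambda(k,h)}c_{\lambda(k,h),x}\,\nu_{g,k,h}\nu_{k,g,h}^{-1}\nu_{k,h,g}.$$ For isomorphisms $\nu^Y_g\colon\rho_gY\to Y$ (with $\nu_1^Y=\mathrm{id}$; not to be confused with the zesting scalars) the projective cocycle of $Y$ is defined by $\beta_Y(g,h)^{-1}\,\mathrm{id}=\nu^Y_g\circ\rho_g(\nu^Y_h)\circ(\rho^2_{g,h})_Y^{-1}\circ(\nu^Y_{hg})^{-1}$. Simple objects of the equivariantisation are written $Y_s$, where $Y$ is a simple object of the extension, the equivariant structure is $u_1=\mathrm{id}$, $u_{-1}=s\,\nu^Y_{-1}$, and the subscript $s$ is the value at $-1$ of a projective representation, i.e. $s^2=\beta_Y(-1,-1)$. The braiding of the equivariantisation is $(\mathrm{id}\otimes u_{|Y|})\circ c_{X,Y}$. Exponents $k_i,l_i,j_i$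 mod 4 are represented in $\{0,1,2,3\}$, exponents mod 2 in $\{0,1\}$, and $\pi(n)\in\{0,1\}$ is the parity of $n$. **(1) $\lambda(-1,-1)=e$.** A zesting datum with this $\lambda$ and defectification $p$ exists iff $p=\pm1$. In each case the zesting is a $\mathbb Z_2$-crossed braided extension of $\mathcal D(\mathbb Z_2)$ with $\mathbb Z_2\times\mathbb Z_4$ fusion rules: its simple objects are $m^ke^l$, $k\in\mathbb Z_2$, $l\in\mathbb Z_4$, of degree $(-1)^l$, where $m^ke^l$ has underlying object $m^ke^{\lfloor l/2\rfloor}$ in $\mathcal D(\mathbb Z_2)$ (so $e^0,e^1,e^2,e^3$ are $\mathbb 1,\tilde{\mathbb 1},e,\tilde e$). For $X_i=m^{k_i}e^{l_i}$, $$\alpha_{X_1,X_2,X_3}=(-1)^{l_1l_2k_3}p(l_1,l_2,l_3),\qquad c_{X_1,X_2}=(-1)^{\lfloor l_1/2\rfloor k_2},$$ $$(\rho^2_{-1})_{X_1,X_2}=p^{-\pi(l_1)\pi(l_2)},\qquad(\rho^2_{-1,-1})_{X_1}=(-1)^{k_1}p^{\pi(l_1)}.$$ With $\nu^Y_g=\mathrm{id}$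 one has $\beta_{m^ke^l}(-1,-1)=(-1)^kp^{\pi(l)}$, that is $1,-1,p,-p$ for $Y\in\{\mathbb 1,e^2\},\{m,me^2\},\{e,e^3\},\{me,me^3\}$ respectively. The simple objects of the equivariantisation are identified with those of $\mathcal D(\mathbb Z_4)$, compatibly with the fusion rings, by $$m^ke^l\longleftrightarrow(m^{k\bmod2}e^l)_s,\qquad s=i^{k}\ (p=1),\qquad s=i^{k+\pi(l)}\ (p=-1),\qquad k,l\in\mathbb Z_4 .$$ In this notation the associator is $(-1)^{l_1l_2k_3}p(l_1,l_2,l_3)$ and the braiding is $$c_{m^{k_1}e^{l_1},m^{k_2}e^{l_2}}=(-1)^{\lfloor l_1/2\rfloor k_2}\,i^{\pi(l_2)k_1}\ (p=1),\qquad(-1)^{\lfloor l_1/2\rfloor k_2}\,i^{\pi(l_2)(k_1+\pi(l_1))}\ (p=-1).$$ **(2) $\lambda(-1,-1)=f$.** A zesting datum with this $\lambda$ and defectification $p$ exists iff $p=\pm i$. In each case the zesting is a $\mathbb Z_2$-crossed braided extension of $\mathcal D(\mathbb Z_2)$ with $\mathbb Z_2\times\mathbb Z_4$ fusion rules: its simple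 objects are $m^kf^j$, $k\in\mathbb Z_2$, $j\in\mathbb Z_4$, of degree $(-1)^j$, where $m^kf^j$ has underlying object $m^kf^{\lfloor j/2\rfloor}$ in $\mathcal D(\mathbb Z_2)$ (so $f^0,f^1,f^2,f^3$ are $\mathbb 1,\tilde{\mathbb 1},f,\tilde f$ and $m,mf,mf^2,mf^3$ are $m,\tilde m,e,\tilde e$). For $X_i=m^{k_i}f^{j_i}$, $$\alpha_{X_1,X_2,X_3}=(-1)^{j_1j_2(k_3+\lfloor j_3/2\rfloor)}p(j_1,j_2,j_3),\qquad c_{X_1,X_2}=(-1)^{\lfloor j_1/2\rfloor(k_2+\lfloor j_2/2\rfloor)},$$ $$(\rho^2_{-1})_{X_1,X_2}=p^{-\pi(j_1)\pi(j_2)},\qquad(\rho^2_{-1,-1})_{X_1}=(-1)^{k_1}p^{\pi(j_1)}.$$ Let $\zeta$ be any complex number with $\zeta^2=-i$. Both for $\nu_{-1}^{m^kf^j}=\zeta^{\pi(j)}$ and for $\nu_{-1}^{m^kf^j}=(-1)^{\lfloor j/2\rfloor}\zeta^{\pi(j)}$ one has $\beta_{m^kf^j}(-1,-1)=(-1)^k(ip)^{\pi(j)}$,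 that is $1,-1,ip,-ip$ for $Y\in\{\mathbb 1,f\},\{m,e\},\{\tilde{\mathbb 1},\tilde f\},\{\tilde m,\tilde e\}$ respectively. With the second choice, the simple objects of the equivariantisation are identified with those of $\mathcal D(\mathbb Z_4)$ (written $m^kf^j$, $k,j\in\mathbb Z_4$, where $m,f$ generate its $\mathbb Z_4\times\mathbb Z_4$ fusion ring), compatibly with the fusion rings, by $$m^kf^j\longleftrightarrow(m^{k\bmod2}f^j)_s,\qquad s=i^{k}\ (p=-i),\qquad s=i^{k+\pi(j)}\ (p=i).$$ In this notation the associator is $(-1)^{j_1j_2(k_3+\lfloor j_3/2\rfloor)}p(j_1,j_2,j_3)$ and the braiding is $$c_{m^{k_1}f^{j_1},m^{k_2}f^{j_2}}=(-1)^{\lfloor j_1/2\rfloor(k_2+\lfloor j_2/2\rfloor+\pi(j_2))}\,\zeta^{\pi(j_1)\pi(j_2)}\,i^{k_1\pi(j_2)}\ (p=-i),$$ $$c_{m^{k_1}f^{j_1},m^{k_2}f^{j_2}}=(-1)^{\lfloor j_1/2\rfloor(k_2+\lfloor j_2/2\rfloor+\pi(j_2))}\,\zeta^{\pi(j_1)\pi(j_2)}\,i^{(k_1+\pi(j_1))\pi(j_2)}\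 (p=i).$$ (In both parts "compatibly with the fusion rings" means: a bijection of isomorphism classes of simple objects of semisimple categories preserving the unit and all fusion coefficients.) -/

import Mathlib

open CategoryTheory MonoidalCategory

noncomputable section

/-! ### Graded vector spaces with twisted associator -/

/-- A normalised 3-cocycle on a group, with values in `ℂˣ` (trivial action). -/
structure ThreeCocycle (A : Type) [Group A] where
  toFun : A → A → A → ℂˣ
  pentagon : ∀ a b c d, toFun a b c * toFun a (b * c) d * toFun b c d =
    toFun (a * b) c d * toFun a b (c * d)
  unit_mid : ∀ a b, toFun a 1 b = 1

/-- Finite-dimensional `A`-graded complex vector spaces, presented by a finite homogeneous basis `ι`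
and the degrees of the basis vectors. The index `w` records which associator is used. -/
structure GrVec {A : Type} [Group A] (w : ThreeCocycle A) where
  ι : Type
  [fin : Fintype ι]
  [dec : DecidableEq ι]
  deg : ι → A

namespace ThreeCocycle

variable {A : Type} [Group A] (w : ThreeCocycle A)

lemma unit_right (a b : A) : w.toFun a b 1 = 1 := by
  have h := w.pentagon a b 1 1
  simpa [w.unit_mid] using h

lemma unit_left (a b : A) : w.toFun 1 a b = 1 := by
  have h := w.pentagon 1 1 a b
  simpa [w.unit_mid] using h

/-- The trivial cocycle. -/
@[simps] def trivial (A : Type) [Group A] : ThreeCocycle A where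
  toFun _ _ _ := 1
  pentagon := by simp
  unit_mid := by simp

end ThreeCocycle

namespace GrVec

variable {A : Type} [Group A] {w : ThreeCocycle A}

attribute [instance] GrVec.fin GrVec.dec

/-- Matrices (rows indexed by the source) whose nonzero entries connect basis vectors of equal degree. -/
def homSubmodule (X Y : GrVec w) : Submodule ℂ (Matrix X.ι Y.ι ℂ) where
  carrier := {M | ∀ i j, M i j ≠ 0 → X.deg i = Y.deg j}
  add_mem' {M N} hM hN i j h := by
    by_cases h1 : M i j = 0
    · exact hN i j (fun h2 => h (by simp [h1, h2]))
    · exact hM i j h1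
  zero_mem' i j h := absurd rfl h
  smul_mem' c M hM i j h := hM i j (fun h1 => h (by simp [h1]))

instance : Category (GrVec w) where
  Hom X Y := homSubmodule X Y
  id X := ⟨1, fun i j h => by
    by_cases hij : i = j
    · rw [hij]
    · exact absurd (Matrix.one_apply_ne hij) h⟩
  comp {X Y Z} f g := ⟨f.1 * g.1, fun i k h => by
    rw [Matrix.mul_apply] at h
    obtain ⟨j, -, hj⟩ := Finset.exists_ne_zero_of_sum_ne_zero h
    exact (f.2 i j (left_ne_zero_of_mul hj)).trans (g.2 j k (right_ne_zero_of_mul hj))⟩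
  id_comp f := Subtype.ext (Matrix.one_mul _)
  comp_id f := Subtype.ext (Matrix.mul_one _)
  assoc f g h := Subtype.ext (Matrix.mul_assoc _ _ _)

/-- The matrix entries of a morphism. -/
def entry {X Y : GrVec w} (f : X ⟶ Y) (i : X.ι) (j : Y.ι) : ℂ := f.1 i j

lemma entry_deg {X Y : GrVec w} (f : X ⟶ Y) {i : X.ι} {j : Y.ι} (h : entry f i j ≠ 0) :
    X.deg i = Y.deg j := f.2 i j h

@[ext] lemma hom_ext {X Y : GrVec w} {f g : X ⟶ Y} (h : ∀ i j, entry f i j = entry g i j) : f = g :=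
  Subtype.ext (Matrix.ext h)

lemma entry_comp {X Y Z : GrVec w} (f : X ⟶ Y) (g : Y ⟶ Z) (i : X.ι) (k : Z.ι) :
    entry (f ≫ g) i k = ∑ j, entry f i j * entry g j k := Matrix.mul_apply

lemma entry_id (X : GrVec w) (i j : X.ι) : entry (𝟙 X) i j = if i = j then 1 else 0 :=
  Matrix.one_apply

instance : Preadditive (GrVec w) where
  homGroup X Y := inferInstanceAs (AddCommGroup (homSubmodule X Y))
  add_comp _ _ _ _ _ _ := Subtype.ext (Matrix.add_mul _ _ _)
  comp_add _ _ _ _ _ _ := Subtype.ext (Matrix.mul_add _ _ _)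

instance : Linear ℂ (GrVec w) where
  homModule X Y := inferInstanceAs (Module ℂ (homSubmodule X Y))
  smul_comp _ _ _ _ _ _ := Subtype.ext (Matrix.smul_mul _ _ _)
  comp_smul _ _ _ _ _ _ := Subtype.ext (Matrix.mul_smul _ _ _)

/-- The morphism sending the basis vector `i` to `s i` times the basis vector `e i`. -/
def mono {X Y : GrVec w} (e : X.ι ≃ Y.ι) (s : X.ι → ℂ) (h : ∀ i, X.deg i = Y.deg (e i)) : X ⟶ Y :=
  ⟨fun i j => if e i = j then s i else 0, fun i j hij => by
    by_cases hj : e i = j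
    · rw [h i, hj]
    · simp [hj] at hij⟩

lemma entry_mono {X Y : GrVec w} (e : X.ι ≃ Y.ι) (s : X.ι → ℂ) (h) (i : X.ι) (j : Y.ι) :
    entry (mono e s h) i j = if e i = j then s i else 0 := rfl

lemma entry_mono_comp {X Y Z : GrVec w} (e : X.ι ≃ Y.ι) (s : X.ι → ℂ) (h) (g : Y ⟶ Z) (i : X.ι)
    (k : Z.ι) : entry (mono e s h ≫ g) i k = s i * entry g (e i) k := by
  simp [entry_comp, entry_mono]

lemma entry_comp_mono {X Y Z : GrVec w} (f : X ⟶ Y) (e : Y.ι ≃ Z.ι) (s : Y.ι → ℂ) (h) (i : X.ι)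
    (k : Z.ι) : entry (f ≫ mono e s h) i k = entry f i (e.symm k) * s (e.symm k) := by
  rw [entry_comp, Finset.sum_eq_single (e.symm k)]
  · simp [entry_mono]
  · intro j _ hj
    rw [entry_mono, if_neg (fun hk => hj (by simp [← hk])), mul_zero]
  · simp

lemma trans_deg {X Y Z : GrVec w} {e : X.ι ≃ Y.ι} {e' : Y.ι ≃ Z.ι} (h : ∀ i, X.deg i = Y.deg (e i))
    (h' : ∀ j, Y.deg j = Z.deg (e' j)) (i : X.ι) : X.deg i = Z.deg (e.trans e' i) :=
  (h i).trans (h' (e i))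

lemma refl_deg (X : GrVec w) (i : X.ι) : X.deg i = X.deg (Equiv.refl X.ι i) := rfl

lemma mono_comp_mono {X Y Z : GrVec w} (e : X.ι ≃ Y.ι) (s : X.ι → ℂ) (h) (e' : Y.ι ≃ Z.ι)
    (s' : Y.ι → ℂ) (h') : mono e s h ≫ mono e' s' h' =
      mono (e.trans e') (fun i => s i * s' (e i)) (trans_deg h h') := by
  ext i k
  rw [entry_mono_comp, entry_mono, entry_mono, mul_ite, mul_zero]
  rfl

lemma id_eq_mono (X : GrVec w) : 𝟙 X = mono (Equiv.refl X.ι) (fun _ => 1) X.refl_deg := by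
  ext i j
  rw [entry_id, entry_mono]
  rfl

lemma mono_congr {X Y : GrVec w} {e e' : X.ι ≃ Y.ι} {s s' : X.ι → ℂ} {h h'}
    (he : ∀ i, e i = e' i) (hs : ∀ i, s i = s' i) :
    mono (X := X) (Y := Y) e s h = mono e' s' h' := by
  ext i j
  simp [entry_mono, he, hs]

/-- The isomorphism sending the basis vector `i` to `s i` times the basis vector `e i`. -/
@[simps] def monoIso {X Y : GrVec w} (e : X.ι ≃ Y.ι) (s : X.ι → ℂˣ)
    (h : ∀ i, X.deg i = Y.deg (e i)) : X ≅ Y where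
  hom := mono e (fun i => s i) h
  inv := mono e.symm (fun j => ((s (e.symm j))⁻¹ : ℂˣ)) (fun j => by simp [h])
  hom_inv_id := by
    rw [mono_comp_mono, id_eq_mono]
    exact mono_congr (by simp) (by simp)
  inv_hom_id := by
    rw [mono_comp_mono, id_eq_mono]
    exact mono_congr (by simp) (by simp)

/-- The one-dimensional space of degree `a`. -/
@[simps] def simple (w : ThreeCocycle A) (a : A) : GrVec w where
  ι := Unit
  deg _ := a

/-- Kronecker product of homogeneous matrices. -/
def tensorMap {X₁ Y₁ X₂ Y₂ : GrVec w} (f : X₁ ⟶ Y₁) (g : X₂ ⟶ Y₂) :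
    (⟨X₁.ι × X₂.ι, fun i => X₁.deg i.1 * X₂.deg i.2⟩ : GrVec w) ⟶
      ⟨Y₁.ι × Y₂.ι, fun i => Y₁.deg i.1 * Y₂.deg i.2⟩ :=
  ⟨fun i j => f.1 i.1 j.1 * g.1 i.2 j.2, fun i j h => by
    change X₁.deg i.1 * X₂.deg i.2 = Y₁.deg j.1 * Y₂.deg j.2
    rw [f.2 _ _ (left_ne_zero_of_mul h), g.2 _ _ (right_ne_zero_of_mul h)]⟩

/-- The tensor product of graded spaces. -/
instance : MonoidalCategoryStruct (GrVec w) where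
  tensorObj X Y := ⟨X.ι × Y.ι, fun i => X.deg i.1 * Y.deg i.2⟩
  whiskerLeft X _ _ f := tensorMap (𝟙 X) f
  whiskerRight f Y := tensorMap f (𝟙 Y)
  tensorHom f g := tensorMap f g
  tensorUnit := simple w 1
  associator X Y Z := monoIso (Equiv.prodAssoc X.ι Y.ι Z.ι)
    (fun i => w.toFun (X.deg i.1.1) (Y.deg i.1.2) (Z.deg i.2)) (fun _ => mul_assoc _ _ _)
  leftUnitor X := monoIso (Equiv.punitProd X.ι) (fun _ => 1) (fun _ => one_mul _)
  rightUnitor X := monoIso (Equiv.prodPUnit X.ι) (fun _ => 1) (fun _ => mul_one _)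

section Equivs

variable (X Y Z X₁ X₂ Y₁ Y₂ : GrVec w)

def assocEquiv : ((X ⊗ Y) ⊗ Z).ι ≃ (X ⊗ (Y ⊗ Z)).ι := Equiv.prodAssoc X.ι Y.ι Z.ι

lemma assoc_deg (i : ((X ⊗ Y) ⊗ Z).ι) :
    ((X ⊗ Y) ⊗ Z).deg i = (X ⊗ (Y ⊗ Z)).deg (assocEquiv X Y Z i) := mul_assoc _ _ _

def leftEquiv : (𝟙_ (GrVec w) ⊗ X).ι ≃ X.ι := Equiv.punitProd X.ι

lemma left_deg (i : (𝟙_ (GrVec w) ⊗ X).ι) :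
    (𝟙_ (GrVec w) ⊗ X).deg i = X.deg (leftEquiv X i) := one_mul _

def rightEquiv : (X ⊗ 𝟙_ (GrVec w)).ι ≃ X.ι := Equiv.prodPUnit X.ι

lemma right_deg (i : (X ⊗ 𝟙_ (GrVec w)).ι) :
    (X ⊗ 𝟙_ (GrVec w)).deg i = X.deg (rightEquiv X i) := mul_one _

variable {X₁ X₂ Y₁ Y₂}

def tensorEquiv (e : X₁.ι ≃ Y₁.ι) (e' : X₂.ι ≃ Y₂.ι) : (X₁ ⊗ X₂).ι ≃ (Y₁ ⊗ Y₂).ι :=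
  Equiv.prodCongr e e'

lemma tensor_deg {e : X₁.ι ≃ Y₁.ι} {e' : X₂.ι ≃ Y₂.ι} (h : ∀ i, X₁.deg i = Y₁.deg (e i))
    (h' : ∀ i, X₂.deg i = Y₂.deg (e' i)) (i : (X₁ ⊗ X₂).ι) :
    (X₁ ⊗ X₂).deg i = (Y₁ ⊗ Y₂).deg (tensorEquiv e e' i) :=
  congrArg₂ (· * ·) (h i.1) (h' i.2)

variable {X Y Z}

/-- Pairs of basis vectors index the basis of a tensor product. -/
abbrev pair (i : X.ι) (j : Y.ι) : (X ⊗ Y).ι := (i, j)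

end Equivs

lemma entry_tensorHom {X₁ Y₁ X₂ Y₂ : GrVec w} (f : X₁ ⟶ Y₁) (g : X₂ ⟶ Y₂) (i : X₁.ι) (i' : X₂.ι)
    (j : Y₁.ι) (j' : Y₂.ι) :
    entry (f ⊗ₘ g) (pair i i') (pair j j') = entry f i j * entry g i' j' := rfl

/-- The coefficients of the associator on basis vectors. -/
def assocCoeff (X Y Z : GrVec w) (i : ((X ⊗ Y) ⊗ Z).ι) : ℂ :=
  w.toFun (X.deg i.1.1) (Y.deg i.1.2) (Z.deg i.2)

lemma associator_hom (X Y Z : GrVec w) : (α_ X Y Z).hom =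
    mono (assocEquiv X Y Z) (assocCoeff X Y Z) (assoc_deg X Y Z) := rfl

lemma leftUnitor_hom (X : GrVec w) : (λ_ X).hom = mono (leftEquiv X) (fun _ => 1) (left_deg X) := by
  ext i j
  exact if_congr Iff.rfl Units.val_one rfl

lemma rightUnitor_hom (X : GrVec w) :
    (ρ_ X).hom = mono (rightEquiv X) (fun _ => 1) (right_deg X) := by
  ext i j
  exact if_congr Iff.rfl Units.val_one rfl

lemma mono_tensor_mono {X₁ Y₁ X₂ Y₂ : GrVec w} (e : X₁.ι ≃ Y₁.ι) (s : X₁.ι → ℂ) (h)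
    (e' : X₂.ι ≃ Y₂.ι) (s' : X₂.ι → ℂ) (h') : mono e s h ⊗ₘ mono e' s' h' =
      mono (tensorEquiv e e') (fun i => s i.1 * s' i.2) (tensor_deg h h') := by
  ext i j
  obtain ⟨i1, i2⟩ := i
  obtain ⟨j1, j2⟩ := j
  refine (entry_tensorHom _ _ i1 i2 j1 j2).trans ?_
  rw [entry_mono, entry_mono, ite_zero_mul_ite_zero]
  exact if_congr (Prod.mk_inj (a₁ := e i1) (b₁ := e' i2)).symm rfl rfl

instance : MonoidalCategory (GrVec w) :=
  MonoidalCategory.ofTensorHom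
    (id_tensorHom_id := fun X₁ X₂ => by
      rw [id_eq_mono, id_eq_mono, mono_tensor_mono, id_eq_mono]
      exact mono_congr (fun _ => rfl) (fun _ => mul_one _))
    (id_tensorHom := fun _ _ _ _ => rfl)
    (tensorHom_id := fun _ _ => rfl)
    (tensorHom_comp_tensorHom := fun f₁ f₂ g₁ g₂ => by
      ext i j
      obtain ⟨i1, i2⟩ := i
      obtain ⟨j1, j2⟩ := j
      refine (entry_comp _ _ _ _).trans (Eq.trans ?_ (entry_tensorHom _ _ i1 i2 j1 j2).symm)
      rw [entry_comp, entry_comp, Finset.sum_mul_sum]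
      refine Eq.trans (Fintype.sum_prod_type _) (Finset.sum_congr rfl fun a _ =>
        Finset.sum_congr rfl fun b _ => ?_)
      change entry f₁ i1 a * entry f₂ i2 b * (entry g₁ a j1 * entry g₂ b j2) = _
      ring)
    (associator_naturality := fun {X₁ X₂ X₃ Y₁ Y₂ Y₃} f₁ f₂ f₃ => by
      ext i j
      obtain ⟨⟨i1, i2⟩, i3⟩ := i
      obtain ⟨j1, j2, j3⟩ := j
      rw [associator_hom, associator_hom, entry_comp_mono, entry_mono_comp]
      change entry f₁ i1 j1 * entry f₂ i2 j2 * entry f₃ i3 j3 *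
          (w.toFun (Y₁.deg j1) (Y₂.deg j2) (Y₃.deg j3) : ℂ) =
        (w.toFun (X₁.deg i1) (X₂.deg i2) (X₃.deg i3) : ℂ) *
          (entry f₁ i1 j1 * (entry f₂ i2 j2 * entry f₃ i3 j3))
      by_cases h1 : entry f₁ i1 j1 = 0
      · simp [h1]
      by_cases h2 : entry f₂ i2 j2 = 0
      · simp [h2]
      by_cases h3 : entry f₃ i3 j3 = 0
      · simp [h3]
      rw [entry_deg f₁ h1, entry_deg f₂ h2, entry_deg f₃ h3]
      ring)
    (leftUnitor_naturality := fun {X Y} f => by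
      ext i j
      obtain ⟨⟨⟩, i⟩ := i
      rw [leftUnitor_hom, leftUnitor_hom, entry_comp_mono, entry_mono_comp]
      change (1 : Matrix Unit Unit ℂ) () () * entry f i j * 1 = 1 * entry f i j
      rw [Matrix.one_apply_eq]
      ring)
    (rightUnitor_naturality := fun {X Y} f => by
      ext i j
      obtain ⟨i, ⟨⟩⟩ := i
      rw [rightUnitor_hom, rightUnitor_hom, entry_comp_mono, entry_mono_comp]
      change entry f i j * (1 : Matrix Unit Unit ℂ) () () * 1 = 1 * entry f i j
      rw [Matrix.one_apply_eq]
      ring)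
    (pentagon := fun W X Y Z => by
      simp only [associator_hom, id_eq_mono, mono_tensor_mono, mono_comp_mono]
      refine mono_congr (fun _ => rfl) ?_
      rintro ⟨⟨⟨a, b⟩, c⟩, d⟩
      have h := congrArg (Units.val) (w.pentagon (W.deg a) (X.deg b) (Y.deg c) (Z.deg d))
      simp only [Units.val_mul] at h
      refine Eq.trans ?_ h
      change (w.toFun (W.deg a) (X.deg b) (Y.deg c) : ℂ) * 1 *
        (w.toFun (W.deg a) (X.deg b * Y.deg c) (Z.deg d) *
          (1 * w.toFun (X.deg b) (Y.deg c) (Z.deg d))) = _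
      ring)
    (triangle := fun X Y => by
      rw [associator_hom, leftUnitor_hom, rightUnitor_hom]
      simp only [id_eq_mono, mono_tensor_mono, mono_comp_mono]
      refine mono_congr (fun _ => rfl) ?_
      rintro ⟨⟨a, u⟩, b⟩
      change (w.toFun (X.deg a) 1 (Y.deg b) : ℂ) * (1 * 1) = 1 * 1
      simp [w.unit_mid])

lemma whiskerLeft_eq (X : GrVec w) {Y Z : GrVec w} (f : Y ⟶ Z) : X ◁ f = 𝟙 X ⊗ₘ f := rfl

lemma whiskerRight_eq {X Y : GrVec w} (f : X ⟶ Y) (Z : GrVec w) : f ▷ Z = f ⊗ₘ 𝟙 Z := rfl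

end GrVec

/-! ### Group actions on monoidal categories and equivariantisation -/

open Functor.LaxMonoidal Functor.OplaxMonoidal Functor.Monoidal

universe v u

/-- A (right) action of a group `G` on a monoidal category `C`: a monoidal functor
`G^rev → Aut^⊗(C)`, written out in components. -/
structure MonoidalAction (G : Type) [Group G] (C : Type u) [Category.{v} C] [MonoidalCategory C] where
  ρ : G → C ⥤ C
  [mon : ∀ g, (ρ g).Monoidal]
  unit : 𝟭 C ≅ ρ 1
  comp : ∀ g h, ρ h ⋙ ρ g ≅ ρ (h * g)
  unit_monoidal : NatTrans.IsMonoidal unit.hom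
  comp_monoidal : ∀ g h, NatTrans.IsMonoidal (comp g h).hom
  comp_assoc : ∀ g h k X, (ρ g).map ((comp h k).hom.app X) ≫ (comp g (k * h)).hom.app X =
    (comp g h).hom.app ((ρ k).obj X) ≫ (comp (h * g) k).hom.app X ≫
      eqToHom (by rw [mul_assoc])
  unit_comp : ∀ g X, unit.hom.app ((ρ g).obj X) ≫ (comp 1 g).hom.app X = eqToHom (by simp)
  comp_unit : ∀ g X, (ρ g).map (unit.hom.app X) ≫ (comp g 1).hom.app X = eqToHom (by simp)

namespace MonoidalAction

attribute [instance] MonoidalAction.mon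

variable {G : Type} [Group G] {C : Type u} [Category.{v} C] [MonoidalCategory C]

instance (a : MonoidalAction G C) (g h : G) : NatTrans.IsMonoidal (a.comp g h).hom :=
  a.comp_monoidal g h

instance (a : MonoidalAction G C) : NatTrans.IsMonoidal a.unit.hom := a.unit_monoidal

end MonoidalAction

/-- A `G`-equivariant object: an object `X` with isomorphisms `u g : ρ_g X ≅ X` such that
`u_g ∘ ρ_g(u_h) = u_{hg} ∘ (ρ²_{g,h})_X`. These are the objects of the equivariantisation. -/
@[ext] structure Equivariant {G : Type} [Group G] {C : Type u} [Category.{v} C] [MonoidalCategory C]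
    (a : MonoidalAction G C) where
  obj : C
  u : ∀ g, (a.ρ g).obj obj ≅ obj
  coherent : ∀ g h, (a.ρ g).map (u h).hom ≫ (u g).hom =
    (a.comp g h).hom.app obj ≫ (u (h * g)).hom

namespace Equivariant

variable {G : Type} [Group G] {C : Type u} [Category.{v} C] [MonoidalCategory C]
  {a : MonoidalAction G C}

/-- Morphisms of equivariant objects commute with the equivariant structures. -/
@[ext] structure Hom (X Y : Equivariant a) where
  f : X.obj ⟶ Y.obj
  comm : ∀ g, (X.u g).hom ≫ f = (a.ρ g).map f ≫ (Y.u g).hom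

@[simps] instance : Category (Equivariant a) where
  Hom X Y := Hom X Y
  id X := ⟨𝟙 _, fun g => by simp⟩
  comp p q := ⟨p.f ≫ q.f, fun g => by
    rw [← Category.assoc, p.comm, Category.assoc, q.comm, Functor.map_comp, Category.assoc]⟩

@[ext] lemma hom_ext {X Y : Equivariant a} {p q : X ⟶ Y} (h : p.f = q.f) : p = q := Hom.ext h

/-- The forgetful functor to the underlying category. -/
@[simps] def forget (a : MonoidalAction G C) : Equivariant a ⥤ C where
  obj X := X.obj
  map p := p.f

instance : (forget a).Faithful where
  map_injective h := hom_ext h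

/-- An isomorphism of underlying objects compatible with the equivariant structures. -/
@[simps] def mkIso {X Y : Equivariant a} (e : X.obj ≅ Y.obj)
    (h : ∀ g, (X.u g).hom ≫ e.hom = (a.ρ g).map e.hom ≫ (Y.u g).hom) : X ≅ Y where
  hom := ⟨e.hom, h⟩
  inv := ⟨e.inv, fun g => by
    rw [Iso.comp_inv_eq, Category.assoc, h, ← Category.assoc, ← Functor.map_comp]; simp⟩

/-- The tensor product `(X,u) ⊗ (Y,v) = (X ⊗ Y, (u_g ⊗ v_g) ∘ (ρ_g²)⁻¹)`. -/
@[simps] def tensor (X Y : Equivariant a) : Equivariant a where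
  obj := X.obj ⊗ Y.obj
  u g := (μIso (a.ρ g) X.obj Y.obj).symm ≪≫ (X.u g ⊗ᵢ Y.u g)
  coherent g h := by
    have key := NatTrans.IsMonoidal.tensor (τ := (a.comp g h).hom) X.obj Y.obj
    have key' : (a.comp g h).hom.app (X.obj ⊗ Y.obj) ≫ δ (a.ρ (h * g)) X.obj Y.obj =
        δ (a.ρ h ⋙ a.ρ g) X.obj Y.obj ≫
          ((a.comp g h).hom.app X.obj ⊗ₘ (a.comp g h).hom.app Y.obj) := by
      rw [← cancel_epi (μ (a.ρ h ⋙ a.ρ g) X.obj Y.obj), ← Category.assoc, key]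
      simp
    simp only [Iso.trans_hom, Iso.symm_hom, μIso_inv, tensorIso_hom, Functor.map_comp,
      Category.assoc]
    rw [reassoc_of% key', MonoidalCategory.tensorHom_comp_tensorHom, ← X.coherent, ← Y.coherent,
      ← MonoidalCategory.tensorHom_comp_tensorHom, Functor.OplaxMonoidal.comp_δ, Category.assoc,
      Functor.OplaxMonoidal.δ_natural_assoc]

/-- The unit object `(𝟙, (ρ_g⁰)⁻¹)`. -/
@[simps] def unit (a : MonoidalAction G C) : Equivariant a where
  obj := 𝟙_ C
  u g := (εIso (a.ρ g)).symm
  coherent g h := by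
    have key := NatTrans.IsMonoidal.unit (τ := (a.comp g h).hom)
    simp only [Iso.symm_hom, εIso_inv]
    rw [← cancel_epi (ε (a.ρ h ⋙ a.ρ g)), ← Category.assoc, ← Category.assoc, key]
    simp

end Equivariant

namespace Equivariant

section Aux

variable {C : Type u} [Category.{v} C] [MonoidalCategory C] (F : C ⥤ C) [F.Monoidal]

lemma aux_tensor {X X' Y Y' : C} (u : F.obj X ⟶ X) (u' : F.obj X' ⟶ X') (w : F.obj Y ⟶ Y)
    (w' : F.obj Y' ⟶ Y') (p : X ⟶ X') (q : Y ⟶ Y') (hp : u ≫ p = F.map p ≫ u')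
    (hq : w ≫ q = F.map q ≫ w') :
    (δ F X Y ≫ (u ⊗ₘ w)) ≫ (p ⊗ₘ q) = F.map (p ⊗ₘ q) ≫ δ F X' Y' ≫ (u' ⊗ₘ w') := by
  rw [Category.assoc, MonoidalCategory.tensorHom_comp_tensorHom, hp, hq,
    ← MonoidalCategory.tensorHom_comp_tensorHom, Functor.OplaxMonoidal.δ_natural_assoc]

lemma aux_assoc {X Y Z : C} (u : F.obj X ⟶ X) (w : F.obj Y ⟶ Y) (t : F.obj Z ⟶ Z) :
    (δ F (X ⊗ Y) Z ≫ ((δ F X Y ≫ (u ⊗ₘ w)) ⊗ₘ t)) ≫ (α_ X Y Z).hom =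
      F.map (α_ X Y Z).hom ≫ δ F X (Y ⊗ Z) ≫ (u ⊗ₘ (δ F Y Z ≫ (w ⊗ₘ t))) := by
  have h1 : ((δ F X Y ≫ (u ⊗ₘ w)) ⊗ₘ t) = (δ F X Y ▷ F.obj Z) ≫ ((u ⊗ₘ w) ⊗ₘ t) := by
    rw [← MonoidalCategory.tensorHom_id, MonoidalCategory.tensorHom_comp_tensorHom,
      Category.id_comp]
  have h2 : (u ⊗ₘ (δ F Y Z ≫ (w ⊗ₘ t))) = (F.obj X ◁ δ F Y Z) ≫ (u ⊗ₘ (w ⊗ₘ t)) := by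
    rw [← MonoidalCategory.id_tensorHom, MonoidalCategory.tensorHom_comp_tensorHom,
      Category.id_comp]
  rw [h1, h2, Category.assoc, Category.assoc, MonoidalCategory.associator_naturality,
    Functor.OplaxMonoidal.associativity_assoc]

lemma aux_left {X : C} (u : F.obj X ⟶ X) :
    (δ F (𝟙_ C) X ≫ (η F ⊗ₘ u)) ≫ (λ_ X).hom = F.map (λ_ X).hom ≫ u := by
  rw [MonoidalCategory.tensorHom_def, Category.assoc, Category.assoc,
    MonoidalCategory.leftUnitor_naturality, ← Functor.OplaxMonoidal.left_unitality_hom_assoc]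

lemma aux_right {X : C} (u : F.obj X ⟶ X) :
    (δ F X (𝟙_ C) ≫ (u ⊗ₘ η F)) ≫ (ρ_ X).hom = F.map (ρ_ X).hom ≫ u := by
  rw [MonoidalCategory.tensorHom_def', Category.assoc, Category.assoc,
    MonoidalCategory.rightUnitor_naturality, ← Functor.OplaxMonoidal.right_unitality_hom_assoc]

lemma ind_assoc (X Y Z : C) : (α_ X Y Z).hom = (𝟙 _ ≫ (𝟙 (X ⊗ Y) ⊗ₘ 𝟙 Z)) ≫ (α_ X Y Z).hom ≫
    (𝟙 X ⊗ₘ 𝟙 (Y ⊗ Z)) ≫ 𝟙 _ := by simp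

lemma ind_left (X : C) : (λ_ X).hom = (𝟙 _ ≫ (𝟙 (𝟙_ C) ⊗ₘ 𝟙 X)) ≫ (λ_ X).hom := by simp

lemma ind_right (X : C) : (ρ_ X).hom = (𝟙 _ ≫ (𝟙 X ⊗ₘ 𝟙 (𝟙_ C))) ≫ (ρ_ X).hom := by simp

end Aux

variable {G : Type} [Group G] {C : Type u} [Category.{v} C] [MonoidalCategory C]
  {a : MonoidalAction G C}

/-- Associator and unitors of the equivariantisation are those of `C`. -/
instance : MonoidalCategoryStruct (Equivariant a) where
  tensorObj := tensor
  whiskerLeft X _ _ p := ⟨X.obj ◁ p.f, fun g => by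
    rw [← MonoidalCategory.id_tensorHom]
    exact aux_tensor _ _ _ _ _ _ _ (by simp) (p.comm g)⟩
  whiskerRight p Y := ⟨p.f ▷ Y.obj, fun g => by
    rw [← MonoidalCategory.tensorHom_id]
    exact aux_tensor _ _ _ _ _ _ _ (p.comm g) (by simp)⟩
  tensorHom p q := ⟨p.f ⊗ₘ q.f, fun g => aux_tensor _ _ _ _ _ _ _ (p.comm g) (q.comm g)⟩
  tensorUnit := unit a
  associator X Y Z := mkIso (α_ X.obj Y.obj Z.obj) (fun _ => aux_assoc _ _ _ _)
  leftUnitor X := mkIso (λ_ X.obj) (fun _ => aux_left _ _)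
  rightUnitor X := mkIso (ρ_ X.obj) (fun _ => aux_right _ _)

instance : MonoidalCategory (Equivariant a) :=
  Monoidal.induced (forget a)
    { μIso := fun _ _ => Iso.refl _
      εIso := Iso.refl _
      whiskerLeft_eq := fun _ _ _ _ => (Category.comp_id _).symm.trans (Category.id_comp _).symm
      whiskerRight_eq := fun _ _ => (Category.comp_id _).symm.trans (Category.id_comp _).symm
      tensorHom_eq := fun _ _ => (Category.comp_id _).symm.trans (Category.id_comp _).symm
      associator_eq := fun X Y Z => ind_assoc X.obj Y.obj Z.obj
      leftUnitor_eq := fun X => ind_left X.obj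
      rightUnitor_eq := fun X => ind_right X.obj }

end Equivariant

namespace Equivariant

variable {G : Type} [Group G] {C : Type u} [Category.{v} C] [MonoidalCategory C] [Preadditive C]
  [Linear ℂ C] {a : MonoidalAction G C} [∀ g, (a.ρ g).Additive] [∀ g, (a.ρ g).Linear ℂ]

/-- Equivariant morphisms form a linear subspace. -/
def homSubmodule (X Y : Equivariant a) : Submodule ℂ (X.obj ⟶ Y.obj) where
  carrier := {f | ∀ g, (X.u g).hom ≫ f = (a.ρ g).map f ≫ (Y.u g).hom}
  add_mem' {p q} hp hq g := by
    rw [Preadditive.comp_add, Functor.map_add, Preadditive.add_comp, hp g, hq g]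
  zero_mem' g := by simp
  smul_mem' c p hp g := by
    rw [Linear.comp_smul, Functor.map_smul, Linear.smul_comp, hp g]

def homEquiv (X Y : Equivariant a) : (X ⟶ Y) ≃ homSubmodule X Y where
  toFun p := ⟨p.f, p.comm⟩
  invFun p := ⟨p.1, p.2⟩
  left_inv _ := rfl
  right_inv _ := rfl

instance : Preadditive (Equivariant a) where
  homGroup X Y := (homEquiv X Y).addCommGroup
  add_comp _ _ _ _ _ _ := hom_ext (Preadditive.add_comp _ _ _ _ _ _)
  comp_add _ _ _ _ _ _ := hom_ext (Preadditive.comp_add _ _ _ _ _ _)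

instance : Linear ℂ (Equivariant a) where
  homModule X Y := (homEquiv X Y).module ℂ
  smul_comp _ _ _ _ _ _ := hom_ext (Linear.smul_comp _ _ _ _ _ _)
  comp_smul _ _ _ _ _ _ := hom_ext (Linear.comp_smul _ _ _ _ _ _)

end Equivariant

/-! ### Fusion rings -/

section Fusion

variable {C : Type u} [Category.{v} C] [Preadditive C] [Linear ℂ C]

/-- `S` lists the simple objects of the semisimple category `C`, each exactly once up to
isomorphism, and every object is a finite direct sum of them. -/
structure IsSimpleBasis {I : Type} (S : I → C) : Prop where
  simple : ∀ i, Simple (S i)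
  distinct : ∀ i j, Nonempty (S i ≅ S j) → i = j
  complete : ∀ X : C, Simple X → ∃ i, Nonempty (X ≅ S i)
  semisimple : ∀ X : C, ∃ (n : ℕ) (x : Fin n → I) (b : Limits.Bicone fun k => S (x k)),
    Nonempty b.IsBilimit ∧ Nonempty (b.pt ≅ X)

/-- The correspondence `S i ↔ T i` is a bijection between the isomorphism classes of simple objects
of `C` and of `D` that respects the unit and all fusion coefficients `dim Hom(S k, S i ⊗ S j)`,
so it is an isomorphism of fusion rings. -/
structure IdentifiesFusionRings {D : Type*} [Category D] [Preadditive D] [Linear ℂ D]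
    [MonoidalCategory C] [MonoidalCategory D] {I : Type} (S : I → C) (T : I → D) : Prop where
  basis_left : IsSimpleBasis S
  basis_right : IsSimpleBasis T
  unit : ∀ i, Nonempty (S i ≅ 𝟙_ C) ↔ Nonempty (T i ≅ 𝟙_ D)
  coeff : ∀ i j k, Module.finrank ℂ (S k ⟶ S i ⊗ S j) = Module.finrank ℂ (T k ⟶ T i ⊗ T j)

end Fusion

/-! ### Crossed braidings -/

section Crossed

variable {G : Type} [Group G] {C : Type u} [Category.{v} C] [MonoidalCategory C] [Preadditive C]

/-- The remaining structure of a `G`-crossed braided category on a monoidal category with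
`G`-action: the twisted sectors `C_g` and the `G`-braiding `X ⊗ Y ≅ Y ⊗ ρ_h X` for `Y ∈ C_h`. -/
structure CrossedBraiding (a : MonoidalAction G C) where
  sector : G → ObjectProperty C
  sector_iso : ∀ {g X Y}, (X ≅ Y) → sector g X → sector g Y
  sector_unit : sector 1 (𝟙_ C)
  sector_tensor : ∀ {g h X Y}, sector g X → sector h Y → sector (g * h) (X ⊗ Y)
  sector_hom : ∀ {g h X Y}, g ≠ h → sector g X → sector h Y → ∀ f : X ⟶ Y, f = 0
  sector_sum : ∀ X, ∃ (Z : G → C) (b : Limits.Bicone Z), (∀ g, sector g (Z g)) ∧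
    Nonempty b.IsBilimit ∧ Nonempty (b.pt ≅ X)
  sector_action : ∀ g {h X}, sector h X → sector (g⁻¹ * h * g) ((a.ρ g).obj X)
  braid : ∀ (X : C) {h : G} {Y : C}, sector h Y → (X ⊗ Y ≅ Y ⊗ (a.ρ h).obj X)
  natural_left : ∀ {X X' : C} (f : X ⟶ X') {h Y} (hY : sector h Y),
    f ▷ Y ≫ (braid X' hY).hom = (braid X hY).hom ≫ Y ◁ (a.ρ h).map f
  natural_right : ∀ (X : C) {h Y Y'} (hY : sector h Y) (hY' : sector h Y') (f : Y ⟶ Y'),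
    X ◁ f ≫ (braid X hY').hom = (braid X hY).hom ≫ f ▷ (a.ρ h).obj X
  -- compatibility with the action: `ρ_g(c_{X,Y}) = c_{ρ_g X, ρ_g Y}`
  action : ∀ g (X : C) {h Y} (hY : sector h Y),
    μ (a.ρ g) X Y ≫ (a.ρ g).map (braid X hY).hom =
      (braid ((a.ρ g).obj X) (sector_action g hY)).hom ≫
        (a.ρ g).obj Y ◁ ((a.comp (g⁻¹ * h * g) g).hom.app X ≫ eqToHom (by simp [mul_assoc]) ≫
          (a.comp g h).inv.app X) ≫ μ (a.ρ g) Y ((a.ρ h).obj X)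
  hexagon_right : ∀ (X : C) {h k Y Z} (hY : sector h Y) (hZ : sector k Z),
    (braid X (sector_tensor hY hZ)).hom = (α_ X Y Z).inv ≫ (braid X hY).hom ▷ Z ≫
      (α_ Y ((a.ρ h).obj X) Z).hom ≫ Y ◁ (braid ((a.ρ h).obj X) hZ).hom ≫
        (α_ Y Z ((a.ρ k).obj ((a.ρ h).obj X))).inv ≫ (Y ⊗ Z) ◁ (a.comp k h).hom.app X
  hexagon_left : ∀ (X Y : C) {k Z} (hZ : sector k Z),
    (braid (X ⊗ Y) hZ).hom = (α_ X Y Z).hom ≫ X ◁ (braid Y hZ).hom ≫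
      (α_ X Z ((a.ρ k).obj Y)).inv ≫ (braid X hZ).hom ▷ (a.ρ k).obj Y ≫
        (α_ Z ((a.ρ k).obj X) ((a.ρ k).obj Y)).hom ≫ Z ◁ μ (a.ρ k) X Y

variable {a : MonoidalAction G C}

/-- `C` is a `G`-crossed braided extension of the braided category `D`: the trivial sector `C_1` is
`D` as a linear braided category (using `ρ_1 ≅ id`). -/
def CrossedBraiding.IsExtensionOf [Linear ℂ C] (cb : CrossedBraiding a) (D : Type*) [Category D]
    [MonoidalCategory D] [Preadditive D] [Linear ℂ D] (b : BraidedCategory D) : Prop :=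
  ∃ (J : D ⥤ C) (_ : J.Monoidal), J.Additive ∧ J.Linear ℂ ∧ J.Full ∧ J.Faithful ∧
    (∀ X, J.essImage X ↔ cb.sector 1 X) ∧
    ∀ X Y (hY : cb.sector 1 (J.obj Y)), μ J X Y ≫ J.map (b.braiding X Y).hom =
      (cb.braid (J.obj X) hY).hom ≫ J.obj Y ◁ a.unit.inv.app (J.obj X) ≫ μ J Y X

/-- `b` is the braiding of the equivariantisation induced by a `G`-braiding: on each homogeneous
piece `j : Y_h ⟶ Y` with `Y_h ∈ C_h`, the braiding of `(X,u)` with `(Y,v)` is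
`(id ⊗ u_h) ∘ c_{X,Y_h}`. -/
def CrossedBraiding.IsEquivariantBraiding (cb : CrossedBraiding a)
    (b : BraidedCategory (Equivariant a)) : Prop :=
  ∀ (X Y : Equivariant a) (h : G) (Yh : C) (hY : cb.sector h Yh) (j : Yh ⟶ Y.obj),
    X.obj ◁ j ≫ (b.braiding X Y).hom.f =
      (cb.braid X.obj hY).hom ≫ Yh ◁ (X.u h).hom ≫ j ▷ X.obj

/-- `β` is the 2-cocycle of the object `Y` (whose stabiliser is all of `G`) for the chosen
isomorphisms `n g : ρ_g Y ≅ Y`: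
`β(g,h)⁻¹ • id = n_g ∘ ρ_g(n_h) ∘ (ρ²_{g,h})_Y⁻¹ ∘ n_{hg}⁻¹`. -/
def IsProjectiveCocycle [Linear ℂ C] (a : MonoidalAction G C) (Y : C)
    (n : ∀ g, (a.ρ g).obj Y ≅ Y) (β : G → G → ℂˣ) : Prop :=
  ∀ g h, (n (h * g)).inv ≫ (a.comp g h).inv.app Y ≫ (a.ρ g).map (n h).hom ≫ (n g).hom =
    (((β g h)⁻¹ : ℂˣ) : ℂ) • 𝟙 Y

end Crossed

/-! ### Actions that are trivial on objects and morphisms -/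

namespace GrVec

variable {A : Type} [Group A] {w : ThreeCocycle A}

/-- Scalars `tens g a b = (ρ_g²)_{a,b}` and `comp g h a = (ρ²_{g,h})_a` making the identity functors
of `GrVec w` into a `G`-action. -/
structure ActionData (G : Type) [Group G] (A : Type) [Group A] where
  tens : G → A → A → ℂˣ
  comp : G → G → A → ℂˣ
  tens_assoc : ∀ g a b c, tens g a b * tens g (a * b) c = tens g b c * tens g a (b * c)
  tens_one_left : ∀ g a, tens g 1 a = 1
  tens_one_right : ∀ g a, tens g a 1 = 1
  tens_one : ∀ a b, tens 1 a b = 1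
  comp_mul : ∀ g h a b, tens g a b * tens h a b * comp g h (a * b) =
    comp g h a * comp g h b * tens (h * g) a b
  comp_one : ∀ g h, comp g h 1 = 1
  comp_assoc : ∀ g h k a, comp h k a * comp g (k * h) a = comp g h a * comp (h * g) k a
  comp_one_left : ∀ g a, comp 1 g a = 1
  comp_one_right : ∀ g a, comp g 1 a = 1

variable {G : Type} [Group G]

/-- The functor `ρ_g`: trivial on objects and morphisms. -/
def actFunctor (w : ThreeCocycle A) (_ : ActionData G A) (_ : G) : GrVec w ⥤ GrVec w := 𝟭 _

/-- Multiplication of each basis vector by a scalar depending on its degree. -/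
def diag (X : GrVec w) (s : X.ι → ℂˣ) : X ≅ X := monoIso (Equiv.refl _) s X.refl_deg

lemma diag_hom (X : GrVec w) (s : X.ι → ℂˣ) :
    (diag X s).hom = mono (Equiv.refl _) (fun i => s i) X.refl_deg := rfl

lemma entry_diag_comp (X Y : GrVec w) (s : X.ι → ℂˣ) (f : X ⟶ Y) (i : X.ι) (j : Y.ι) :
    entry ((diag X s).hom ≫ f) i j = s i * entry f i j :=
  entry_mono_comp (Equiv.refl _) (fun i => (s i : ℂ)) X.refl_deg f i j

lemma entry_comp_diag (X Y : GrVec w) (s : Y.ι → ℂˣ) (f : X ⟶ Y) (i : X.ι) (j : Y.ι) :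
    entry (f ≫ (diag Y s).hom) i j = entry f i j * s j :=
  entry_comp_mono f (Equiv.refl _) (fun i => (s i : ℂ)) Y.refl_deg i j

/-- The tensorator `(ρ_g²)_{X,Y}`. -/
def tensIso (d : ActionData G A) (g : G) (X Y : GrVec w) : X ⊗ Y ≅ X ⊗ Y :=
  diag (X ⊗ Y) (fun i => d.tens g (X.deg i.1) (Y.deg i.2))

def actCore (d : ActionData G A) (g : G) : (actFunctor w d g).CoreMonoidal where
  εIso := Iso.refl _
  μIso X Y := tensIso d g X Y
  μIso_hom_natural_left {X Y} f Z := by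
    ext i j
    refine (entry_comp_diag _ _ _ _ i j).trans (Eq.trans ?_ (entry_diag_comp _ _ _ _ i j).symm)
    obtain ⟨i, i'⟩ := i
    obtain ⟨j, j'⟩ := j
    change entry f i j * entry (𝟙 Z) i' j' * (d.tens g (Y.deg j) (Z.deg j') : ℂ) =
      d.tens g (X.deg i) (Z.deg i') * (entry f i j * entry (𝟙 Z) i' j')
    by_cases h1 : entry f i j = 0
    · simp [h1]
    by_cases h2 : entry (𝟙 Z) i' j' = 0
    · simp [h2]
    rw [entry_deg _ h1, entry_deg _ h2, mul_comm]
  μIso_hom_natural_right {X Y} Z f := by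
    ext i j
    refine (entry_comp_diag _ _ _ _ i j).trans (Eq.trans ?_ (entry_diag_comp _ _ _ _ i j).symm)
    obtain ⟨i', i⟩ := i
    obtain ⟨j', j⟩ := j
    change entry (𝟙 Z) i' j' * entry f i j * (d.tens g (Z.deg j') (Y.deg j) : ℂ) =
      d.tens g (Z.deg i') (X.deg i) * (entry (𝟙 Z) i' j' * entry f i j)
    by_cases h1 : entry f i j = 0
    · simp [h1]
    by_cases h2 : entry (𝟙 Z) i' j' = 0
    · simp [h2]
    rw [entry_deg _ h1, entry_deg _ h2, mul_comm]
  associativity X Y Z := by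
    change (tensIso d g X Y).hom ▷ Z ≫ (tensIso d g (X ⊗ Y) Z).hom ≫ (α_ X Y Z).hom =
      (α_ X Y Z).hom ≫ X ◁ (tensIso d g Y Z).hom ≫ (tensIso d g X (Y ⊗ Z)).hom
    simp only [tensIso, diag_hom, whiskerLeft_eq, whiskerRight_eq, associator_hom, id_eq_mono,
      mono_tensor_mono, mono_comp_mono]
    refine mono_congr (fun _ => rfl) ?_
    rintro ⟨⟨a, b⟩, c⟩
    have h := congrArg Units.val (d.tens_assoc g (X.deg a) (Y.deg b) (Z.deg c))
    simp only [Units.val_mul] at h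
    change (d.tens g (X.deg a) (Y.deg b) : ℂ) * 1 * (d.tens g (X.deg a * Y.deg b) (Z.deg c) *
        w.toFun (X.deg a) (Y.deg b) (Z.deg c)) =
      w.toFun (X.deg a) (Y.deg b) (Z.deg c) * (1 * d.tens g (Y.deg b) (Z.deg c) *
        d.tens g (X.deg a) (Y.deg b * Z.deg c))
    linear_combination (w.toFun (X.deg a) (Y.deg b) (Z.deg c) : ℂ) * h
  left_unitality X := by
    change (λ_ X).hom = 𝟙 (𝟙_ (GrVec w)) ▷ X ≫ (tensIso d g (𝟙_ _) X).hom ≫ (λ_ X).hom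
    simp only [tensIso, diag_hom, whiskerRight_eq, leftUnitor_hom, id_eq_mono,
      mono_tensor_mono, mono_comp_mono]
    refine mono_congr (fun _ => rfl) ?_
    rintro ⟨u, b⟩
    change (1 : ℂ) = 1 * 1 * (d.tens g 1 (X.deg b) * 1)
    simp [d.tens_one_left]
  right_unitality X := by
    change (ρ_ X).hom = X ◁ 𝟙 (𝟙_ (GrVec w)) ≫ (tensIso d g X (𝟙_ _)).hom ≫ (ρ_ X).hom
    simp only [tensIso, diag_hom, whiskerLeft_eq, rightUnitor_hom, id_eq_mono,
      mono_tensor_mono, mono_comp_mono]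
    refine mono_congr (fun _ => rfl) ?_
    rintro ⟨b, u⟩
    change (1 : ℂ) = 1 * 1 * (d.tens g (X.deg b) 1 * 1)
    simp [d.tens_one_right]

instance actMonoidal (d : ActionData G A) (g : G) : (actFunctor w d g).Monoidal :=
  (actCore d g).toMonoidal

instance actAdditive (d : ActionData G A) (g : G) : (actFunctor w d g).Additive where
  map_add := rfl

instance actLinear (d : ActionData G A) (g : G) : (actFunctor w d g).Linear ℂ where
  map_smul _ _ := rfl

lemma act_ε (d : ActionData G A) (g : G) : ε (actFunctor w d g) = 𝟙 (𝟙_ (GrVec w)) := rfl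

lemma act_μ (d : ActionData G A) (g : G) (X Y : GrVec w) :
    μ (actFunctor w d g) X Y = (tensIso d g X Y).hom := rfl

/-- The compositor `(ρ²_{g,h})_X`. -/
def compIso (d : ActionData G A) (g h : G) (X : GrVec w) : X ≅ X :=
  diag X (fun i => d.comp g h (X.deg i))

lemma diag_comp_diag (X : GrVec w) (s t : X.ι → ℂˣ) :
    (diag X s).hom ≫ (diag X t).hom = (diag X (fun i => s i * t i)).hom := by
  rw [diag_hom, diag_hom, diag_hom, mono_comp_mono]
  exact mono_congr (fun _ => rfl) (fun _ => (Units.val_mul _ _).symm)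

lemma diag_tensor_diag (X Y : GrVec w) (s : X.ι → ℂˣ) (t : Y.ι → ℂˣ) :
    (diag X s).hom ⊗ₘ (diag Y t).hom = (diag (X ⊗ Y) (fun i => s i.1 * t i.2)).hom := by
  rw [diag_hom, diag_hom, diag_hom, mono_tensor_mono]
  exact mono_congr (fun _ => rfl) (fun _ => (Units.val_mul _ _).symm)

lemma diag_congr {X : GrVec w} {s t : X.ι → ℂˣ} (h : ∀ i, s i = t i) : diag X s = diag X t :=
  congrArg _ (funext h)

lemma diag_one {X : GrVec w} {s : X.ι → ℂˣ} (h : ∀ i, s i = 1) : (diag X s).hom = 𝟙 X := by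
  rw [diag_hom, id_eq_mono]
  exact mono_congr (fun _ => rfl) (fun i => by simp [h])

lemma eqToHom_act (d : ActionData G A) {g h : G} (e : g = h) (X : GrVec w)
    (p : (actFunctor w d g).obj X = (actFunctor w d h).obj X) : eqToHom p = 𝟙 X := by
  subst e; rfl

def compNat (d : ActionData G A) (g h : G) :
    actFunctor w d h ⋙ actFunctor w d g ≅ actFunctor w d (h * g) :=
  NatIso.ofComponents (fun X => compIso d g h X) (fun {X Y} f => by
    ext i j
    refine (entry_comp_diag _ _ _ _ i j).trans (Eq.trans ?_ (entry_diag_comp _ _ _ _ i j).symm)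
    change entry f i j * (d.comp g h (Y.deg j) : ℂ) = d.comp g h (X.deg i) * entry f i j
    by_cases h1 : entry f i j = 0
    · simp [h1]
    rw [entry_deg _ h1, mul_comm])

/-- The `G`-action on `GrVec w` with the given scalar coherence data. -/
def action (w : ThreeCocycle A) (d : ActionData G A) : MonoidalAction G (GrVec w) where
  ρ := actFunctor w d
  unit := Iso.refl _
  comp := compNat d
  unit_monoidal :=
    { unit := Category.comp_id _
      tensor := fun X Y => by
        change 𝟙 (X ⊗ Y) ≫ 𝟙 (X ⊗ Y) = (𝟙 X ⊗ₘ 𝟙 Y) ≫ (tensIso d 1 X Y).hom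
        have h1 : (tensIso d 1 X Y).hom = 𝟙 _ := diag_one (fun _ => d.tens_one _ _)
        rw [MonoidalCategory.id_tensorHom_id, h1] }
  comp_monoidal g h :=
    { unit := by
        change (𝟙 (𝟙_ (GrVec w)) ≫ 𝟙 (𝟙_ (GrVec w))) ≫ (compIso d g h (𝟙_ (GrVec w))).hom =
          𝟙 (𝟙_ (GrVec w))
        have h1 : (compIso d g h (𝟙_ (GrVec w))).hom = 𝟙 _ := diag_one (fun _ => d.comp_one _ _)
        rw [h1, Category.comp_id, Category.comp_id]
      tensor := fun X Y => by
        change ((tensIso d g X Y).hom ≫ (tensIso d h X Y).hom) ≫ (compIso d g h (X ⊗ Y)).hom =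
          ((compIso d g h X).hom ⊗ₘ (compIso d g h Y).hom) ≫ (tensIso d (h * g) X Y).hom
        simp only [tensIso, compIso, diag_tensor_diag, diag_comp_diag]
        exact congrArg Iso.hom (diag_congr fun i => d.comp_mul g h (X.deg i.1) (Y.deg i.2)) }
  comp_assoc g h k X := by
    rw [eqToHom_act d (mul_assoc k h g).symm]
    change (compIso d h k X).hom ≫ (compIso d g (k * h) X).hom =
      (compIso d g h X).hom ≫ (compIso d (h * g) k X).hom ≫ 𝟙 X
    rw [Category.comp_id]
    simp only [compIso, diag_comp_diag]
    exact congrArg Iso.hom (diag_congr fun i => d.comp_assoc g h k (X.deg i))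
  unit_comp g X := by
    rw [eqToHom_act d (mul_one g).symm]
    change 𝟙 X ≫ (compIso d 1 g X).hom = _
    have h1 : (compIso d 1 g X).hom = 𝟙 _ := diag_one (fun _ => d.comp_one_left _ _)
    rw [h1, Category.comp_id]
  comp_unit g X := by
    rw [eqToHom_act d (one_mul g).symm]
    change 𝟙 X ≫ (compIso d g 1 X).hom = _
    have h1 : (compIso d g 1 X).hom = 𝟙 _ := diag_one (fun _ => d.comp_one_right _ _)
    rw [h1, Category.comp_id]

instance (d : ActionData G A) (g : G) : ((action w d).ρ g).Additive := actAdditive d g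

instance (d : ActionData G A) (g : G) : ((action w d).ρ g).Linear ℂ := actLinear d g

/-- A simple object with scalars `u g : ρ_g X ≅ X` satisfying the equivariance condition. -/
def equivariantSimple (d : ActionData G A) (a : A) (u : G → ℂˣ)
    (hu : ∀ g h, u h * u g = d.comp g h a * u (h * g)) : Equivariant (action w d) where
  obj := simple w a
  u g := diag (simple w a) (fun _ => u g)
  coherent g h := by
    change (diag (simple w a) (fun _ => u h)).hom ≫ (diag (simple w a) (fun _ => u g)).hom =
      (compIso d g h (simple w a)).hom ≫ (diag (simple w a) (fun _ => u (h * g))).hom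
    rw [compIso, diag_comp_diag, diag_comp_diag]
    exact congrArg Iso.hom (diag_congr fun _ => hu g h)

end GrVec

/-! ### Braided pointed categories from bicharacters -/

/-- A bicharacter on an abelian group. -/
structure Bicharacter (B : Type) [AddCommGroup B] where
  toFun : B → B → ℂˣ
  add_left : ∀ x y z, toFun (x + y) z = toFun x z * toFun y z
  add_right : ∀ x y z, toFun x (y + z) = toFun x y * toFun x z

namespace Bicharacter

variable {B : Type} [AddCommGroup B] (c : Bicharacter B)

lemma zero_left (x : B) : c.toFun 0 x = 1 := by
  have h := c.add_left 0 0 x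
  simpa using h

lemma zero_right (x : B) : c.toFun x 0 = 1 := by
  have h := c.add_right x 0 0
  simpa using h

end Bicharacter

/-- Graded vector spaces with trivial associator. -/
abbrev PointedCat (B : Type) [AddCommGroup B] := GrVec (ThreeCocycle.trivial (Multiplicative B))

namespace PointedCat

variable {B : Type} [AddCommGroup B]

/-- The one-dimensional object of degree `x`. -/
abbrev obj (x : B) : PointedCat B := GrVec.simple _ (Multiplicative.ofAdd x)

open GrVec

def swapEquiv (X Y : PointedCat B) : (X ⊗ Y).ι ≃ (Y ⊗ X).ι := Equiv.prodComm X.ι Y.ι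

lemma swap_deg (X Y : PointedCat B) (i : (X ⊗ Y).ι) :
    (X ⊗ Y).deg i = (Y ⊗ X).deg (swapEquiv X Y i) := mul_comm _ _

/-- The scalar by which basis vectors braid. -/
def braidCoeff (c : Bicharacter B) (X Y : PointedCat B) (i : (X ⊗ Y).ι) : ℂˣ :=
  c.toFun (X.deg i.1).toAdd (Y.deg i.2).toAdd

def braidIso (c : Bicharacter B) (X Y : PointedCat B) : X ⊗ Y ≅ Y ⊗ X :=
  monoIso (swapEquiv X Y) (braidCoeff c X Y) (swap_deg X Y)

lemma braidIso_hom (c : Bicharacter B) (X Y : PointedCat B) : (braidIso c X Y).hom =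
    mono (swapEquiv X Y) (fun i => braidCoeff c X Y i) (swap_deg X Y) := rfl

lemma associator_inv (X Y Z : PointedCat B) : (α_ X Y Z).inv =
    mono (assocEquiv X Y Z).symm (fun _ => 1)
      (fun i => by rw [assoc_deg, Equiv.apply_symm_apply]) := by
  ext i j
  refine if_congr Iff.rfl ?_ rfl
  simp [ThreeCocycle.trivial]

/-- The braided category whose simple objects braid by the bicharacter `c`. -/
@[reducible] def braided (c : Bicharacter B) : BraidedCategory (PointedCat B) where
  braiding := braidIso c
  braiding_naturality_right X Y Z f := by
    ext i j
    rw [braidIso_hom, braidIso_hom, entry_comp_mono, entry_mono_comp]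
    obtain ⟨i', i⟩ := i
    obtain ⟨j, j'⟩ := j
    change entry (𝟙 X) i' j' * entry f i j * (c.toFun (X.deg j').toAdd (Z.deg j).toAdd : ℂ) =
      c.toFun (X.deg i').toAdd (Y.deg i).toAdd * (entry f i j * entry (𝟙 X) i' j')
    by_cases h1 : entry f i j = 0
    · simp [h1]
    by_cases h2 : entry (𝟙 X) i' j' = 0
    · simp [h2]
    rw [entry_deg _ h1, entry_deg _ h2]
    ring
  braiding_naturality_left {X Y} f Z := by
    ext i j
    rw [braidIso_hom, braidIso_hom, entry_comp_mono, entry_mono_comp]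
    obtain ⟨i, i'⟩ := i
    obtain ⟨j', j⟩ := j
    change entry f i j * entry (𝟙 Z) i' j' * (c.toFun (Y.deg j).toAdd (Z.deg j').toAdd : ℂ) =
      c.toFun (X.deg i).toAdd (Z.deg i').toAdd * (entry (𝟙 Z) i' j' * entry f i j)
    by_cases h1 : entry f i j = 0
    · simp [h1]
    by_cases h2 : entry (𝟙 Z) i' j' = 0
    · simp [h2]
    rw [entry_deg _ h1, entry_deg _ h2]
    ring
  hexagon_forward X Y Z := by
    simp only [braidIso_hom, whiskerLeft_eq, whiskerRight_eq, GrVec.associator_hom, id_eq_mono,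
      mono_tensor_mono, mono_comp_mono]
    refine mono_congr (fun _ => rfl) ?_
    rintro ⟨⟨x, y⟩, z⟩
    have h := congrArg Units.val (c.add_right (X.deg x).toAdd (Y.deg y).toAdd (Z.deg z).toAdd)
    simp only [Units.val_mul] at h
    change (1 : ℂ) * (c.toFun (X.deg x).toAdd ((Y.deg y).toAdd + (Z.deg z).toAdd) * 1) =
      c.toFun (X.deg x).toAdd (Y.deg y).toAdd * 1 *
        (1 * (1 * c.toFun (X.deg x).toAdd (Z.deg z).toAdd))
    linear_combination h
  hexagon_reverse X Y Z := by
    simp only [braidIso_hom, whiskerLeft_eq, whiskerRight_eq, PointedCat.associator_inv, id_eq_mono,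
      mono_tensor_mono, mono_comp_mono]
    refine mono_congr (fun _ => rfl) ?_
    rintro ⟨x, y, z⟩
    have h := congrArg Units.val (c.add_left (X.deg x).toAdd (Y.deg y).toAdd (Z.deg z).toAdd)
    simp only [Units.val_mul] at h
    change (1 : ℂ) * (c.toFun ((X.deg x).toAdd + (Y.deg y).toAdd) (Z.deg z).toAdd * 1) =
      1 * c.toFun (Y.deg y).toAdd (Z.deg z).toAdd *
        (1 * (c.toFun (X.deg x).toAdd (Z.deg z).toAdd * 1))
    linear_combination h

end PointedCat

/-! ### Zesting -/

/-- A zesting datum for the trivial extension `G-Vect ⊠ B` of the pointed braided category with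
simple objects `B` and braiding `c`. The symmetry fractionalisation is `lam`, and
`nu g h k : λ(g,h) ⊗ λ(gh,k) ≅ λ(h,k) ⊗ λ(g,hk)` is the defectification. For cyclic `G` symmetry of
`lam` is automatic. -/
structure ZestingDatum (G : Type) [CommGroup G] {B : Type} [AddCommGroup B] (c : Bicharacter B) where
  lam : G → G → B
  nu : G → G → G → ℂˣ
  lam_one_left : ∀ g, lam 1 g = 0
  lam_one_right : ∀ g, lam g 1 = 0
  lam_symm : ∀ g h, lam g h = lam h g
  lam_cocycle : ∀ g h k, lam g h + lam (g * h) k = lam h k + lam g (h * k)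
  nu_unit : ∀ g k, nu g 1 k = 1
  nu_pentagon : ∀ g h k l, nu g h k * nu g (h * k) l * nu h k l =
    nu (g * h) k l * nu g h (k * l) * c.toFun (lam g h) (lam k l)

namespace ZestingDatum

variable {G : Type} [CommGroup G] {B : Type} [AddCommGroup B] {c : Bicharacter B}
  (z : ZestingDatum G c)

lemma nu_one_left (g h : G) : z.nu 1 g h = 1 := by
  have h1 := z.nu_pentagon 1 1 g h
  simpa [z.nu_unit, z.lam_one_left, c.zero_left] using h1

lemma nu_one_right (g h : G) : z.nu g h 1 = 1 := by
  have h1 := z.nu_pentagon g h 1 1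
  simpa [z.nu_unit, z.lam_one_left, c.zero_right] using h1

/-- Simple objects of the zested extension: a degree in `G` and a simple object of `B`. -/
@[ext] structure Label (z : ZestingDatum G c) where
  deg : G
  base : B

namespace Label

variable {z}

/-- The zested fusion rules `(g,x) ⊗ (h,y) = (gh, x + y + λ(g,h))`. -/
instance : Mul z.Label := ⟨fun X Y => ⟨X.deg * Y.deg, X.base + Y.base + z.lam X.deg Y.deg⟩⟩

instance : One z.Label := ⟨⟨1, 0⟩⟩

instance : Inv z.Label := ⟨fun X => ⟨X.deg⁻¹, -X.base - z.lam X.deg⁻¹ X.deg⟩⟩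

@[simp] lemma mul_deg (X Y : z.Label) : (X * Y).deg = X.deg * Y.deg := rfl

@[simp] lemma mul_base (X Y : z.Label) :
    (X * Y).base = X.base + Y.base + z.lam X.deg Y.deg := rfl

@[simp] lemma one_deg : (1 : z.Label).deg = 1 := rfl

@[simp] lemma one_base : (1 : z.Label).base = 0 := rfl

@[simp] lemma inv_deg (X : z.Label) : (X⁻¹).deg = X.deg⁻¹ := rfl

@[simp] lemma inv_base (X : z.Label) : (X⁻¹).base = -X.base - z.lam X.deg⁻¹ X.deg := rfl

instance : CommGroup z.Label where
  mul_assoc X Y Z := by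
    refine Label.ext (mul_assoc _ _ _) ?_
    have h := z.lam_cocycle X.deg Y.deg Z.deg
    simp only [mul_base, mul_deg]
    calc _ = X.base + Y.base + Z.base + (z.lam X.deg Y.deg + z.lam (X.deg * Y.deg) Z.deg) := by
            abel
      _ = _ := by rw [h]; abel
  one_mul X := Label.ext (one_mul _) (by simp [z.lam_one_left])
  mul_one X := Label.ext (mul_one _) (by simp [z.lam_one_right])
  inv_mul_cancel X := Label.ext (inv_mul_cancel _) (by
    simp only [mul_base, inv_base, inv_deg, one_base]
    abel)
  mul_comm X Y := Label.ext (mul_comm _ _) (by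
    simp only [mul_base]
    rw [z.lam_symm X.deg Y.deg, add_comm X.base])

end Label

/-- The zested associator `α_{X,Y,Z} = c(λ(g,h), Z) · ν(g,h,k)` in degrees `g`, `h`, `k`. -/
@[simps] def cocycle : ThreeCocycle z.Label where
  toFun X Y Z := c.toFun (z.lam X.deg Y.deg) Z.base * z.nu X.deg Y.deg Z.deg
  pentagon X Y Z W := by
    have h := z.nu_pentagon X.deg Y.deg Z.deg W.deg
    have h2 : c.toFun (z.lam X.deg Y.deg) W.base * c.toFun (z.lam (X.deg * Y.deg) Z.deg) W.base =
        c.toFun (z.lam Y.deg Z.deg) W.base * c.toFun (z.lam X.deg (Y.deg * Z.deg)) W.base := by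
      rw [← c.add_left, ← c.add_left, z.lam_cocycle]
    simp only [Label.mul_deg, Label.mul_base, c.add_right]
    calc _ = c.toFun (z.lam X.deg Y.deg) Z.base * (c.toFun (z.lam Y.deg Z.deg) W.base *
            c.toFun (z.lam X.deg (Y.deg * Z.deg)) W.base) * (z.nu X.deg Y.deg Z.deg *
            z.nu X.deg (Y.deg * Z.deg) W.deg * z.nu Y.deg Z.deg W.deg) := by
              simp only [mul_assoc, mul_comm, mul_left_comm]
      _ = _ := by
              rw [h, ← h2]
              simp only [mul_assoc, mul_comm, mul_left_comm]
  unit_mid X Y := by simp [z.lam_one_right, z.nu_unit, c.zero_left]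

/-- The zested extension. -/
abbrev Cat := GrVec z.cocycle

/-- Double braiding. -/
def monodromy (c : Bicharacter B) (x y : B) : ℂˣ := c.toFun x y * c.toFun y x

lemma monodromy_add_left (x y w : B) :
    monodromy c (x + y) w = monodromy c x w * monodromy c y w := by
  simp only [monodromy, c.add_left, c.add_right]
  exact mul_mul_mul_comm _ _ _ _

lemma monodromy_add_right (x y w : B) :
    monodromy c x (y + w) = monodromy c x y * monodromy c x w := by
  simp only [monodromy, c.add_left, c.add_right]
  exact mul_mul_mul_comm _ _ _ _

section Additive

/-- Additive notation for the scalars. -/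
def addNu (a b d : G) : Additive ℂˣ := Additive.ofMul (z.nu a b d)

def addC (c : Bicharacter B) (x y : B) : Additive ℂˣ := Additive.ofMul (c.toFun x y)

lemma addNu_pentagon (a b d e : G) : z.addNu a b d + z.addNu a (b * d) e + z.addNu b d e =
    z.addNu (a * b) d e + z.addNu a b (d * e) + addC c (z.lam a b) (z.lam d e) :=
  congrArg Additive.ofMul (z.nu_pentagon a b d e)

end Additive

/-- `(ρ²_k)_{X,Y} = ν(g,h,k)⁻¹ ν(g,k,h) ν(k,g,h)⁻¹` in degrees `g`, `h`. -/
def tensorator (k g h : G) : ℂˣ := (z.nu g h k)⁻¹ * z.nu g k h * (z.nu k g h)⁻¹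

/-- `(ρ²_{g,h})_X = M(x, λ(h,g)) ν(k,h,g) ν(h,k,g)⁻¹ ν(h,g,k)` for `X = (k,x)`, where `M` is the
double braiding. -/
def compositor (g h : G) (X : z.Label) : ℂˣ :=
  monodromy c X.base (z.lam h g) * (z.nu X.deg h g * (z.nu h X.deg g)⁻¹ * z.nu h g X.deg)

lemma tensorator_assoc (k a b d : G) : z.tensorator k a b * z.tensorator k (a * b) d =
    z.tensorator k b d * z.tensorator k a (b * d) := by
  apply Additive.ofMul.injective
  change (-z.addNu a b k + z.addNu a k b + -z.addNu k a b) +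
      (-z.addNu (a * b) d k + z.addNu (a * b) k d + -z.addNu k (a * b) d) =
    (-z.addNu b d k + z.addNu b k d + -z.addNu k b d) +
      (-z.addNu a (b * d) k + z.addNu a k (b * d) + -z.addNu k a (b * d))
  have h1 := z.addNu_pentagon a b d k
  have h2 := z.addNu_pentagon a b k d
  have h3 := z.addNu_pentagon a k b d
  have h4 := z.addNu_pentagon k a b d
  rw [mul_comm k b] at h3
  rw [mul_comm d k] at h1
  rw [mul_comm k a, z.lam_symm k a] at h4
  rw [z.lam_symm k d] at h2
  have := congrArg₂ (· - ·) (congrArg₂ (· + ·) h1 h3) (congrArg₂ (· + ·) h2 h4)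
  beta_reduce at this
  rw [← sub_eq_zero] at this ⊢
  rw [← this]
  abel

lemma addC_add_left (c : Bicharacter B) (x y w : B) : addC c (x + y) w = addC c x w + addC c y w :=
  congrArg Additive.ofMul (c.add_left x y w)

lemma addC_add_right (c : Bicharacter B) (x y w : B) : addC c x (y + w) = addC c x y + addC c x w :=
  congrArg Additive.ofMul (c.add_right x y w)

lemma compositor_mul (g h : G) (X Y : z.Label) :
    z.tensorator g X.deg Y.deg * z.tensorator h X.deg Y.deg * z.compositor g h (X * Y) =
      z.compositor g h X * z.compositor g h Y * z.tensorator (h * g) X.deg Y.deg := by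
  obtain ⟨a, x⟩ := X
  obtain ⟨b, y⟩ := Y
  apply Additive.ofMul.injective
  change (-z.addNu a b g + z.addNu a g b + -z.addNu g a b) +
      (-z.addNu a b h + z.addNu a h b + -z.addNu h a b) +
      ((addC c (x + y + z.lam a b) (z.lam h g) + addC c (z.lam h g) (x + y + z.lam a b)) +
        (z.addNu (a * b) h g + -z.addNu h (a * b) g + z.addNu h g (a * b))) =
    ((addC c x (z.lam h g) + addC c (z.lam h g) x) +
        (z.addNu a h g + -z.addNu h a g + z.addNu h g a)) +
      ((addC c y (z.lam h g) + addC c (z.lam h g) y) +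
        (z.addNu b h g + -z.addNu h b g + z.addNu h g b)) +
      (-z.addNu a b (h * g) + z.addNu a (h * g) b + -z.addNu (h * g) a b)
  have h1 := z.addNu_pentagon a b h g
  have h2 := z.addNu_pentagon a h b g
  have h3 := z.addNu_pentagon a h g b
  have h4 := z.addNu_pentagon h a b g
  have h5 := z.addNu_pentagon h a g b
  have h6 := z.addNu_pentagon h g a b
  rw [mul_comm h b] at h2
  rw [mul_comm g b, z.lam_symm g b] at h3
  rw [mul_comm h a, z.lam_symm h a] at h4
  rw [mul_comm h a, z.lam_symm h a, z.lam_symm g b] at h5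
  rw [mul_comm g a] at h6
  simp only [addC_add_left, addC_add_right]
  generalize z.addNu = n at *
  generalize addC c = m at *
  grind only

lemma compositor_assoc (g h k : G) (X : z.Label) :
    z.compositor h k X * z.compositor g (k * h) X = z.compositor g h X * z.compositor (h * g) k X := by
  obtain ⟨a, x⟩ := X
  apply Additive.ofMul.injective
  change ((addC c x (z.lam k h) + addC c (z.lam k h) x) +
        (z.addNu a k h + -z.addNu k a h + z.addNu k h a)) +
      ((addC c x (z.lam (k * h) g) + addC c (z.lam (k * h) g) x) +
        (z.addNu a (k * h) g + -z.addNu (k * h) a g + z.addNu (k * h) g a)) =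
    ((addC c x (z.lam h g) + addC c (z.lam h g) x) +
        (z.addNu a h g + -z.addNu h a g + z.addNu h g a)) +
      ((addC c x (z.lam k (h * g)) + addC c (z.lam k (h * g)) x) +
        (z.addNu a k (h * g) + -z.addNu k a (h * g) + z.addNu k (h * g) a))
  have h1 := z.addNu_pentagon a k h g
  have h2 := z.addNu_pentagon k a h g
  have h3 := z.addNu_pentagon k h a g
  have h4 := z.addNu_pentagon k h g a
  have h5 := congrArg (addC c x) (z.lam_cocycle k h g)
  have h6 := congrArg (fun t => addC c t x) (z.lam_cocycle k h g)
  simp only [addC_add_left, addC_add_right] at h5 h6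
  rw [mul_comm k a, z.lam_symm k a] at h2
  rw [mul_comm h a, z.lam_symm a g] at h3
  rw [mul_comm g a] at h4
  have := congrArg₂ (· + ·) (congrArg₂ (· - ·) (congrArg₂ (· + ·) h1 h3) (congrArg₂ (· + ·) h2 h4))
    (congrArg₂ (· + ·) h5 h6)
  beta_reduce at this
  rw [← sub_eq_zero] at this ⊢
  rw [← this]
  abel

/-- The coherence data of the zested `G`-action, which is trivial on objects and morphisms. -/
def actionData : GrVec.ActionData G z.Label where
  tens k X Y := z.tensorator k X.deg Y.deg
  comp g h X := z.compositor g h X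
  tens_assoc k X Y Z := z.tensorator_assoc k X.deg Y.deg Z.deg
  tens_one_left k X := by simp [tensorator, nu_one_left, nu_unit]
  tens_one_right k X := by simp [tensorator, nu_one_right, nu_unit]
  tens_one X Y := by simp [tensorator, nu_one_left, nu_one_right, nu_unit]
  comp_mul g h X Y := z.compositor_mul g h X Y
  comp_one g h := by
    simp [compositor, monodromy, c.zero_left, c.zero_right, nu_one_left, nu_one_right, nu_unit]
  comp_assoc g h k X := z.compositor_assoc g h k X
  comp_one_left g X := by
    simp [compositor, monodromy, c.zero_left, c.zero_right, nu_one_right, nu_unit,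
      lam_one_right]
  comp_one_right g X := by
    simp [compositor, monodromy, c.zero_left, c.zero_right, nu_one_left, nu_unit,
      lam_one_left]

/-- The `G`-action on the zested extension. -/
abbrev action : MonoidalAction G z.Cat := GrVec.action z.cocycle z.actionData

end ZestingDatum

namespace ZestingDatum

variable {G : Type} [CommGroup G] {B : Type} [AddCommGroup B] {c : Bicharacter B}
  (z : ZestingDatum G c)

/-- The one-dimensional object with the given label. -/
abbrev simple (X : z.Label) : z.Cat := GrVec.simple z.cocycle X

/-- `cb` is the zested `G`-braiding: `C_g` consists of the objects all of whose constituents have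
degree `g`, and basis vectors of labels `X`, `Y` braid with the scalar `c(X,Y)` of their underlying
objects in `B`. -/
structure IsZestedBraiding (cb : CrossedBraiding z.action) : Prop where
  sector_iff : ∀ g (X : z.Cat), cb.sector g X ↔ ∀ i, (X.deg i).deg = g
  braid_entry : ∀ (X : z.Cat) {h : G} {Y : z.Cat} (hY : cb.sector h Y) (i : X.ι) (j : Y.ι) (k : Y.ι)
    (l : X.ι), GrVec.entry (cb.braid X hY).hom (GrVec.pair i j) (GrVec.pair (X := Y) (Y := X) k l) =
      if k = j ∧ l = i then (c.toFun (X.deg i).base (Y.deg j).base : ℂ) else 0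

/-- Multiplication by `s`, as an isomorphism `ρ_g X ≅ X`. -/
def scalarIso (X : z.Label) (s : ℂˣ) (g : G) : (z.action.ρ g).obj (z.simple X) ≅ z.simple X :=
  GrVec.diag (z.simple X) (fun _ => s)

end ZestingDatum

/-! ### The toric code and its zestings by `ℤ/2 = {1,-1}` -/

/-- The function of `g ∈ {1,-1}` equal to `1` at `1` and to `x` at `-1`. -/
def atNeg (x : ℂˣ) (g : ℤˣ) : ℂˣ := if g = 1 then 1 else x

/-- The normalised function on pairs in `{1,-1}` with value `x` at `(-1,-1)`. -/
def atNegNeg (x : ℂˣ) (g h : ℤˣ) : ℂˣ := if g = 1 ∨ h = 1 then 1 else x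

/-- The imaginary unit. -/
def iU : ℂˣ := Units.mk0 Complex.I Complex.I_ne_zero

/-- The braiding `c(m^k₁ e^l₁, m^k₂ e^l₂) = (-1)^(l₁ k₂)` of `D(ℤ/2)`, where `m^k e^l` is `(k,l)`. -/
def toricBraiding : Bicharacter (ZMod 2 × ZMod 2) where
  toFun x y := (-1) ^ (x.2.val * y.1.val)
  add_left := by
    have h : ∀ a b d : ZMod 2, Even ((a + b).val * d.val) ↔ Even (a.val * d.val + b.val * d.val) := by
      decide
    intro x y w
    rw [← pow_add]
    exact neg_one_pow_congr (h x.2 y.2 w.1)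
  add_right := by
    have h : ∀ a b d : ZMod 2, Even (d.val * (a + b).val) ↔ Even (d.val * a.val + d.val * b.val) := by
      decide
    intro w x y
    rw [← pow_add]
    exact neg_one_pow_congr (h x.1 y.1 w.2)

/-- The fusion category of the toric code `D(ℤ/2) ≅ ℤ/2-Vect ⊠ Rep(ℤ/2)`. -/
abbrev ToricCode := PointedCat (ZMod 2 × ZMod 2)

/-- The fusion category `D(ℤ/4) ≅ ℤ/4-Vect ⊠ Rep(ℤ/4)`; here `m^k e^l` is `(k,l)`. -/
abbrev DZ4 := PointedCat (ZMod 4 × ZMod 4)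

/-- `ℤ/2`-zesting data for the trivial `ℤ/2`-extension `ℤ/2-Vect ⊠ D(ℤ/2)`. -/
abbrev ToricZesting := ZestingDatum ℤˣ toricBraiding

/-- The underlying object of a simple object of the equivariantisation: `m^k e^l ↦ m^(k mod 2) e^l`. -/
def underlying (x : ZMod 4 × ZMod 4) : ZMod 2 × ZMod 4 := ((x.1.val : ZMod 2), x.2)

/-- The parity in `{0,1}` of an element of `ℤ/4`. -/
def parity (l : ZMod 4) : ℕ := l.val % 2

/-- `⌊l/2⌋` for `l ∈ {0,1,2,3}`. -/
def halfFloor (l : ZMod 4) : ℕ := l.val / 2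

namespace ToricZesting

variable (z : ToricZesting)

/-- A simple object with the equivariant structure `u_1 = id`, `u_{-1} = t`. -/
def charged (X : z.Label) (t : ℂˣ) (ht : t ^ 2 = z.compositor (-1) (-1) X) :
    Equivariant z.action :=
  GrVec.equivariantSimple z.actionData X (atNeg t) (by
    intro g h
    rcases Int.units_eq_one_or g with rfl | rfl <;> rcases Int.units_eq_one_or h with rfl | rfl
    · simp [atNeg, z.actionData.comp_one_left]
    · simp [atNeg, z.actionData.comp_one_left]
    · simp [atNeg, z.actionData.comp_one_right]
    · change atNeg t (-1) * atNeg t (-1) = z.compositor (-1) (-1) X * atNeg t (-1 * -1)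
      rw [← ht]
      simp [atNeg, sq])

/-- The crossed braided extension `(ℤ/2-Vect ⊠ D(ℤ/2))^(λ,ν)` with its `G`-braiding `cb`, described
explicitly: `T` names the simple objects by `ℤ/2 × ℤ/4`, and the associator, the `G`-braiding, the
tensorator `(ρ²_{-1})_{X,Y}` and the compositor `(ρ²_{-1,-1})_X` are the given scalars. -/
structure ExtensionData (cb : CrossedBraiding z.action) (T : ZMod 2 × ZMod 4 → z.Label)
    (assoc : ZMod 2 × ZMod 4 → ZMod 2 × ZMod 4 → ZMod 2 × ZMod 4 → ℂˣ)
    (braid tens : ZMod 2 × ZMod 4 → ZMod 2 × ZMod 4 → ℂˣ) (comp : ZMod 2 × ZMod 4 → ℂˣ) :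
    Prop where
  zested : z.IsZestedBraiding cb
  extension : cb.IsExtensionOf ToricCode (PointedCat.braided toricBraiding)
  label_add : ∀ x y, T (x + y) = T x * T y
  fusion : IdentifiesFusionRings (fun x => z.simple (T x))
    (fun x => (PointedCat.obj x : PointedCat (ZMod 2 × ZMod 4)))
  associator : ∀ x y w, GrVec.entry (α_ (z.simple (T x)) (z.simple (T y)) (z.simple (T w))).hom
    (GrVec.pair (GrVec.pair () ()) ()) (GrVec.pair () (GrVec.pair () ())) = (assoc x y w : ℂ)
  braiding : ∀ x y {h : ℤˣ} (hY : cb.sector h (z.simple (T y))),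
    GrVec.entry (cb.braid (z.simple (T x)) hY).hom (GrVec.pair () ())
      (GrVec.pair (X := z.simple (T y)) (Y := z.simple (T x)) () ()) = (braid x y : ℂ)
  tensorator : ∀ x y, μ (z.action.ρ (-1)) (z.simple (T x)) (z.simple (T y)) =
    (tens x y : ℂ) • 𝟙 (z.simple (T x) ⊗ z.simple (T y))
  compositor : ∀ x, (z.action.comp (-1) (-1)).hom.app (z.simple (T x)) =
    (comp x : ℂ) • 𝟙 (z.simple (T x))

/-- The `ℤ/2`-equivariantisation of the extension, described explicitly. For the isomorphisms
`ν_{-1} : ρ_{-1} Y ≅ Y` the projective cocycle of `Y` has `β_Y(-1,-1) = β Y`. The simple objects are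
named by the simple objects `x = m^k e^l` of `D(ℤ/4)`; the one named `x` has underlying object
`T (underlying x)` and equivariant structure `u_{-1} = sub x • ν_{-1}`, where the subscript `sub x` is
the value at `-1` of a projective representation for `β`. -/
structure EquivariantisationData (cb : CrossedBraiding z.action) (T : ZMod 2 × ZMod 4 → z.Label)
    (ν β : ZMod 2 × ZMod 4 → ℂˣ) (sub : ZMod 4 × ZMod 4 → ℂˣ)
    (assoc : ZMod 4 × ZMod 4 → ZMod 4 × ZMod 4 → ZMod 4 × ZMod 4 → ℂˣ)
    (braid : ZMod 4 × ZMod 4 → ZMod 4 × ZMod 4 → ℂˣ) : Prop where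
  cocycle : ∀ y, IsProjectiveCocycle z.action (z.simple (T y))
    (fun g => z.scalarIso (T y) (atNeg (ν y) g) g) (atNegNeg (β y))
  projective : ∀ x, sub x ^ 2 = β (underlying x)
  simples : ∃ h : ∀ x, (sub x * ν (underlying x)) ^ 2 =
      z.compositor (-1) (-1) (T (underlying x)),
    let S : ZMod 4 × ZMod 4 → Equivariant z.action := fun x =>
      z.charged (T (underlying x)) (sub x * ν (underlying x)) (h x)
    IdentifiesFusionRings S (fun x => (PointedCat.obj x : DZ4)) ∧
    Nonempty (S 0 ≅ 𝟙_ _) ∧ (∀ x y, Nonempty (S x ⊗ S y ≅ S (x + y))) ∧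
    (∀ x y w, GrVec.entry (α_ (S x) (S y) (S w)).hom.f (GrVec.pair (GrVec.pair () ()) ())
      (GrVec.pair () (GrVec.pair () ())) = (assoc x y w : ℂ)) ∧
    (∃ b : BraidedCategory (Equivariant z.action), cb.IsEquivariantBraiding b) ∧
    ∀ b : BraidedCategory (Equivariant z.action), cb.IsEquivariantBraiding b →
      ∀ x y, GrVec.entry (b.braiding (S x) (S y)).hom.f (GrVec.pair () ()) (GrVec.pair () ()) =
        (braid x y : ℂ)

/-! Fractionalisation `λ(-1,-1) = e`; here `(k,l)` is `m^k e^l`. -/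

/-- `m^k e^l` has degree `(-1)^l` and underlying object `m^k e^⌊l/2⌋` in `D(ℤ/2)`. -/
def labelE (x : ZMod 2 × ZMod 4) : z.Label := ⟨(-1) ^ x.2.val, (x.1, (halfFloor x.2 : ZMod 2))⟩

def assocE (p : ℂˣ) (x y w : ZMod 2 × ZMod 4) : ℂˣ :=
  (-1) ^ (x.2.val * y.2.val * w.1.val) * p ^ (parity x.2 * parity y.2 * parity w.2)

def braidE (x y : ZMod 2 × ZMod 4) : ℂˣ := (-1) ^ (halfFloor x.2 * y.1.val)

/-! Fractionalisation `λ(-1,-1) = f`; here `(k,j)` is `m^k f^j`. -/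

/-- `m^k f^j` has degree `(-1)^j` and underlying object `m^k f^⌊j/2⌋` in `D(ℤ/2)`. -/
def labelF (x : ZMod 2 × ZMod 4) : z.Label :=
  ⟨(-1) ^ x.2.val, (x.1 + (halfFloor x.2 : ZMod 2), (halfFloor x.2 : ZMod 2))⟩

def assocF (p : ℂˣ) (x y w : ZMod 2 × ZMod 4) : ℂˣ :=
  (-1) ^ (x.2.val * y.2.val * (w.1.val + halfFloor w.2)) *
    p ^ (parity x.2 * parity y.2 * parity w.2)

def braidF (x y : ZMod 2 × ZMod 4) : ℂˣ := (-1) ^ (halfFloor x.2 * (y.1.val + halfFloor y.2))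

/-! Data given by the same formula in both cases. -/

def tens (p : ℂˣ) (x y : ZMod 2 × ZMod 4) : ℂˣ := p⁻¹ ^ (parity x.2 * parity y.2)

def comp (p : ℂˣ) (x : ZMod 2 × ZMod 4) : ℂˣ := (-1) ^ x.1.val * p ^ parity x.2

end ToricZesting

end

noncomputable section

/-! ### Families of pairwise orthogonal absolutely simple objects -/

section Schur

universe v u

variable {C : Type u} [Category.{v} C] [Preadditive C] [Linear ℂ C]

/-- Pairwise orthogonal objects with scalar endomorphisms into which every object decomposes. -/
structure IsSchurFamily {I : Type} (S : I → C) : Prop where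
  hom_eq_zero : ∀ {i j}, i ≠ j → ∀ f : S i ⟶ S j, f = 0
  hom_eq_smul : ∀ {i} (f : S i ⟶ S i), ∃ c : ℂ, f = c • 𝟙 (S i)
  id_ne_zero : ∀ i, 𝟙 (S i) ≠ 0
  decompose : ∀ X : C, ∃ (K : Type) (_ : Fintype K) (x : K → I) (i : ∀ k, S (x k) ⟶ X)
    (p : ∀ k, X ⟶ S (x k)), (∀ k, i k ≫ p k = 𝟙 _) ∧ (∀ k l, k ≠ l → i k ≫ p l = 0) ∧
      ∑ k, p k ≫ i k = 𝟙 X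

namespace IsSchurFamily

variable {I : Type} {S : I → C} (hS : IsSchurFamily S)

include hS

lemma isIso_of_ne_zero {i j : I} (f : S i ⟶ S j) (hf : f ≠ 0) : IsIso f := by
  by_cases hij : i = j
  · subst hij
    obtain ⟨c, rfl⟩ := hS.hom_eq_smul f
    have hc : c ≠ 0 := fun h => hf (by rw [h, zero_smul])
    exact ⟨c⁻¹ • 𝟙 _, by simp [smul_smul, hc], by simp [smul_smul, hc]⟩
  · exact absurd (hS.hom_eq_zero hij f) hf

lemma eq_of_iso {i j : I} (e : S i ≅ S j) : i = j := by
  by_contra h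
  apply hS.id_ne_zero i
  rw [← e.hom_inv_id, hS.hom_eq_zero h e.hom, Limits.zero_comp]

lemma isSimple (i : I) : Simple (S i) where
  mono_isIso_iff_nonzero {Y} f _ := by
    constructor
    · rintro _ rfl
      exact hS.id_ne_zero i (by rw [← IsIso.inv_hom_id (0 : Y ⟶ S i), Limits.comp_zero])
    · intro hf
      obtain ⟨K, _, x, a, p, -, -, hsum⟩ := hS.decompose Y
      have : ∃ k, a k ≫ f ≠ 0 := by
        by_contra! h
        apply hf
        rw [← Category.id_comp f, ← hsum, Preadditive.sum_comp]
        exact Finset.sum_eq_zero fun k _ => by rw [Category.assoc, h, Limits.comp_zero]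
      obtain ⟨k, hk⟩ := this
      have := hS.isIso_of_ne_zero _ hk
      have hs : (inv (a k ≫ f) ≫ a k) ≫ f = 𝟙 _ := by
        rw [Category.assoc, IsIso.inv_hom_id]
      have : IsSplitEpi f := ⟨⟨⟨_, hs⟩⟩⟩
      exact isIso_of_mono_of_isSplitEpi f

lemma isSimpleBasis : IsSimpleBasis S where
  simple := hS.isSimple
  distinct _ _ := fun ⟨e⟩ => hS.eq_of_iso e
  complete X hX := by
    obtain ⟨K, _, x, a, p, hap, -, hsum⟩ := hS.decompose X
    have : Nonempty K := by
      by_contra h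
      rw [not_nonempty_iff] at h
      exact Simple.not_isZero X ((Limits.IsZero.iff_id_eq_zero X).2 (by rw [← hsum]; simp))
    obtain ⟨k⟩ := this
    have hs : IsSplitMono (a k) := ⟨⟨⟨p k, hap k⟩⟩⟩
    have h0 : a k ≠ 0 := fun h => hS.id_ne_zero (x k) (by rw [← hap k, h, Limits.zero_comp])
    have := isIso_of_mono_of_nonzero h0
    exact ⟨x k, ⟨(asIso (a k)).symm⟩⟩
  semisimple X := by
    classical
    obtain ⟨K, _, x, a, p, hap, hne, hsum⟩ := hS.decompose X
    let e := (Fintype.equivFin K).symm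
    let b : Limits.Bicone fun k => S (x (e k)) :=
      { pt := X
        π := fun k => p (e k)
        ι := fun k => a (e k)
        ι_π := fun k l => by
          by_cases h : k = l
          · subst h
            simp [hap]
          · rw [dif_neg h]
            exact hne _ _ fun h' => h (e.injective h') }
    exact ⟨_, fun k => x (e k), b,
      ⟨Limits.isBilimitOfTotal b ((e.sum_comp fun k => p k ≫ a k).trans hsum)⟩, ⟨Iso.refl _⟩⟩

lemma finrank_hom [DecidableEq I] (i j : I) :
    Module.finrank ℂ (S i ⟶ S j) = if i = j then 1 else 0 := by
  split_ifs with h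
  · subst h
    refine finrank_eq_one (𝟙 (S i)) (hS.id_ne_zero i) fun f => ?_
    obtain ⟨c, hc⟩ := hS.hom_eq_smul f
    exact ⟨c, hc.symm⟩
  · have : Subsingleton (S i ⟶ S j) :=
      ⟨fun f g => (hS.hom_eq_zero h f).trans (hS.hom_eq_zero h g).symm⟩
    exact Module.finrank_zero_of_subsingleton

lemma finrank_hom_of_iso [DecidableEq I] {X : C} {j : I} (e : X ≅ S j) (i : I) :
    Module.finrank ℂ (S i ⟶ X) = if i = j then 1 else 0 := by
  rw [← hS.finrank_hom i j]
  exact LinearEquiv.finrank_eq (Linear.homCongr ℂ (Iso.refl _) e)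

lemma iso_unit_iff [MonoidalCategory C] [AddGroup I] (h : S 0 ≅ 𝟙_ C) (i : I) :
    Nonempty (S i ≅ 𝟙_ C) ↔ i = 0 :=
  ⟨fun ⟨e⟩ => hS.eq_of_iso (e ≪≫ h.symm), fun hi => ⟨hi ▸ h⟩⟩

/-- Two categories whose simple objects multiply like the same group have the same fusion ring. -/
lemma identifiesFusionRings {D : Type*} [Category D] [Preadditive D] [Linear ℂ D]
    [MonoidalCategory C] [MonoidalCategory D] [AddGroup I] {T : I → D} (hT : IsSchurFamily T)
    (hS0 : Nonempty (S 0 ≅ 𝟙_ C)) (hT0 : Nonempty (T 0 ≅ 𝟙_ D))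
    (hSadd : ∀ i j, Nonempty (S i ⊗ S j ≅ S (i + j)))
    (hTadd : ∀ i j, Nonempty (T i ⊗ T j ≅ T (i + j))) : IdentifiesFusionRings S T where
  basis_left := hS.isSimpleBasis
  basis_right := hT.isSimpleBasis
  unit i := by
    obtain ⟨a⟩ := hS0
    obtain ⟨b⟩ := hT0
    rw [hS.iso_unit_iff a, hT.iso_unit_iff b]
  coeff i j k := by
    classical
    obtain ⟨a⟩ := hSadd i j
    obtain ⟨b⟩ := hTadd i j
    rw [hS.finrank_hom_of_iso a, hT.finrank_hom_of_iso b]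

end IsSchurFamily

end Schur

/-! ### Simple objects of graded vector spaces -/

namespace GrVec

variable {A : Type} [Group A] {w : ThreeCocycle A}

lemma entry_zero {X Y : GrVec w} (i : X.ι) (j : Y.ι) : entry (0 : X ⟶ Y) i j = 0 := rfl

lemma entry_smul {X Y : GrVec w} (c : ℂ) (f : X ⟶ Y) (i : X.ι) (j : Y.ι) :
    entry (c • f) i j = c * entry f i j := rfl

lemma entry_sum {X Y : GrVec w} {K : Type} (s : Finset K) (f : K → (X ⟶ Y)) (i : X.ι) (j : Y.ι) :
    entry (∑ k ∈ s, f k) i j = ∑ k ∈ s, entry (f k) i j :=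
  map_sum (G := (X ⟶ Y) →+ ℂ) ⟨⟨fun f => entry f i j, rfl⟩, fun _ _ => rfl⟩ f s

/-- The morphism with the given homogeneous matrix. -/
def ofEntry {X Y : GrVec w} (M : X.ι → Y.ι → ℂ) (h : ∀ i j, M i j ≠ 0 → X.deg i = Y.deg j) :
    X ⟶ Y := ⟨M, h⟩

lemma entry_ofEntry {X Y : GrVec w} (M : X.ι → Y.ι → ℂ) (h) (i : X.ι) (j : Y.ι) :
    entry (ofEntry (X := X) (Y := Y) M h) i j = M i j := rfl

lemma entry_eq_zero {X Y : GrVec w} (f : X ⟶ Y) {i : X.ι} {j : Y.ι} (h : X.deg i ≠ Y.deg j) :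
    entry f i j = 0 := by
  by_contra h'
  exact h (entry_deg f h')

/-- The basis vector of a one-dimensional space. -/
def base (w : ThreeCocycle A) (a : A) : (simple w a).ι := ()

lemma sum_base {a : A} (F : (simple w a).ι → ℂ) : ∑ j, F j = F (base w a) :=
  Fintype.sum_unique (ι := Unit) F

lemma simple_hom_ext {a b : A} {f g : simple w a ⟶ simple w b}
    (h : entry f (base w a) (base w b) = entry g (base w a) (base w b)) : f = g :=
  hom_ext fun _ _ => h

lemma simple_hom_eq_smul {a : A} (f : simple w a ⟶ simple w a) :
    f = entry f (base w a) (base w a) • 𝟙 (simple w a) :=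
  simple_hom_ext (by rw [entry_smul, entry_id, if_pos rfl, mul_one])

lemma id_simple_ne_zero (a : A) : 𝟙 (simple w a) ≠ 0 := fun h => by
  have := congrArg (fun f => entry f (base w a) (base w a)) h
  simp only [entry_id, if_pos, entry_zero, one_ne_zero] at this

/-- Inclusion of a basis vector. -/
def incl (X : GrVec w) (k : X.ι) {a : A} (h : a = X.deg k) : simple w a ⟶ X :=
  ofEntry (X := simple w a) (fun _ j => if j = k then 1 else 0) fun _ j hj => by
    by_cases hk : j = k
    · rw [hk]; exact h
    · simp [hk] at hj

/-- Projection to a basis vector. -/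
def proj (X : GrVec w) (k : X.ι) {a : A} (h : a = X.deg k) : X ⟶ simple w a :=
  ofEntry (Y := simple w a) (fun j _ => if j = k then 1 else 0) fun j _ hj => by
    by_cases hk : j = k
    · rw [hk]; exact h.symm
    · simp [hk] at hj

/-- One-dimensional spaces of every degree, listed along a bijection, form a Schur family. -/
lemma isSchurFamily {I : Type} {T : I → A} (hT : Function.Bijective T) :
    IsSchurFamily (fun i => simple w (T i)) where
  hom_eq_zero {i j} hij f := simple_hom_ext (entry_eq_zero f fun h => hij (hT.1 h))
  hom_eq_smul f := ⟨_, simple_hom_eq_smul f⟩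
  id_ne_zero i := id_simple_ne_zero _
  decompose X := by
    choose x hx using fun k : X.ι => hT.2 (X.deg k)
    refine ⟨X.ι, inferInstance, x, fun k => incl X k (hx k), fun k => proj X k (hx k), ?_, ?_, ?_⟩
    · intro k
      refine simple_hom_ext ?_
      rw [entry_comp, entry_id, if_pos rfl]
      simp only [incl, proj, entry_ofEntry]
      simp
    · intro k l hkl
      refine simple_hom_ext ?_
      rw [entry_comp, entry_zero]
      simp only [incl, proj, entry_ofEntry]
      simp [hkl.symm]
    · ext i j
      have h : ∀ k, entry (proj X k (hx k) ≫ incl X k (hx k)) i j =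
          if i = k then (if j = k then 1 else 0) else 0 := fun k => by
        rw [entry_comp, sum_base]
        simp only [incl, proj, entry_ofEntry, ite_zero_mul, one_mul]
      rw [entry_sum, Finset.sum_congr rfl fun k _ => h k, entry_id]
      simp [eq_comm]

/-- `simple a ⊗ simple b ≅ simple (a * b)`. -/
def simpleTensor {a b c : A} (h : a * b = c) : simple w a ⊗ simple w b ≅ simple w c :=
  monoIso (X := simple w a ⊗ simple w b) (Y := simple w c) (Equiv.punitProd Unit) (fun _ => 1)
    fun _ => h

/-- `simple 1` is the tensor unit. -/
def simpleUnit {a : A} (h : a = 1) : simple w a ≅ 𝟙_ (GrVec w) :=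
  monoIso (X := simple w a) (Y := simple w 1) (Equiv.refl _) (fun _ => 1) fun _ => h

end GrVec

lemma PointedCat.isSchurFamily (B : Type) [AddCommGroup B] :
    IsSchurFamily (fun x : B => (PointedCat.obj x : PointedCat B)) :=
  GrVec.isSchurFamily Multiplicative.ofAdd.bijective

namespace GrVec

variable {A : Type} [Group A] {w : ThreeCocycle A}

lemma associator_inv_hom (X Y Z : GrVec w) : (α_ X Y Z).inv =
    mono (assocEquiv X Y Z).symm (fun j =>
      ((w.toFun (X.deg j.1) (Y.deg j.2.1) (Z.deg j.2.2))⁻¹ : ℂˣ))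
      (fun i => by rw [assoc_deg, Equiv.apply_symm_apply]) := by
  ext i j
  exact if_congr Iff.rfl rfl rfl

end GrVec

/-! ### The zested crossed braiding -/

namespace ZestingDatum

open Functor.LaxMonoidal Functor.OplaxMonoidal Functor.Monoidal GrVec

variable {G : Type} [CommGroup G] {B : Type} [AddCommGroup B] {c : Bicharacter B}
  (z : ZestingDatum G c)

/-- The scalar by which homogeneous vectors braid. -/
def braidScalar (X Y : z.Label) : ℂˣ := c.toFun X.base Y.base

lemma braidScalar_mul_left (X Y Z : z.Label) :
    z.braidScalar (X * Y) Z = z.cocycle.toFun X Y Z * z.braidScalar Y Z *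
      (z.cocycle.toFun X Z Y)⁻¹ * z.braidScalar X Z * z.cocycle.toFun Z X Y *
        z.tensorator Z.deg X.deg Y.deg := by
  simp only [braidScalar, Label.mul_base, c.add_left, cocycle_toFun, tensorator,
    z.lam_symm Z.deg X.deg]
  apply Additive.ofMul.injective
  simp only [ofMul_mul, ofMul_inv]
  abel

lemma braidScalar_mul_right (X Y Z : z.Label) :
    z.braidScalar X (Y * Z) = (z.cocycle.toFun X Y Z)⁻¹ * z.braidScalar X Y *
      z.cocycle.toFun Y X Z * z.braidScalar X Z * (z.cocycle.toFun Y Z X)⁻¹ *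
        z.compositor Z.deg Y.deg X := by
  simp only [braidScalar, Label.mul_base, c.add_right, cocycle_toFun, compositor, monodromy,
    z.lam_symm Y.deg X.deg]
  apply Additive.ofMul.injective
  simp only [ofMul_mul, ofMul_inv]
  abel

lemma tensorator_mul_compositor (g : G) (X Y : z.Label) :
    z.tensorator g X.deg Y.deg * z.compositor g Y.deg X =
      z.compositor Y.deg g X * z.tensorator g Y.deg X.deg := by
  simp only [compositor, tensorator, z.lam_symm g Y.deg]
  apply Additive.ofMul.injective
  simp only [ofMul_mul, ofMul_inv]
  abel

def swapEquiv (X Y : z.Cat) : (X ⊗ Y).ι ≃ (Y ⊗ X).ι := Equiv.prodComm X.ι Y.ι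

lemma swap_deg (X Y : z.Cat) (i : (X ⊗ Y).ι) :
    (X ⊗ Y).deg i = (Y ⊗ X).deg (z.swapEquiv X Y i) := mul_comm _ _

/-- The `G`-braiding on basis vectors. -/
def braidIso (X Y : z.Cat) : X ⊗ Y ≅ Y ⊗ X :=
  monoIso (z.swapEquiv X Y) (fun i => z.braidScalar (X.deg i.1) (Y.deg i.2)) (z.swap_deg X Y)

lemma braidIso_hom (X Y : z.Cat) : (z.braidIso X Y).hom =
    mono (z.swapEquiv X Y) (fun i => z.braidScalar (X.deg i.1) (Y.deg i.2)) (z.swap_deg X Y) := rfl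

/-- The objects all of whose constituents have degree `g`. -/
def sector (g : G) : ObjectProperty z.Cat := fun X => ∀ i, (X.deg i).deg = g

/-- The homogeneous component of degree `g`. -/
def component [DecidableEq G] (X : z.Cat) (g : G) : z.Cat where
  ι := {i : X.ι // (X.deg i).deg = g}
  deg i := X.deg i

def componentIncl [DecidableEq G] (X : z.Cat) (g : G) : z.component X g ⟶ X :=
  ofEntry (X := z.component X g) (fun i j => if i.1 = j then 1 else 0) fun i j h => by
    by_cases hij : i.1 = j
    · exact congrArg X.deg hij
    · simp [hij] at h

def componentProj [DecidableEq G] (X : z.Cat) (g : G) : X ⟶ z.component X g :=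
  ofEntry (Y := z.component X g) (fun j i => if i.1 = j then 1 else 0) fun j i h => by
    by_cases hij : i.1 = j
    · exact (congrArg X.deg hij).symm
    · simp [hij] at h

lemma entry_incl_comp_proj [DecidableEq G] (X : z.Cat) {g h : G} (i : {i // (X.deg i).deg = g})
    (j : {i // (X.deg i).deg = h}) :
    entry (X := z.component X g) (Y := z.component X h) (z.componentIncl X g ≫ z.componentProj X h)
      i j = if i.1 = j.1 then 1 else 0 := by
  refine (entry_comp _ _ _ _).trans ?_
  change ∑ k, (if i.1 = k then (1 : ℂ) else 0) * (if j.1 = k then 1 else 0) = _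
  simp [eq_comm]

def componentBicone [DecidableEq G] (X : z.Cat) : Limits.Bicone (z.component X) where
  pt := X
  π := z.componentProj X
  ι := z.componentIncl X
  ι_π g h := by
    split_ifs with hgh
    · subst hgh
      refine hom_ext fun i j => (z.entry_incl_comp_proj X i j).trans ?_
      rw [eqToHom_refl, entry_id]
      exact if_congr Subtype.ext_iff.symm rfl rfl
    · refine hom_ext fun i j => (z.entry_incl_comp_proj X i j).trans ?_
      rw [if_neg, entry_zero]
      intro hij
      exact hgh (i.2.symm.trans ((congrArg (fun k => (X.deg k).deg) hij).trans j.2))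

lemma componentBicone_total [DecidableEq G] [Fintype G] (X : z.Cat) :
    ∑ g, (z.componentBicone X).π g ≫ (z.componentBicone X).ι g = 𝟙 X := by
  have h : ∀ g i j, entry (z.componentProj X g ≫ z.componentIncl X g) i j =
      if i = j then (if (X.deg i).deg = g then 1 else 0) else 0 := by
    intro g i j
    rw [entry_comp]
    change ∑ k : {k // (X.deg k).deg = g}, (if k.1 = i then (1 : ℂ) else 0) *
      (if k.1 = j then 1 else 0) = _
    by_cases hi : (X.deg i).deg = g
    · rw [Finset.sum_eq_single ⟨i, hi⟩]
      · simp [hi]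
      · intro k _ hk
        rw [if_neg (fun h => hk (Subtype.ext h)), zero_mul]
      · simp
    · rw [if_neg hi, ite_self]
      refine Finset.sum_eq_zero fun k _ => ?_
      rw [if_neg, zero_mul]
      rintro rfl
      exact hi k.2
  refine hom_ext (X := X) (Y := X) fun i j => ?_
  change entry (∑ g, z.componentProj X g ≫ z.componentIncl X g) i j = _
  rw [entry_sum, Finset.sum_congr rfl fun g _ => h g i j, entry_id]
  simp

lemma exists_entry_ne_zero {X Y : z.Cat} (e : X ≅ Y) (j : Y.ι) : ∃ i, entry e.hom i j ≠ 0 := by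
  by_contra! h
  have h1 : entry (e.inv ≫ e.hom) j j = 1 := by rw [e.inv_hom_id, entry_id, if_pos rfl]
  rw [entry_comp, Finset.sum_eq_zero fun i _ => by rw [h, mul_zero]] at h1
  exact zero_ne_one h1

/-- The zested extension is `G`-crossed braided. -/
def crossedBraiding [DecidableEq G] [Fintype G] : CrossedBraiding z.action where
  sector := z.sector
  sector_iso e hX j := by
    obtain ⟨i, hi⟩ := z.exists_entry_ne_zero e j
    rw [← entry_deg _ hi]
    exact hX i
  sector_unit _ := rfl
  sector_tensor hX hY i := congrArg₂ (· * ·) (hX i.1) (hY i.2)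
  sector_hom hgh hX hY f := hom_ext fun i j => entry_eq_zero f fun h =>
    hgh ((hX i).symm.trans ((congrArg Label.deg h).trans (hY j)))
  sector_sum X := ⟨z.component X, z.componentBicone X, fun _ i => i.2,
    ⟨Limits.isBilimitOfTotal _ (z.componentBicone_total X)⟩, ⟨Iso.refl _⟩⟩
  sector_action g h X hX i := by
    rw [mul_right_comm, inv_mul_cancel, one_mul]
    exact hX i
  braid X _ Y _ := z.braidIso X Y
  natural_left {X X'} f h Y hY := by
    change f ▷ Y ≫ (z.braidIso X' Y).hom = (z.braidIso X Y).hom ≫ Y ◁ f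
    ext i j
    rw [braidIso_hom, braidIso_hom, entry_comp_mono, entry_mono_comp]
    obtain ⟨i, i'⟩ := i
    obtain ⟨j', j⟩ := j
    change entry f i j * entry (𝟙 Y) i' j' * (z.braidScalar (X'.deg j) (Y.deg j') : ℂ) =
      z.braidScalar (X.deg i) (Y.deg i') * (entry (𝟙 Y) i' j' * entry f i j)
    by_cases h1 : entry f i j = 0
    · simp [h1]
    by_cases h2 : entry (𝟙 Y) i' j' = 0
    · simp [h2]
    rw [entry_deg _ h1, entry_deg _ h2]
    ring
  natural_right X h Y Y' hY hY' f := by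
    change X ◁ f ≫ (z.braidIso X Y').hom = (z.braidIso X Y).hom ≫ f ▷ X
    ext i j
    rw [braidIso_hom, braidIso_hom, entry_comp_mono, entry_mono_comp]
    obtain ⟨i', i⟩ := i
    obtain ⟨j, j'⟩ := j
    change entry (𝟙 X) i' j' * entry f i j * (z.braidScalar (X.deg j') (Y'.deg j) : ℂ) =
      z.braidScalar (X.deg i') (Y.deg i) * (entry f i j * entry (𝟙 X) i' j')
    by_cases h1 : entry f i j = 0
    · simp [h1]
    by_cases h2 : entry (𝟙 X) i' j' = 0
    · simp [h2]
    rw [entry_deg _ h1, entry_deg _ h2]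
    ring
  action g X h Y hY := by
    change (tensIso z.actionData g X Y).hom ≫ (z.braidIso X Y).hom = (z.braidIso X Y).hom ≫
      Y ◁ ((compIso z.actionData (g⁻¹ * h * g) g X).hom ≫ 𝟙 X ≫
        (compIso z.actionData g h X).inv) ≫ (tensIso z.actionData g Y X).hom
    rw [mul_right_comm, inv_mul_cancel, one_mul, Category.id_comp]
    have e2 : (compIso z.actionData h g X).hom ≫ (compIso z.actionData g h X).inv =
        (diag X (fun i => z.compositor h g (X.deg i) * (z.compositor g h (X.deg i))⁻¹)).hom := by
      rw [Iso.comp_inv_eq]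
      simp only [compIso, diag_comp_diag]
      exact congrArg Iso.hom (diag_congr fun i => by simp [actionData])
    rw [e2]
    simp only [tensIso, diag_hom, braidIso_hom, whiskerLeft_eq, id_eq_mono, mono_tensor_mono,
      mono_comp_mono]
    refine mono_congr (fun _ => rfl) ?_
    rintro ⟨x, y⟩
    have h1 := z.tensorator_mul_compositor g (X.deg x) (Y.deg y)
    rw [hY y, ← eq_mul_inv_iff_mul_eq] at h1
    have h2 := congrArg Units.val h1
    simp only [Units.val_mul] at h2
    change (z.tensorator g (X.deg x).deg (Y.deg y).deg : ℂ) *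
        z.braidScalar (X.deg x) (Y.deg y) = z.braidScalar (X.deg x) (Y.deg y) *
      (1 * ((z.compositor h g (X.deg x) * (z.compositor g h (X.deg x))⁻¹ : ℂˣ) : ℂ) *
        z.tensorator g (Y.deg y).deg (X.deg x).deg)
    rw [hY y, h2, Units.val_mul]
    ring
  hexagon_right X h k Y Z hY hZ := by
    change (z.braidIso X (Y ⊗ Z)).hom = (α_ X Y Z).inv ≫ (z.braidIso X Y).hom ▷ Z ≫
      (α_ Y X Z).hom ≫ Y ◁ (z.braidIso X Z).hom ≫ (α_ Y Z X).inv ≫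
        (Y ⊗ Z) ◁ (compIso z.actionData k h X).hom
    simp only [compIso, diag_hom, braidIso_hom, whiskerLeft_eq, whiskerRight_eq,
      GrVec.associator_hom, associator_inv_hom, id_eq_mono, mono_tensor_mono, mono_comp_mono]
    refine mono_congr (fun _ => rfl) ?_
    rintro ⟨x, y, t⟩
    have h1 := congrArg Units.val (z.braidScalar_mul_right (X.deg x) (Y.deg y) (Z.deg t))
    rw [hY y, hZ t] at h1
    simp only [Units.val_mul] at h1
    refine Eq.trans h1 ?_
    change _ = (((z.cocycle.toFun (X.deg x) (Y.deg y) (Z.deg t))⁻¹ : ℂˣ) : ℂ) *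
      (z.braidScalar (X.deg x) (Y.deg y) * 1 *
      (z.cocycle.toFun (Y.deg y) (X.deg x) (Z.deg t) *
      (1 * z.braidScalar (X.deg x) (Z.deg t) *
      (((z.cocycle.toFun (Y.deg y) (Z.deg t) (X.deg x))⁻¹ : ℂˣ) *
      (1 * z.compositor k h (X.deg x))))))
    ring
  hexagon_left X Y k Z hZ := by
    change (z.braidIso (X ⊗ Y) Z).hom = (α_ X Y Z).hom ≫ X ◁ (z.braidIso Y Z).hom ≫
      (α_ X Z Y).inv ≫ (z.braidIso X Z).hom ▷ Y ≫ (α_ Z X Y).hom ≫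
        Z ◁ (tensIso z.actionData k X Y).hom
    simp only [tensIso, diag_hom, braidIso_hom, whiskerLeft_eq, whiskerRight_eq,
      GrVec.associator_hom, associator_inv_hom, id_eq_mono, mono_tensor_mono, mono_comp_mono]
    refine mono_congr (fun _ => rfl) ?_
    rintro ⟨⟨x, y⟩, t⟩
    have h1 := congrArg Units.val (z.braidScalar_mul_left (X.deg x) (Y.deg y) (Z.deg t))
    rw [hZ t] at h1
    simp only [Units.val_mul] at h1
    refine Eq.trans h1 ?_
    change _ = (z.cocycle.toFun (X.deg x) (Y.deg y) (Z.deg t) : ℂ) *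
      (1 * z.braidScalar (Y.deg y) (Z.deg t) *
      (((z.cocycle.toFun (X.deg x) (Z.deg t) (Y.deg y))⁻¹ : ℂˣ) *
      (z.braidScalar (X.deg x) (Z.deg t) * 1 *
      (z.cocycle.toFun (Z.deg t) (X.deg x) (Y.deg y) *
      (1 * z.tensorator k (X.deg x).deg (Y.deg y).deg)))))
    ring

lemma crossedBraiding_isZested [DecidableEq G] [Fintype G] :
    z.IsZestedBraiding z.crossedBraiding where
  sector_iff _ _ := Iff.rfl
  braid_entry X h Y hY i j k l := by
    change (if (j, i) = (k, l) then (c.toFun (X.deg i).base (Y.deg j).base : ℂ) else 0) = _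
    refine if_congr ?_ rfl rfl
    rw [Prod.mk_inj, eq_comm, @eq_comm _ i l]

end ZestingDatum

/-! ### The trivial sector of a zested extension -/

namespace ZestingDatum

open Functor.LaxMonoidal Functor.OplaxMonoidal Functor.Monoidal GrVec

variable {G : Type} [CommGroup G] {B : Type} [AddCommGroup B] {c : Bicharacter B}
  (z : ZestingDatum G c)

/-- The simple objects of the trivial sector. -/
def trivialLabel (x : Multiplicative B) : z.Label := ⟨1, x.toAdd⟩

lemma trivialLabel_mul (x y : Multiplicative B) :
    z.trivialLabel (x * y) = z.trivialLabel x * z.trivialLabel y :=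
  Label.ext (one_mul _).symm (by simp [trivialLabel, z.lam_one_left])

lemma cocycle_trivialLabel (x y t : Multiplicative B) :
    z.cocycle.toFun (z.trivialLabel x) (z.trivialLabel y) (z.trivialLabel t) = 1 := by
  simp [trivialLabel, z.lam_one_left, c.zero_left, z.nu_unit]

/-- The embedding of the braided category as the trivial sector. -/
def trivialSector : PointedCat B ⥤ z.Cat where
  obj X := ⟨X.ι, fun i => z.trivialLabel (X.deg i)⟩
  map f := ⟨f.1, fun i j h => congrArg z.trivialLabel (f.2 i j h)⟩

variable (X Y Z : PointedCat B)

def trivialSectorEquiv :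
    (z.trivialSector.obj X ⊗ z.trivialSector.obj Y).ι ≃ (z.trivialSector.obj (X ⊗ Y)).ι :=
  Equiv.refl (X.ι × Y.ι)

lemma trivialSector_tensor_deg (i : (z.trivialSector.obj X ⊗ z.trivialSector.obj Y).ι) :
    (z.trivialSector.obj X ⊗ z.trivialSector.obj Y).deg i =
      (z.trivialSector.obj (X ⊗ Y)).deg (z.trivialSectorEquiv X Y i) :=
  (z.trivialLabel_mul _ _).symm

def trivialSectorμ : z.trivialSector.obj X ⊗ z.trivialSector.obj Y ≅ z.trivialSector.obj (X ⊗ Y) :=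
  monoIso (z.trivialSectorEquiv X Y) (fun _ => 1) (z.trivialSector_tensor_deg X Y)

lemma trivialSectorμ_hom : (z.trivialSectorμ X Y).hom =
    mono (z.trivialSectorEquiv X Y) (fun _ => 1) (z.trivialSector_tensor_deg X Y) := by
  ext i j
  exact if_congr Iff.rfl Units.val_one rfl

variable {X Y}

def trivialSectorMapEquiv (e : X.ι ≃ Y.ι) : (z.trivialSector.obj X).ι ≃ (z.trivialSector.obj Y).ι :=
  e

def trivialSectorScalar (s : X.ι → ℂ) : (z.trivialSector.obj X).ι → ℂ := s

lemma trivialSector_map_deg {e : X.ι ≃ Y.ι} (h : ∀ i, X.deg i = Y.deg (e i))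
    (i : (z.trivialSector.obj X).ι) : (z.trivialSector.obj X).deg i =
      (z.trivialSector.obj Y).deg (z.trivialSectorMapEquiv e i) :=
  congrArg z.trivialLabel (h i)

lemma trivialSector_map_mono (e : X.ι ≃ Y.ι) (s : X.ι → ℂ) (h : ∀ i, X.deg i = Y.deg (e i)) :
    z.trivialSector.map (mono e s h) =
      mono (z.trivialSectorMapEquiv e) (z.trivialSectorScalar s) (z.trivialSector_map_deg h) := rfl

lemma entry_comp_trivialSectorμ {W : z.Cat} (f : W ⟶ z.trivialSector.obj X ⊗ z.trivialSector.obj Y)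
    (i : W.ι) (j : (z.trivialSector.obj (X ⊗ Y)).ι) :
    entry (f ≫ (z.trivialSectorμ X Y).hom) i j =
      entry f i ((z.trivialSectorEquiv X Y).symm j) := by
  rw [trivialSectorμ_hom, entry_comp_mono, mul_one]

lemma entry_trivialSectorμ_comp {W : z.Cat} (f : z.trivialSector.obj (X ⊗ Y) ⟶ W)
    (i : (z.trivialSector.obj X ⊗ z.trivialSector.obj Y).ι) (j : W.ι) :
    entry ((z.trivialSectorμ X Y).hom ≫ f) i j = entry f (z.trivialSectorEquiv X Y i) j := by
  rw [trivialSectorμ_hom, entry_mono_comp, one_mul]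

def trivialSectorCore : z.trivialSector.CoreMonoidal where
  εIso := Iso.refl _
  μIso := z.trivialSectorμ
  μIso_hom_natural_left f Z := by
    refine hom_ext fun i j => ?_
    refine (z.entry_comp_trivialSectorμ _ i j).trans
      (Eq.trans ?_ (z.entry_trivialSectorμ_comp _ i j).symm)
    rfl
  μIso_hom_natural_right Z f := by
    refine hom_ext fun i j => ?_
    refine (z.entry_comp_trivialSectorμ _ i j).trans
      (Eq.trans ?_ (z.entry_trivialSectorμ_comp _ i j).symm)
    rfl
  associativity X Y Z := by
    simp only [trivialSectorμ_hom, GrVec.associator_hom, trivialSector_map_mono, id_eq_mono,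
      whiskerRight_eq, whiskerLeft_eq, mono_tensor_mono, mono_comp_mono]
    refine mono_congr (fun _ => rfl) ?_
    rintro ⟨⟨x, y⟩, t⟩
    change (1 : ℂ) * 1 * (1 * 1) =
      z.cocycle.toFun (z.trivialLabel (X.deg x)) (z.trivialLabel (Y.deg y))
        (z.trivialLabel (Z.deg t)) * (1 * 1 * 1)
    rw [cocycle_trivialLabel, Units.val_one]
    ring
  left_unitality X := by
    change _ = 𝟙 (z.trivialSector.obj (𝟙_ _)) ▷ z.trivialSector.obj X ≫ _
    simp only [trivialSectorμ_hom, GrVec.leftUnitor_hom, trivialSector_map_mono, id_eq_mono,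
      whiskerRight_eq, mono_tensor_mono, mono_comp_mono]
    refine mono_congr (fun _ => rfl) fun _ => ?_
    change (1 : ℂ) = 1 * 1 * (1 * 1)
    simp
  right_unitality X := by
    change _ = z.trivialSector.obj X ◁ 𝟙 (z.trivialSector.obj (𝟙_ _)) ≫ _
    simp only [trivialSectorμ_hom, GrVec.rightUnitor_hom, trivialSector_map_mono, id_eq_mono,
      whiskerLeft_eq, mono_tensor_mono, mono_comp_mono]
    refine mono_congr (fun _ => rfl) fun _ => ?_
    change (1 : ℂ) = 1 * 1 * (1 * 1)
    simp

lemma trivialLabel_injective : Function.Injective z.trivialLabel := fun _ _ h =>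
  congrArg (fun X : z.Label => Multiplicative.ofAdd X.base) h

lemma crossedBraiding_isExtensionOf [DecidableEq G] [Fintype G] :
    z.crossedBraiding.IsExtensionOf (PointedCat B) (PointedCat.braided c) := by
  refine ⟨z.trivialSector, z.trivialSectorCore.toMonoidal, ⟨rfl⟩, ⟨fun _ _ => rfl⟩,
    ⟨fun f => ⟨⟨f.1, fun i j h => z.trivialLabel_injective (f.2 i j h)⟩, rfl⟩⟩,
    ⟨fun h => Subtype.ext (Subtype.ext_iff.1 h :)⟩, fun X => ⟨?_, fun hX => ?_⟩, ?_⟩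
  · rintro ⟨Y, ⟨e⟩⟩
    exact z.crossedBraiding.sector_iso e fun _ => rfl
  · refine ⟨⟨X.ι, fun i => Multiplicative.ofAdd (X.deg i).base⟩,
      ⟨monoIso (Equiv.refl X.ι) (fun _ => 1) fun i => ?_⟩⟩
    exact Label.ext (hX i).symm rfl
  · intro X Y hY
    change (z.trivialSectorμ X Y).hom ≫ z.trivialSector.map (PointedCat.braidIso c X Y).hom =
      (z.braidIso (z.trivialSector.obj X) (z.trivialSector.obj Y)).hom ≫
        z.trivialSector.obj Y ◁ 𝟙 (z.trivialSector.obj X) ≫ (z.trivialSectorμ Y X).hom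
    simp only [trivialSectorμ_hom, PointedCat.braidIso_hom, braidIso_hom, trivialSector_map_mono,
      id_eq_mono, whiskerLeft_eq, mono_tensor_mono, mono_comp_mono]
    refine mono_congr (fun _ => rfl) ?_
    rintro ⟨x, y⟩
    change (1 : ℂ) * c.toFun (X.deg x).toAdd (Y.deg y).toAdd =
      c.toFun (X.deg x).toAdd (Y.deg y).toAdd * (1 * 1 * 1)
    ring

end ZestingDatum

/-! ### The braiding of the equivariantisation -/

namespace ZestingDatum

open Functor.LaxMonoidal Functor.OplaxMonoidal Functor.Monoidal GrVec

variable {G : Type} [CommGroup G] {B : Type} [AddCommGroup B] {c : Bicharacter B}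
  {z : ZestingDatum G c}

/-- The equivariant structure as an automorphism: the group acts trivially on objects. -/
def actIso (X : Equivariant z.action) (g : G) : X.obj ≅ X.obj := X.u g

/-- The matrix entries of the equivariant structure. -/
def actEntry (X : Equivariant z.action) (g : G) (i j : X.obj.ι) : ℂ := entry (actIso X g).hom i j

lemma actEntry_deg {X : Equivariant z.action} {g : G} {i j : X.obj.ι} (h : actEntry X g i j ≠ 0) :
    X.obj.deg i = X.obj.deg j := entry_deg _ h

lemma sum_actEntry (X : Equivariant z.action) (g h : G) (i j : X.obj.ι) :
    ∑ k, actEntry X h i k * actEntry X g k j =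
      z.compositor g h (X.obj.deg i) * actEntry X (h * g) i j := by
  have key : (actIso X h).hom ≫ (actIso X g).hom =
      (compIso z.actionData g h X.obj).hom ≫ (actIso X (h * g)).hom := X.coherent g h
  have h1 := congrArg (fun f => entry f i j) key
  beta_reduce at h1
  rw [entry_comp, compIso, entry_diag_comp] at h1
  exact h1

lemma actEntry_tensor (X Y : Equivariant z.action) (g : G) (x x' : X.obj.ι) (y y' : Y.obj.ι) :
    actEntry (X ⊗ Y) g (pair x y) (pair x' y') =
      (((z.tensorator g (X.obj.deg x).deg (Y.obj.deg y).deg)⁻¹ : ℂˣ) : ℂ) *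
        (actEntry X g x x' * actEntry Y g y y') :=
  entry_mono_comp (Equiv.refl (X.obj ⊗ Y.obj).ι)
    (fun i => (((z.tensorator g (X.obj.deg i.1).deg (Y.obj.deg i.2).deg)⁻¹ : ℂˣ) : ℂ))
    (X.obj ⊗ Y.obj).refl_deg ((actIso X g).hom ⊗ₘ (actIso Y g).hom) (pair x y) (pair x' y')

lemma hom_comp_actIso {X Y : Equivariant z.action} (f : X ⟶ Y) (g : G) :
    (actIso X g).hom ≫ f.f = f.f ≫ (actIso Y g).hom := f.comm g

lemma sum_actEntry_hom {X Y : Equivariant z.action} (f : X ⟶ Y) (g : G) (i : X.obj.ι)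
    (j : Y.obj.ι) : ∑ k, actEntry X g i k * entry f.f k j =
      ∑ k, entry f.f i k * actEntry Y g k j := by
  have h := congrArg (fun f => entry f i j) (hom_comp_actIso f g)
  beta_reduce at h
  rwa [entry_comp, entry_comp] at h

/-- A family of endomorphisms of `X`, one for each basis vector of `Y`, acting on `Y ⊗ X`. -/
def blockHom (Y X : z.Cat) (f : Y.ι → (X ⟶ X)) : Y ⊗ X ⟶ Y ⊗ X :=
  ofEntry (X := Y ⊗ X) (Y := Y ⊗ X) (fun p q => if p.1 = q.1 then entry (f p.1) p.2 q.2 else 0)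
    fun p q h => by
      by_cases hpq : p.1 = q.1
      · rw [if_pos hpq] at h
        exact congrArg₂ (· * ·) (congrArg Y.deg hpq) (entry_deg _ h)
      · simp [hpq] at h

lemma entry_blockHom {Y X : z.Cat} (f : Y.ι → (X ⟶ X)) (y y' : Y.ι) (x x' : X.ι) :
    entry (blockHom Y X f) (pair y x) (pair y' x') = if y = y' then entry (f y) x x' else 0 := rfl

lemma sum_pair {X Y : z.Cat} (F : (X ⊗ Y).ι → ℂ) : ∑ p, F p = ∑ x, ∑ y, F (pair x y) :=
  Fintype.sum_prod_type F

lemma blockHom_comp {Y X : z.Cat} (f g : Y.ι → (X ⟶ X)) :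
    blockHom Y X f ≫ blockHom Y X g = blockHom Y X (fun y => f y ≫ g y) := by
  refine hom_ext ?_
  rintro ⟨y, x⟩ ⟨y', x'⟩
  refine (entry_comp _ _ _ _).trans ((sum_pair _).trans ?_)
  refine Eq.trans ?_ (entry_blockHom _ y y' x x').symm
  simp only [entry_blockHom, ite_zero_mul_ite_zero]
  rw [Finset.sum_eq_single y]
  · by_cases h : y = y'
    · subst h
      simp [entry_comp]
    · simp [h]
  · intro b _ hb
    simp [hb.symm]
  · simp

lemma blockHom_id (Y X : z.Cat) : blockHom Y X (fun _ => 𝟙 X) = 𝟙 (Y ⊗ X) := by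
  refine hom_ext ?_
  rintro ⟨y, x⟩ ⟨y', x'⟩
  refine (entry_blockHom _ y y' x x').trans ?_
  rw [entry_id, ← ite_and]
  refine Eq.trans ?_ (entry_id (Y ⊗ X) (pair y x) (pair y' x')).symm
  exact if_congr Prod.mk_inj.symm rfl rfl

/-- `u_h` on the degree `h` part of the first factor. -/
def twistIso (Y : z.Cat) (X : Equivariant z.action) : Y ⊗ X.obj ≅ Y ⊗ X.obj where
  hom := blockHom Y X.obj fun y => (actIso X (Y.deg y).deg).hom
  inv := blockHom Y X.obj fun y => (actIso X (Y.deg y).deg).inv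
  hom_inv_id := by
    rw [blockHom_comp]
    simp only [Iso.hom_inv_id, blockHom_id]
  inv_hom_id := by
    rw [blockHom_comp]
    simp only [Iso.inv_hom_id, blockHom_id]

/-- `(id ⊗ u_{|Y|}) ∘ c_{X,Y}` -/
def eqBraidIso (X Y : Equivariant z.action) : X.obj ⊗ Y.obj ≅ Y.obj ⊗ X.obj :=
  z.braidIso X.obj Y.obj ≪≫ twistIso Y.obj X

lemma entry_eqBraid (X Y : Equivariant z.action) (x x' : X.obj.ι) (y y' : Y.obj.ι) :
    entry (eqBraidIso X Y).hom (pair x y) (pair y' x') =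
      z.braidScalar (X.obj.deg x) (Y.obj.deg y) *
        if y = y' then actEntry X (Y.obj.deg y).deg x x' else 0 :=
  entry_mono_comp (z.swapEquiv X.obj Y.obj)
    (fun i => z.braidScalar (X.obj.deg i.1) (Y.obj.deg i.2)) (z.swap_deg X.obj Y.obj)
    (twistIso Y.obj X).hom (pair x y) (pair y' x')

lemma entry_eqBraid_comp (X Y : Equivariant z.action) {W : z.Cat} (g : Y.obj ⊗ X.obj ⟶ W)
    (x : X.obj.ι) (y : Y.obj.ι) (k : W.ι) : entry ((eqBraidIso X Y).hom ≫ g) (pair x y) k =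
      ∑ x', z.braidScalar (X.obj.deg x) (Y.obj.deg y) * actEntry X (Y.obj.deg y).deg x x' *
        entry g (pair y x') k := by
  rw [entry_comp, sum_pair, Finset.sum_eq_single y]
  · refine Finset.sum_congr rfl fun x' _ => ?_
    rw [entry_eqBraid, if_pos rfl]
  · intro y' _ hy
    refine Finset.sum_eq_zero fun x' _ => ?_
    rw [entry_eqBraid, if_neg hy.symm, mul_zero, zero_mul]
  · simp

lemma entry_comp_eqBraid (X Y : Equivariant z.action) {W : z.Cat} (f : W ⟶ X.obj ⊗ Y.obj)
    (k : W.ι) (x' : X.obj.ι) (y : Y.obj.ι) : entry (f ≫ (eqBraidIso X Y).hom) k (pair y x') =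
      ∑ x, entry f k (pair x y) * (z.braidScalar (X.obj.deg x) (Y.obj.deg y) *
        actEntry X (Y.obj.deg y).deg x x') := by
  rw [entry_comp, sum_pair]
  refine Finset.sum_congr rfl fun x _ => ?_
  rw [Finset.sum_eq_single y]
  · rw [entry_eqBraid, if_pos rfl]
  · intro y' _ hy
    rw [entry_eqBraid, if_neg hy, mul_zero, mul_zero]
  · simp

lemma actIso_comp_eqBraid (X Y : Equivariant z.action) (g : G) :
    (actIso (X ⊗ Y) g).hom ≫ (eqBraidIso X Y).hom =
      (eqBraidIso X Y).hom ≫ (actIso (Y ⊗ X) g).hom := by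
  refine hom_ext ?_
  rintro ⟨x, y⟩ ⟨y', x'⟩
  refine (entry_comp_eqBraid X Y _ (pair x y) x' y').trans ?_
  refine Eq.trans ?_ (entry_eqBraid_comp X Y _ x y (pair y' x')).symm
  change ∑ a, actEntry (X ⊗ Y) g (pair x y) (pair a y') * _ =
    ∑ a, _ * actEntry (Y ⊗ X) g (pair y a) (pair y' x')
  simp only [actEntry_tensor]
  by_cases hy : actEntry Y g y y' = 0
  · simp [hy]
  rw [← actEntry_deg hy]
  have h1 : ∀ a, ((z.tensorator g (X.obj.deg x).deg (Y.obj.deg y).deg)⁻¹ : ℂˣ) *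
      (actEntry X g x a * actEntry Y g y y') * (z.braidScalar (X.obj.deg a) (Y.obj.deg y) *
        actEntry X (Y.obj.deg y).deg a x') =
      ((z.tensorator g (X.obj.deg x).deg (Y.obj.deg y).deg)⁻¹ : ℂˣ) * actEntry Y g y y' *
        z.braidScalar (X.obj.deg x) (Y.obj.deg y) *
        (actEntry X g x a * actEntry X (Y.obj.deg y).deg a x') := fun a => by
    by_cases h : actEntry X g x a = 0
    · simp [h]
    rw [← actEntry_deg h]
    ring
  have h2 : ∀ a, z.braidScalar (X.obj.deg x) (Y.obj.deg y) * actEntry X (Y.obj.deg y).deg x a *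
      (((z.tensorator g (Y.obj.deg y).deg (X.obj.deg a).deg)⁻¹ : ℂˣ) *
        (actEntry Y g y y' * actEntry X g a x')) =
      ((z.tensorator g (Y.obj.deg y).deg (X.obj.deg x).deg)⁻¹ : ℂˣ) * actEntry Y g y y' *
        z.braidScalar (X.obj.deg x) (Y.obj.deg y) *
        (actEntry X (Y.obj.deg y).deg x a * actEntry X g a x') := fun a => by
    by_cases h : actEntry X (Y.obj.deg y).deg x a = 0
    · simp [h]
    rw [← actEntry_deg h]
    ring
  rw [Finset.sum_congr rfl fun a _ => h1 a, Finset.sum_congr rfl fun a _ => h2 a,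
    ← Finset.mul_sum, ← Finset.mul_sum, sum_actEntry, sum_actEntry, mul_comm g]
  have h3 : (z.tensorator g (X.obj.deg x).deg (Y.obj.deg y).deg)⁻¹ *
      z.compositor (Y.obj.deg y).deg g (X.obj.deg x) =
      (z.tensorator g (Y.obj.deg y).deg (X.obj.deg x).deg)⁻¹ *
      z.compositor g (Y.obj.deg y).deg (X.obj.deg x) := by
    rw [inv_mul_eq_iff_eq_mul, mul_left_comm, eq_inv_mul_iff_mul_eq, mul_comm,
      ← tensorator_mul_compositor]
  have h4 := congrArg Units.val h3
  simp only [Units.val_mul] at h4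
  linear_combination (actEntry Y g y y' * z.braidScalar (X.obj.deg x) (Y.obj.deg y) *
    actEntry X ((Y.obj.deg y).deg * g) x x') * h4

lemma entry_whiskerRight {X X' : z.Cat} (f : X ⟶ X') (Y : z.Cat) (x : X.ι) (x' : X'.ι)
    (y y' : Y.ι) : entry (f ▷ Y) (pair x y) (pair x' y') = entry f x x' * if y = y' then 1 else 0 :=
  congrArg (_ * ·) (entry_id Y y y')

lemma entry_whiskerLeft {X X' : z.Cat} (f : X ⟶ X') (Y : z.Cat) (x : X.ι) (x' : X'.ι)
    (y y' : Y.ι) : entry (Y ◁ f) (pair y x) (pair y' x') = (if y = y' then 1 else 0) * entry f x x' :=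
  congrArg (· * _) (entry_id Y y y')

lemma entry_whiskerRight_comp {X X' W : z.Cat} (f : X ⟶ X') (Y : z.Cat) (g : X' ⊗ Y ⟶ W)
    (x : X.ι) (y : Y.ι) (k : W.ι) :
    entry (f ▷ Y ≫ g) (pair x y) k = ∑ x', entry f x x' * entry g (pair x' y) k := by
  rw [entry_comp, sum_pair]
  simp [entry_whiskerRight]

lemma entry_whiskerLeft_comp {X X' W : z.Cat} (f : X ⟶ X') (Y : z.Cat) (g : Y ⊗ X' ⟶ W)
    (x : X.ι) (y : Y.ι) (k : W.ι) :
    entry (Y ◁ f ≫ g) (pair y x) k = ∑ x', entry f x x' * entry g (pair y x') k := by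
  rw [entry_comp, sum_pair, Finset.sum_comm]
  simp [entry_whiskerLeft]

lemma entry_associator_comp (X Y Z : z.Cat) {W : z.Cat} (g : X ⊗ (Y ⊗ Z) ⟶ W) (i : X.ι) (j : Y.ι)
    (k : Z.ι) (l : W.ι) : entry ((α_ X Y Z).hom ≫ g) (pair (pair i j) k) l =
      z.cocycle.toFun (X.deg i) (Y.deg j) (Z.deg k) * entry g (pair i (pair j k)) l := by
  rw [GrVec.associator_hom]
  exact entry_mono_comp _ _ _ g (pair (pair i j) k) l

lemma entry_comp_associator (X Y Z : z.Cat) {W : z.Cat} (g : W ⟶ (X ⊗ Y) ⊗ Z) (i : X.ι) (j : Y.ι)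
    (k : Z.ι) (l : W.ι) : entry (g ≫ (α_ X Y Z).hom) l (pair i (pair j k)) =
      entry g l (pair (pair i j) k) * z.cocycle.toFun (X.deg i) (Y.deg j) (Z.deg k) := by
  rw [GrVec.associator_hom]
  exact entry_comp_mono g _ _ _ l (pair i (pair j k))

lemma entry_associator_inv_comp (X Y Z : z.Cat) {W : z.Cat} (g : (X ⊗ Y) ⊗ Z ⟶ W) (i : X.ι)
    (j : Y.ι) (k : Z.ι) (l : W.ι) : entry ((α_ X Y Z).inv ≫ g) (pair i (pair j k)) l =
      ((z.cocycle.toFun (X.deg i) (Y.deg j) (Z.deg k))⁻¹ : ℂˣ) *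
        entry g (pair (pair i j) k) l := by
  rw [associator_inv_hom]
  exact entry_mono_comp _ _ _ g (pair i (pair j k)) l

lemma entry_comp_associator_inv (X Y Z : z.Cat) {W : z.Cat} (g : W ⟶ X ⊗ (Y ⊗ Z)) (i : X.ι)
    (j : Y.ι) (k : Z.ι) (l : W.ι) : entry (g ≫ (α_ X Y Z).inv) l (pair (pair i j) k) =
      entry g l (pair i (pair j k)) *
        ((z.cocycle.toFun (X.deg i) (Y.deg j) (Z.deg k))⁻¹ : ℂˣ) := by
  rw [associator_inv_hom]
  exact entry_comp_mono g _ _ _ l (pair (pair i j) k)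

lemma eqBraid_natural_right (X : Equivariant z.action) {Y Y' : Equivariant z.action}
    (f : Y.obj ⟶ Y'.obj) :
    X.obj ◁ f ≫ (eqBraidIso X Y').hom = (eqBraidIso X Y).hom ≫ f ▷ X.obj := by
  refine hom_ext ?_
  rintro ⟨x, y⟩ ⟨y', x'⟩
  refine (entry_whiskerLeft_comp _ _ _ y x (pair y' x')).trans ?_
  refine Eq.trans ?_ (entry_eqBraid_comp X Y _ x y (pair y' x')).symm
  simp only [entry_eqBraid, entry_whiskerRight, mul_ite, mul_zero, Finset.sum_ite_eq',
    Finset.mem_univ, if_true, mul_one]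
  by_cases h : entry f y y' = 0
  · simp [h]
  rw [entry_deg f h]
  ring

lemma eqBraid_natural_left {X X' : Equivariant z.action} (f : X ⟶ X') (Y : Equivariant z.action) :
    f.f ▷ Y.obj ≫ (eqBraidIso X' Y).hom = (eqBraidIso X Y).hom ≫ Y.obj ◁ f.f := by
  refine hom_ext ?_
  rintro ⟨x, y⟩ ⟨y', x'⟩
  refine (entry_whiskerRight_comp _ _ _ x y (pair y' x')).trans ?_
  refine Eq.trans ?_ (entry_eqBraid_comp X Y _ x y (pair y' x')).symm
  simp only [entry_eqBraid, entry_whiskerLeft]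
  by_cases h : y = y'
  · subst h
    have h1 : ∀ k, entry f.f x k * (z.braidScalar (X'.obj.deg k) (Y.obj.deg y) *
        actEntry X' (Y.obj.deg y).deg k x') = z.braidScalar (X.obj.deg x) (Y.obj.deg y) *
        (entry f.f x k * actEntry X' (Y.obj.deg y).deg k x') := fun k => by
      by_cases h : entry f.f x k = 0
      · simp [h]
      rw [entry_deg _ h]
      ring
    simp only [if_true, one_mul, h1, mul_assoc]
    rw [← Finset.mul_sum, ← Finset.mul_sum, sum_actEntry_hom]
  · simp [h]

lemma entry_eqBraid_tensor_right (X Y Z : Equivariant z.action) (x x' : X.obj.ι) (y y' : Y.obj.ι)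
    (t t' : Z.obj.ι) :
    entry (eqBraidIso X (Y ⊗ Z)).hom (pair x (pair y t)) (pair (pair y' t') x') =
      z.braidScalar (X.obj.deg x) (Y.obj.deg y * Z.obj.deg t) * if y = y' then if t = t' then
        actEntry X ((Y.obj.deg y).deg * (Z.obj.deg t).deg) x x' else 0 else 0 := by
  refine (entry_eqBraid X (Y ⊗ Z) x x' (pair y t) (pair y' t')).trans ?_
  refine congrArg (_ * ·) ?_
  by_cases hy : y = y'
  · by_cases ht : t = t'
    · rw [if_pos hy, if_pos ht]
      exact if_pos (Prod.ext hy ht)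
    · rw [if_neg ht, ite_self]
      exact if_neg fun h => ht (congrArg Prod.snd h)
  · rw [if_neg hy]
    exact if_neg fun h => hy (congrArg Prod.fst h)

lemma entry_eqBraid_tensor_left (X Y Z : Equivariant z.action) (x x' : X.obj.ι) (y y' : Y.obj.ι)
    (t t' : Z.obj.ι) :
    entry (eqBraidIso (X ⊗ Y) Z).hom (pair (pair x y) t) (pair t' (pair x' y')) =
      z.braidScalar (X.obj.deg x * Y.obj.deg y) (Z.obj.deg t) * if t = t' then
        (((z.tensorator (Z.obj.deg t).deg (X.obj.deg x).deg (Y.obj.deg y).deg)⁻¹ : ℂˣ) : ℂ) *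
        (actEntry X (Z.obj.deg t).deg x x' * actEntry Y (Z.obj.deg t).deg y y') else 0 := by
  rw [← actEntry_tensor]
  exact entry_eqBraid (X ⊗ Y) Z (pair x y) (pair x' y') t t'

lemma cocycle_mul_braidScalar_right (X Y Z : z.Label) :
    z.cocycle.toFun X Y Z * (z.braidScalar X (Y * Z) * z.cocycle.toFun Y Z X) =
      z.braidScalar X Y * z.cocycle.toFun Y X Z * z.braidScalar X Z *
        z.compositor Z.deg Y.deg X := by
  rw [braidScalar_mul_right]
  apply Additive.ofMul.injective
  simp only [ofMul_mul, ofMul_inv]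
  abel

lemma cocycle_inv_mul_braidScalar_left (X Y Z : z.Label) :
    (z.cocycle.toFun X Y Z)⁻¹ * (z.braidScalar (X * Y) Z * (z.tensorator Z.deg X.deg Y.deg)⁻¹ *
      (z.cocycle.toFun Z X Y)⁻¹) =
      z.braidScalar Y Z * (z.cocycle.toFun X Z Y)⁻¹ * z.braidScalar X Z := by
  rw [braidScalar_mul_left]
  apply Additive.ofMul.injective
  simp only [ofMul_mul, ofMul_inv]
  abel

lemma eqBraid_hexagon_forward (X Y Z : Equivariant z.action) :
    (α_ X.obj Y.obj Z.obj).hom ≫ (eqBraidIso X (Y ⊗ Z)).hom ≫ (α_ Y.obj Z.obj X.obj).hom =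
      (eqBraidIso X Y).hom ▷ Z.obj ≫ (α_ Y.obj X.obj Z.obj).hom ≫
        Y.obj ◁ (eqBraidIso X Z).hom := by
  refine hom_ext ?_
  rintro ⟨⟨x, y⟩, t⟩ ⟨y', t', x'⟩
  refine (entry_associator_comp _ _ _ _ x y t (pair y' (pair t' x'))).trans ?_
  refine (congrArg (_ * ·) ((entry_comp_associator _ _ _ _ y' t' x' (pair x (pair y t))).trans
    (congrArg (· * _) (entry_eqBraid_tensor_right X Y Z x x' y y' t t')))).trans ?_
  refine Eq.trans ?_ (entry_whiskerRight_comp _ _ _ (pair x y) t (pair y' (pair t' x'))).symm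
  rw [sum_pair, Finset.sum_eq_single y]
  rotate_left
  · intro y1 _ hy
    refine Finset.sum_eq_zero fun x1 _ => ?_
    rw [entry_eqBraid, if_neg hy.symm, mul_zero, zero_mul]
  · simp
  simp only [entry_associator_comp, entry_whiskerLeft, entry_eqBraid]
  by_cases hy : y = y'
  swap
  · simp [hy]
  by_cases ht : t = t'
  swap
  · simp [ht]
  subst hy ht
  simp only [if_true]
  have h1 : ∀ k, z.braidScalar (X.obj.deg x) (Y.obj.deg y) * actEntry X (Y.obj.deg y).deg x k *
      (z.cocycle.toFun (Y.obj.deg y) (X.obj.deg k) (Z.obj.deg t) *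
        (1 * (z.braidScalar (X.obj.deg k) (Z.obj.deg t) * actEntry X (Z.obj.deg t).deg k x'))) =
      z.braidScalar (X.obj.deg x) (Y.obj.deg y) *
        z.cocycle.toFun (Y.obj.deg y) (X.obj.deg x) (Z.obj.deg t) *
        z.braidScalar (X.obj.deg x) (Z.obj.deg t) *
        (actEntry X (Y.obj.deg y).deg x k * actEntry X (Z.obj.deg t).deg k x') := fun k => by
    by_cases h : actEntry X (Y.obj.deg y).deg x k = 0
    · simp [h]
    rw [actEntry_deg h]
    ring
  rw [Finset.sum_congr rfl fun k _ => h1 k, ← Finset.mul_sum, sum_actEntry]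
  by_cases h : actEntry X ((Y.obj.deg y).deg * (Z.obj.deg t).deg) x x' = 0
  · simp [h]
  rw [← actEntry_deg h]
  have h2 := congrArg Units.val
    (cocycle_mul_braidScalar_right (X.obj.deg x) (Y.obj.deg y) (Z.obj.deg t))
  simp only [Units.val_mul] at h2
  linear_combination actEntry X ((Y.obj.deg y).deg * (Z.obj.deg t).deg) x x' * h2

lemma eqBraid_hexagon_reverse (X Y Z : Equivariant z.action) :
    (α_ X.obj Y.obj Z.obj).inv ≫ (eqBraidIso (X ⊗ Y) Z).hom ≫ (α_ Z.obj X.obj Y.obj).inv =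
      X.obj ◁ (eqBraidIso Y Z).hom ≫ (α_ X.obj Z.obj Y.obj).inv ≫
        (eqBraidIso X Z).hom ▷ Y.obj := by
  refine hom_ext ?_
  rintro ⟨x, y, t⟩ ⟨⟨t', x'⟩, y'⟩
  refine (entry_associator_inv_comp _ _ _ _ x y t (pair (pair t' x') y')).trans ?_
  refine (congrArg (_ * ·) ((entry_comp_associator_inv _ _ _ _ t' x' y' (pair (pair x y) t)).trans
    (congrArg (· * _) (entry_eqBraid_tensor_left X Y Z x x' y y' t t')))).trans ?_
  refine Eq.trans ?_ (entry_whiskerLeft_comp _ _ _ (pair y t) x (pair (pair t' x') y')).symm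
  rw [sum_pair, Finset.sum_eq_single t]
  rotate_left
  · intro t1 _ ht
    refine Finset.sum_eq_zero fun y1 _ => ?_
    rw [entry_eqBraid, if_neg ht.symm, mul_zero, zero_mul]
  · simp
  simp only [entry_associator_inv_comp, entry_whiskerRight, entry_eqBraid]
  by_cases ht : t = t'
  swap
  · simp [ht]
  subst ht
  simp only [if_true, mul_ite, mul_one, mul_zero, Finset.sum_ite_eq', Finset.mem_univ]
  by_cases hx : actEntry X (Z.obj.deg t).deg x x' = 0
  · simp [hx]
  by_cases hy : actEntry Y (Z.obj.deg t).deg y y' = 0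
  · simp [hy]
  rw [← actEntry_deg hx, ← actEntry_deg hy]
  have h2 := congrArg Units.val
    (cocycle_inv_mul_braidScalar_left (X.obj.deg x) (Y.obj.deg y) (Z.obj.deg t))
  simp only [Units.val_mul] at h2
  linear_combination actEntry X (Z.obj.deg t).deg x x' * actEntry Y (Z.obj.deg t).deg y y' * h2

variable (z) in
/-- The braiding `(id ⊗ u_{|Y|}) ∘ c_{X,Y}` of the equivariantisation. -/
@[reducible] def equivariantBraided : BraidedCategory (Equivariant z.action) where
  braiding X Y := Equivariant.mkIso (X := X ⊗ Y) (Y := Y ⊗ X) (eqBraidIso X Y)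
    (actIso_comp_eqBraid X Y)
  braiding_naturality_right X _ _ f := Equivariant.hom_ext (eqBraid_natural_right X f.f)
  braiding_naturality_left f Z := Equivariant.hom_ext (eqBraid_natural_left f Z)
  hexagon_forward X Y Z := Equivariant.hom_ext (eqBraid_hexagon_forward X Y Z)
  hexagon_reverse X Y Z := Equivariant.hom_ext (eqBraid_hexagon_reverse X Y Z)

lemma equivariantBraided_isEquivariantBraiding [DecidableEq G] [Fintype G] :
    z.crossedBraiding.IsEquivariantBraiding z.equivariantBraided := by
  intro X Y h Yh hY j
  change X.obj ◁ j ≫ (eqBraidIso X Y).hom =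
    (z.braidIso X.obj Yh).hom ≫ Yh ◁ (actIso X h).hom ≫ j ▷ X.obj
  refine hom_ext ?_
  rintro ⟨x, y⟩ ⟨y', x'⟩
  refine (entry_whiskerLeft_comp _ _ _ y x (pair y' x')).trans ?_
  have e : entry ((z.braidIso X.obj Yh).hom ≫ Yh ◁ (actIso X h).hom ≫ j ▷ X.obj) (pair x y)
      (pair y' x') = z.braidScalar (X.obj.deg x) (Yh.deg y) *
        entry (Yh ◁ (actIso X h).hom ≫ j ▷ X.obj) (pair y x) (pair y' x') :=
    entry_mono_comp (z.swapEquiv X.obj Yh) (fun i => z.braidScalar (X.obj.deg i.1) (Yh.deg i.2))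
      (z.swap_deg X.obj Yh) _ (pair x y) (pair y' x')
  refine Eq.trans ?_ e.symm
  rw [entry_whiskerLeft_comp]
  simp only [entry_eqBraid, entry_whiskerRight, mul_ite, mul_zero, Finset.sum_ite_eq',
    Finset.mem_univ, if_true, mul_one]
  by_cases hj : entry j y y' = 0
  · simp [hj]
  rw [← entry_deg j hj, hY y]
  change _ = _ * (actEntry X h x x' * _)
  ring

end ZestingDatum

/-! ### Splitting idempotent matrices -/

/-- An idempotent matrix factors through a vector space of dimension its rank. -/
lemma exists_splitting_of_idempotent {n : Type} [Fintype n] [DecidableEq n] (M : n → n → ℂ)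
    (hM : ∀ i j, ∑ k, M i k * M k j = M i j) :
    ∃ (r : ℕ) (a b : Fin r → n → ℂ), (∀ i j, ∑ k, b k i * a k j = M i j) ∧
      ∀ k l, ∑ i, a k i * b l i = if k = l then 1 else 0 := by
  let f := Matrix.vecMulLinear (Matrix.of M)
  have hf : ∀ v, f v = fun j => ∑ i, v i * M i j := fun v => rfl
  have hidem : ∀ v, f (f v) = f v := by
    intro v
    funext j
    simp only [hf, Finset.sum_mul]
    rw [Finset.sum_comm]
    refine Finset.sum_congr rfl fun i _ => ?_
    simp only [mul_assoc]
    rw [← Finset.mul_sum, hM]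
  let e := Module.finBasis ℂ (LinearMap.range f)
  let g : (n → ℂ) →ₗ[ℂ] (Fin _ → ℂ) := e.equivFun.toLinearMap ∘ₗ f.rangeRestrict
  refine ⟨_, fun k => (e k).1, fun k i => g (fun j => if i = j then 1 else 0) k, fun i j => ?_,
    fun k l => ?_⟩
  · have h := congrArg (fun v : LinearMap.range f => v.1 j)
      (e.sum_equivFun (f.rangeRestrict fun j => if i = j then 1 else 0))
    simp only [AddSubmonoidClass.coe_finsetSum, Finset.sum_apply, SetLike.val_smul, Pi.smul_apply,
      smul_eq_mul] at h
    refine h.trans ?_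
    simp [hf]
  · have h1 : g (e k).1 = fun l => if k = l then 1 else 0 := by
      have h2 : f.rangeRestrict (e k).1 = e k := by
        obtain ⟨v, hv⟩ := (e k).2
        refine Subtype.ext ?_
        change f (e k).1 = (e k).1
        rw [← hv, hidem]
      change e.equivFun (f.rangeRestrict (e k).1) = _
      rw [h2]
      funext l
      exact e.equivFun_self k l
    have h3 := congrFun (g.pi_apply_eq_sum_univ (e k).1) l
    rw [h1, Finset.sum_apply] at h3
    exact h3.symm

/-! ### Simple objects of the equivariantisation -/

namespace ToricZesting

open GrVec ZestingDatum Functor.LaxMonoidal Functor.OplaxMonoidal Functor.Monoidal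

variable {z : ToricZesting}

instance : DecidableEq z.Label := Classical.decEq _

lemma actIso_one (X : Equivariant z.action) : (actIso X 1).hom = 𝟙 X.obj := by
  have key : (actIso X 1).hom ≫ (actIso X 1).hom =
      (compIso z.actionData 1 1 X.obj).hom ≫ (actIso X 1).hom := X.coherent 1 1
  rw [cancel_mono] at key
  rw [key]
  exact diag_one fun i => z.actionData.comp_one_left 1 (X.obj.deg i)

/-- A morphism commuting with `u_{-1}` is equivariant. -/
def mkHom {X Y : Equivariant z.action} (f : X.obj ⟶ Y.obj)
    (hf : (actIso X (-1)).hom ≫ f = f ≫ (actIso Y (-1)).hom) : X ⟶ Y where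
  f := f
  comm g := by
    change (actIso X g).hom ≫ f = f ≫ (actIso Y g).hom
    rcases Int.units_eq_one_or g with rfl | rfl
    · rw [actIso_one, actIso_one, Category.id_comp, Category.comp_id]
    · exact hf

/-- An isomorphism commuting with `u_{-1}` is equivariant. -/
def mkEquivariantIso {X Y : Equivariant z.action} (e : X.obj ≅ Y.obj)
    (he : (actIso X (-1)).hom ≫ e.hom = e.hom ≫ (actIso Y (-1)).hom) : X ≅ Y :=
  Equivariant.mkIso e (mkHom e.hom he).comm

lemma sum_actEntry_neg (X : Equivariant z.action) (i j : X.obj.ι) :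
    ∑ k, actEntry X (-1) i k * actEntry X (-1) k j =
      if i = j then (z.compositor (-1) (-1) (X.obj.deg i) : ℂ) else 0 := by
  have h : actEntry X (-1 * -1) i j = if i = j then 1 else 0 := by
    change entry (actIso X 1).hom i j = _
    rw [actIso_one, entry_id]
  rw [sum_actEntry, h, mul_boole]

section Simples

variable {T : ZMod 2 × ZMod 4 → z.Label} {t : ZMod 4 × ZMod 4 → ℂˣ}
  (ht : ∀ x, t x ^ 2 = z.compositor (-1) (-1) (T (underlying x)))

lemma eq_or_eq_of_underlying : ∀ x y, underlying x = underlying y → x = y ∨ y = x + (2, 0) := by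
  decide

lemma underlying_add_two : ∀ x, underlying (x + (2, 0)) = underlying x := by decide

lemma card_underlying : ∀ y, (Finset.univ.filter fun x => underlying x = y).card = 2 := by decide

lemma underlying_add : ∀ x y, underlying (x + y) = underlying x + underlying y := by decide

/-- The projection to the isotypic component of the simple object named `x`. -/
def isotypicProj (T : ZMod 2 × ZMod 4 → z.Label) (t : ZMod 4 × ZMod 4 → ℂˣ)
    (X : Equivariant z.action) (x : ZMod 4 × ZMod 4) (i j : X.obj.ι) : ℂ :=
  if X.obj.deg i = T (underlying x) then
    2⁻¹ * ((if i = j then 1 else 0) + (t x : ℂ)⁻¹ * actEntry X (-1) i j) else 0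

variable {X : Equivariant z.action}

lemma isotypicProj_deg {x : ZMod 4 × ZMod 4} {i j : X.obj.ι} (h : isotypicProj T t X x i j ≠ 0) :
    X.obj.deg i = T (underlying x) ∧ X.obj.deg j = T (underlying x) := by
  unfold isotypicProj at h
  split_ifs at h with h1 h2
  · exact ⟨h1, h2 ▸ h1⟩
  · refine ⟨h1, (actEntry_deg (g := -1) (i := i) fun h3 => h ?_).symm.trans h1⟩
    rw [h3]
    simp
  · exact absurd rfl h

include ht

lemma sum_isotypicProj_actEntry (x : ZMod 4 × ZMod 4) (i j : X.obj.ι) :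
    ∑ k, isotypicProj T t X x i k * actEntry X (-1) k j = t x * isotypicProj T t X x i j := by
  unfold isotypicProj
  by_cases h : X.obj.deg i = T (underlying x)
  swap
  · simp [h]
  simp only [if_pos h]
  have h1 : ∀ k, 2⁻¹ * ((if i = k then 1 else 0) + (t x : ℂ)⁻¹ * actEntry X (-1) i k) *
      actEntry X (-1) k j = 2⁻¹ * ((if i = k then actEntry X (-1) k j else 0) +
        (t x : ℂ)⁻¹ * (actEntry X (-1) i k * actEntry X (-1) k j)) := fun k => by
    split_ifs <;> ring
  simp only [h1]
  rw [← Finset.mul_sum, Finset.sum_add_distrib, ← Finset.mul_sum, sum_actEntry_neg, h, ← ht]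
  simp only [Finset.sum_ite_eq, Finset.mem_univ, if_true, Units.val_pow_eq_pow_val]
  have := (t x).ne_zero
  split_ifs <;> field_simp <;> ring

lemma sum_actEntry_isotypicProj (x : ZMod 4 × ZMod 4) (i j : X.obj.ι) :
    ∑ k, actEntry X (-1) i k * isotypicProj T t X x k j = t x * isotypicProj T t X x i j := by
  rw [← sum_isotypicProj_actEntry ht]
  unfold isotypicProj
  by_cases h : X.obj.deg i = T (underlying x)
  swap
  · simp only [if_neg h, zero_mul, Finset.sum_const_zero]
    refine Finset.sum_eq_zero fun k _ => ?_
    by_cases hk : actEntry X (-1) i k = 0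
    · rw [hk, zero_mul]
    · rw [← actEntry_deg hk, if_neg h, mul_zero]
  have h1 : ∀ k, actEntry X (-1) i k * (if X.obj.deg k = T (underlying x) then
      2⁻¹ * ((if k = j then 1 else 0) + (t x : ℂ)⁻¹ * actEntry X (-1) k j) else 0) =
      2⁻¹ * ((if k = j then actEntry X (-1) i k else 0) +
        (t x : ℂ)⁻¹ * (actEntry X (-1) i k * actEntry X (-1) k j)) := fun k => by
    by_cases hk : actEntry X (-1) i k = 0
    · simp [hk]
    · rw [← actEntry_deg hk, if_pos h]
      split_ifs <;> ring
  have h2 : ∀ k, (if X.obj.deg i = T (underlying x) then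
      2⁻¹ * ((if i = k then 1 else 0) + (t x : ℂ)⁻¹ * actEntry X (-1) i k) else 0) *
      actEntry X (-1) k j = 2⁻¹ * ((if i = k then actEntry X (-1) k j else 0) +
        (t x : ℂ)⁻¹ * (actEntry X (-1) i k * actEntry X (-1) k j)) := fun k => by
    rw [if_pos h]
    split_ifs <;> ring
  simp only [h1, h2]
  rw [← Finset.mul_sum, ← Finset.mul_sum, Finset.sum_add_distrib, Finset.sum_add_distrib]
  simp

variable (hT : Function.Bijective T) (hneg : ∀ x, t (x + (2, 0)) = -t x)

include hT hneg

lemma sum_isotypicProj_mul (x y : ZMod 4 × ZMod 4) (i j : X.obj.ι) :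
    ∑ k, isotypicProj T t X x i k * isotypicProj T t X y k j =
      if x = y then isotypicProj T t X x i j else 0 := by
  by_cases hi : X.obj.deg i = T (underlying x)
  swap
  · have h0 : ∀ k, isotypicProj T t X x i k = 0 := fun k => if_neg hi
    simp [h0]
  have h1 : ∀ k, isotypicProj T t X x i k * isotypicProj T t X y k j =
      2⁻¹ * ((if i = k then isotypicProj T t X y k j else 0) +
        (t x : ℂ)⁻¹ * (actEntry X (-1) i k * isotypicProj T t X y k j)) := fun k => by
    rw [isotypicProj, if_pos hi]
    split_ifs <;> ring
  simp only [h1]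
  rw [← Finset.mul_sum, Finset.sum_add_distrib, ← Finset.mul_sum, sum_actEntry_isotypicProj ht]
  simp only [Finset.sum_ite_eq, Finset.mem_univ, if_true]
  have hx := (t x).ne_zero
  split_ifs with hxy
  · subst hxy
    field_simp
    ring
  · by_cases hy : X.obj.deg i = T (underlying y)
    · rcases eq_or_eq_of_underlying x y (hT.1 (hi.symm.trans hy)) with h | h
      · exact absurd h hxy
      · rw [h, hneg, Units.val_neg]
        field_simp
        ring
    · rw [isotypicProj, if_neg hy]
      simp

omit ht in
lemma sum_isotypicProj (i j : X.obj.ι) :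
    ∑ x, isotypicProj T t X x i j = if i = j then 1 else 0 := by
  obtain ⟨y, hy⟩ := hT.2 (X.obj.deg i)
  have h1 : ∀ x, isotypicProj T t X x i j + isotypicProj T t X (x + (2, 0)) i j =
      if underlying x = y then (if i = j then 1 else 0) else 0 := fun x => by
    unfold isotypicProj
    rw [underlying_add_two, hneg, Units.val_neg, ← hy]
    have := (t x).ne_zero
    simp only [hT.1.eq_iff, eq_comm (a := y)]
    split_ifs <;> field_simp <;> ring
  have h2 := Equiv.sum_comp (Equiv.addRight ((2, 0) : ZMod 4 × ZMod 4))
    fun x => isotypicProj T t X x i j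
  have h3 : ∑ x, (isotypicProj T t X x i j + isotypicProj T t X (x + (2, 0)) i j) =
      2 * if i = j then 1 else 0 := by
    simp only [h1]
    rw [← Finset.sum_filter, Finset.sum_const, card_underlying, nsmul_eq_mul, Nat.cast_ofNat]
  rw [Finset.sum_add_distrib] at h3
  have h4 : (2 : ℂ) * ∑ x, isotypicProj T t X x i j = 2 * if i = j then 1 else 0 := by
    rw [← h3, two_mul]
    exact congrArg _ h2.symm
  exact mul_left_cancel₀ two_ne_zero h4

end Simples

end ToricZesting

namespace GrVec

variable {A : Type} [Group A] {w : ThreeCocycle A} {a b c : A} (h : a * b = c)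

lemma entry_comp_simpleTensor {W : GrVec w} (f : W ⟶ simple w a ⊗ simple w b) (k : W.ι) :
    entry (f ≫ (simpleTensor h).hom) k (base w c) = entry f k (pair (base w a) (base w b)) :=
  (entry_comp_mono (Y := simple w a ⊗ simple w b) (Z := simple w c) f (Equiv.punitProd Unit)
    (fun _ => ((1 : ℂˣ) : ℂ)) (fun _ => h) k (base w c)).trans (mul_one _)

lemma entry_simpleTensor_comp {W : GrVec w} (f : simple w c ⟶ W) (k : W.ι) :
    entry ((simpleTensor h).hom ≫ f) (pair (base w a) (base w b)) k = entry f (base w c) k :=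
  (entry_mono_comp (X := simple w a ⊗ simple w b) (Y := simple w c) (Equiv.punitProd Unit)
    (fun _ => ((1 : ℂˣ) : ℂ)) (fun _ => h) f (pair (base w a) (base w b)) k).trans (one_mul _)

end GrVec

namespace ToricZesting

open GrVec hiding simple
open ZestingDatum Functor.LaxMonoidal Functor.OplaxMonoidal Functor.Monoidal

variable {z : ToricZesting}

section Schur

variable {T : ZMod 2 × ZMod 4 → z.Label} {t : ZMod 4 × ZMod 4 → ℂˣ}
  (ht : ∀ x, t x ^ 2 = z.compositor (-1) (-1) (T (underlying x)))
  (hT : Function.Bijective T) (hneg : ∀ x, t (x + (2, 0)) = -t x)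

/-- The simple object of the equivariantisation with underlying object `T (underlying x)` and
`u_{-1} = t x`. -/
def chargedSimple (x : ZMod 4 × ZMod 4) : Equivariant z.action :=
  z.charged (T (underlying x)) (t x) (ht x)

include hT hneg

lemma chargedSimple_decompose (X : Equivariant z.action) :
    ∃ (K : Type) (_ : Fintype K) (x : K → ZMod 4 × ZMod 4) (i : ∀ k, chargedSimple ht (x k) ⟶ X)
      (p : ∀ k, X ⟶ chargedSimple ht (x k)), (∀ k, i k ≫ p k = 𝟙 _) ∧
      (∀ k l, k ≠ l → i k ≫ p l = 0) ∧ ∑ k, p k ≫ i k = 𝟙 X := by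
  choose r a b hba hab using fun x => exists_splitting_of_idempotent (isotypicProj T t X x)
    fun i j => (sum_isotypicProj_mul ht hT hneg x x i j).trans (if_pos rfl)
  have ha : ∀ x k j, ∑ i, a x k i * isotypicProj T t X x i j = a x k j := by
    intro x k j
    simp only [← hba, Finset.mul_sum]
    rw [Finset.sum_comm]
    simp only [← mul_assoc, ← Finset.sum_mul, hab]
    simp
  have hb : ∀ x k i, ∑ j, isotypicProj T t X x i j * b x k j = b x k i := by
    intro x k i
    simp only [← hba, Finset.sum_mul]
    rw [Finset.sum_comm]
    simp only [mul_assoc, ← Finset.mul_sum, hab]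
    simp
  have ha_deg : ∀ x k j, a x k j ≠ 0 → T (underlying x) = X.obj.deg j := by
    intro x k j h
    rw [← ha] at h
    obtain ⟨i, -, hi⟩ := Finset.exists_ne_zero_of_sum_ne_zero h
    exact (isotypicProj_deg (right_ne_zero_of_mul hi)).2.symm
  have hb_deg : ∀ x k j, b x k j ≠ 0 → X.obj.deg j = T (underlying x) := by
    intro x k j h
    rw [← hb] at h
    obtain ⟨i, -, hi⟩ := Finset.exists_ne_zero_of_sum_ne_zero h
    exact (isotypicProj_deg (left_ne_zero_of_mul hi)).1
  have hau : ∀ x k j, t x * a x k j = ∑ i, a x k i * actEntry X (-1) i j := by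
    intro x k j
    have h1 : ∀ i, a x k i * actEntry X (-1) i j =
        ∑ m, a x k m * (isotypicProj T t X x m i * actEntry X (-1) i j) := fun i => by
      conv_lhs => rw [← ha x k i, Finset.sum_mul]
      exact Finset.sum_congr rfl fun m _ => mul_assoc _ _ _
    simp only [h1]
    rw [Finset.sum_comm]
    simp only [← Finset.mul_sum, sum_isotypicProj_actEntry ht, mul_left_comm _ (t x : ℂ), ha]
  have hbu : ∀ x k i, ∑ j, actEntry X (-1) i j * b x k j = b x k i * t x := by
    intro x k i
    have h1 : ∀ j, actEntry X (-1) i j * b x k j =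
        ∑ m, (actEntry X (-1) i j * isotypicProj T t X x j m) * b x k m := fun j => by
      conv_lhs => rw [← hb x k j, Finset.mul_sum]
      exact Finset.sum_congr rfl fun m _ => (mul_assoc _ _ _).symm
    simp only [h1]
    rw [Finset.sum_comm]
    simp only [← Finset.sum_mul, sum_actEntry_isotypicProj ht]
    simp only [mul_assoc, ← Finset.mul_sum, hb]
    exact mul_comm (t x : ℂ) _
  let aHom : ∀ k : (Σ x, Fin (r x)), z.simple (T (underlying k.1)) ⟶ X.obj := fun k =>
    ofEntry (X := z.simple (T (underlying k.1))) (fun _ j => a k.1 k.2 j)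
      fun _ j h => ha_deg k.1 k.2 j h
  let bHom : ∀ k : (Σ x, Fin (r x)), X.obj ⟶ z.simple (T (underlying k.1)) := fun k =>
    ofEntry (Y := z.simple (T (underlying k.1))) (fun j _ => b k.1 k.2 j)
      fun j _ h => hb_deg k.1 k.2 j h
  let incl : ∀ k : (Σ x, Fin (r x)), chargedSimple ht k.1 ⟶ X := fun k => mkHom (aHom k) (by
    refine hom_ext fun _ j => (entry_diag_comp (z.simple (T (underlying k.1))) X.obj _ (aHom k)
      (base _ _) j).trans ?_
    exact (hau k.1 k.2 j).trans (entry_comp (aHom k) (actIso X (-1)).hom (base _ _) j).symm)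
  let proj : ∀ k : (Σ x, Fin (r x)), X ⟶ chargedSimple ht k.1 := fun k => mkHom (bHom k) (by
    refine hom_ext fun j _ => (entry_comp (actIso X (-1)).hom (bHom k) j (base _ _)).trans ?_
    exact (hbu k.1 k.2 j).trans (entry_comp_diag X.obj (z.simple (T (underlying k.1)))
      (fun _ => t k.1) (bHom k) j (base _ _)).symm)
  have hip : ∀ k l, entry (aHom k ≫ bHom l) (base _ _) (base _ _) =
      ∑ i, a k.1 k.2 i * b l.1 l.2 i := fun k l => entry_comp _ _ _ _
  have hpi : ∀ k i j, entry (bHom k ≫ aHom k) i j = b k.1 k.2 i * a k.1 k.2 j := fun k i j =>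
    (entry_comp _ _ _ _).trans (sum_base _)
  refine ⟨Σ x, Fin (r x), inferInstance, fun k => k.1, incl, proj, ?_, ?_, ?_⟩
  · intro k
    refine Equivariant.hom_ext (simple_hom_ext ((hip k k).trans ?_))
    rw [hab, if_pos rfl]
    exact ((entry_id (z.simple (T (underlying k.1))) (base _ _) (base _ _)).trans (if_pos rfl)).symm
  · rintro ⟨x, k⟩ ⟨y, l⟩ hkl
    refine Equivariant.hom_ext (simple_hom_ext ((hip _ _).trans ?_))
    change ∑ i, a x k i * b y l i = 0
    by_cases hxy : x = y
    · subst hxy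
      rw [hab, if_neg]
      rintro rfl
      exact hkl rfl
    · have h1 : ∀ i, a x k i * b y l i = ∑ m, ∑ n, a x k m * b y l n *
          (isotypicProj T t X x m i * isotypicProj T t X y i n) := fun i => by
        conv_lhs => rw [← ha x k i, ← hb y l i, Finset.sum_mul_sum]
        refine Finset.sum_congr rfl fun m _ => Finset.sum_congr rfl fun n _ => ?_
        ring
      simp only [h1]
      rw [Finset.sum_comm]
      refine Finset.sum_eq_zero fun m _ => ?_
      rw [Finset.sum_comm]
      refine Finset.sum_eq_zero fun n _ => ?_
      rw [← Finset.mul_sum, sum_isotypicProj_mul ht hT hneg, if_neg hxy, mul_zero]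
  · refine Equivariant.hom_ext (hom_ext fun i j => ?_)
    have h1 : (∑ k, proj k ≫ incl k).f = ∑ k, (proj k ≫ incl k).f :=
      map_sum (G := (X ⟶ X) →+ (X.obj ⟶ X.obj)) ⟨⟨fun f => f.f, rfl⟩, fun _ _ => rfl⟩ _ _
    rw [h1, entry_sum, Fintype.sum_sigma]
    refine (Finset.sum_congr rfl fun x _ => Finset.sum_congr rfl fun k _ => hpi ⟨x, k⟩ i j).trans ?_
    simp only [hba]
    rw [sum_isotypicProj hT hneg]
    exact (entry_id X.obj i j).symm

omit hT hneg in
lemma chargedSimple_hom_comm {x y : ZMod 4 × ZMod 4} (f : chargedSimple ht x ⟶ chargedSimple ht y)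
    (f' : z.simple (T (underlying x)) ⟶ z.simple (T (underlying y))) (hf : f' = f.f) :
    (t x : ℂ) * entry f' (base _ _) (base _ _) = entry f' (base _ _) (base _ _) * (t y : ℂ) := by
  have h : (diag (z.simple (T (underlying x))) fun _ => t x).hom ≫ f' =
      f' ≫ (diag (z.simple (T (underlying y))) fun _ => t y).hom := by
    rw [hf]
    exact hom_comp_actIso f (-1)
  have h2 := congrArg (fun f => entry f (base _ _) (base _ _)) h
  beta_reduce at h2
  rwa [entry_diag_comp, entry_comp_diag] at h2

lemma chargedSimple_isSchurFamily : IsSchurFamily (chargedSimple ht) where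
  hom_eq_zero {x y} hxy f := by
    refine Equivariant.hom_ext (simple_hom_ext ?_)
    by_contra h
    have hu := hT.1 (entry_deg f.f h)
    have hyx : y = x + (2, 0) := (eq_or_eq_of_underlying x y hu).resolve_left hxy
    have h1 := chargedSimple_hom_comm ht f f.f rfl
    have h2 : (t y : ℂ) = -t x := by rw [hyx, hneg, Units.val_neg]
    rw [h2] at h1
    have h3 := (t x).ne_zero
    refine h (mul_left_cancel₀ (mul_ne_zero two_ne_zero h3) ?_)
    refine Eq.trans ?_ (mul_zero _).symm
    linear_combination h1
  hom_eq_smul f := ⟨_, Equivariant.hom_ext (simple_hom_eq_smul f.f)⟩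
  id_ne_zero x h := id_simple_ne_zero (w := z.cocycle) (T (underlying x))
    (congrArg Equivariant.Hom.f h)
  decompose := chargedSimple_decompose ht hT hneg

omit hT hneg

/-- The simple objects multiply like `ℤ/4 × ℤ/4`. -/
def chargedSimpleTensor (hadd : ∀ x y, T (x + y) = T x * T y)
    (hmul : ∀ x y, t x * t y = z.tensorator (-1) (T (underlying x)).deg (T (underlying y)).deg *
      t (x + y)) (x y : ZMod 4 × ZMod 4) :
    chargedSimple ht x ⊗ chargedSimple ht y ≅ chargedSimple ht (x + y) :=
  mkEquivariantIso (X := chargedSimple ht x ⊗ chargedSimple ht y)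
    (simpleTensor (by rw [underlying_add, hadd])) (by
      have h : (((z.tensorator (-1) (T (underlying x)).deg (T (underlying y)).deg)⁻¹ : ℂˣ) : ℂ) *
          ((t x : ℂ) * t y) = t (x + y) := by
        rw [← Units.val_mul, ← Units.val_mul, hmul, inv_mul_cancel_left]
      refine hom_ext ?_
      rintro ⟨⟨⟩, ⟨⟩⟩ ⟨⟩
      refine (entry_comp_simpleTensor _ _ (pair (base _ _) (base _ _))).trans ?_
      refine Eq.trans ?_ (entry_simpleTensor_comp _ _ (base _ _)).symm
      exact (actEntry_tensor (chargedSimple ht x) (chargedSimple ht y) (-1) (base _ _) (base _ _)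
        (base _ _) (base _ _)).trans h)

def chargedSimpleUnit (h0 : T 0 = 1) (ht0 : t 0 = 1) : chargedSimple ht 0 ≅ 𝟙_ _ :=
  mkEquivariantIso (X := chargedSimple ht 0) (Y := 𝟙_ (Equivariant z.action)) (simpleUnit h0) (by
    have h1 : (actIso (𝟙_ (Equivariant z.action)) (-1)).hom = 𝟙 _ := rfl
    have h2 : (actIso (chargedSimple ht 0) (-1)).hom = 𝟙 _ :=
      diag_one (X := z.simple (T (underlying 0))) fun _ => ht0
    rw [h1, h2, Category.id_comp, Category.comp_id])

end Schur

end ToricZesting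

lemma CrossedBraiding.IsEquivariantBraiding.hom_eq {G : Type} [Group G] {C : Type*} [Category C]
    [MonoidalCategory C] [Preadditive C] {a : MonoidalAction G C} {cb : CrossedBraiding a}
    {b : BraidedCategory (Equivariant a)} (hb : cb.IsEquivariantBraiding b) (X : Equivariant a)
    {Y : Equivariant a} {h : G} (hY : cb.sector h Y.obj) : (b.braiding X Y).hom.f =
      (cb.braid X.obj hY).hom ≫ Y.obj ◁ (X.u h).hom := by
  have h1 := hb X Y h Y.obj hY (𝟙 _)
  rw [MonoidalCategory.whiskerLeft_id, MonoidalCategory.id_whiskerRight, Category.comp_id] at h1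
  exact (Category.id_comp _).symm.trans h1

namespace ToricZesting

open GrVec hiding simple
open ZestingDatum Functor.LaxMonoidal Functor.OplaxMonoidal Functor.Monoidal

variable {z : ToricZesting}

lemma entry_associator_simple (X Y W : z.Label) :
    entry (α_ (z.simple X) (z.simple Y) (z.simple W)).hom
      (pair (pair (base _ X) (base _ Y)) (base _ W)) (pair (base _ X) (pair (base _ Y) (base _ W))) =
      z.cocycle.toFun X Y W := by
  rw [GrVec.associator_hom]
  exact (entry_mono _ _ _ _ _).trans (if_pos rfl)

lemma entry_braid_simple (X Y : z.Label) {h : ℤˣ} (hY : z.crossedBraiding.sector h (z.simple Y)) :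
    entry (z.crossedBraiding.braid (z.simple X) hY).hom (pair (base _ X) (base _ Y))
      (pair (X := z.simple Y) (Y := z.simple X) (base _ Y) (base _ X)) = z.braidScalar X Y :=
  (entry_mono (z.swapEquiv (z.simple X) (z.simple Y)) (fun _ => (z.braidScalar X Y : ℂ)) (fun i =>
    z.swap_deg (z.simple X) (z.simple Y) i) (pair (base _ X) (base _ Y))
      (pair (X := z.simple Y) (Y := z.simple X) (base _ Y) (base _ X))).trans (if_pos rfl)

lemma diag_simple_hom (X : z.Label) (s : ℂˣ) :
    (diag (z.simple X) fun _ => s).hom = (s : ℂ) • 𝟙 (z.simple X) :=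
  simple_hom_ext (by
    rw [entry_smul, entry_id, if_pos rfl, mul_one, diag_hom]
    exact (entry_mono _ _ _ _ _).trans (if_pos rfl))

lemma extensionData {T : ZMod 2 × ZMod 4 → z.Label}
    {assoc : ZMod 2 × ZMod 4 → ZMod 2 × ZMod 4 → ZMod 2 × ZMod 4 → ℂˣ}
    {braid tens : ZMod 2 × ZMod 4 → ZMod 2 × ZMod 4 → ℂˣ} {comp : ZMod 2 × ZMod 4 → ℂˣ}
    (hT : Function.Bijective T) (hadd : ∀ x y, T (x + y) = T x * T y)
    (hassoc : ∀ x y w, z.cocycle.toFun (T x) (T y) (T w) = assoc x y w)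
    (hbraid : ∀ x y, z.braidScalar (T x) (T y) = braid x y)
    (htens : ∀ x y, z.tensorator (-1) (T x).deg (T y).deg = tens x y)
    (hcomp : ∀ x, z.compositor (-1) (-1) (T x) = comp x) :
    ExtensionData z z.crossedBraiding T assoc braid tens comp where
  zested := z.crossedBraiding_isZested
  extension := z.crossedBraiding_isExtensionOf
  label_add := hadd
  fusion := by
    have h0 : T 0 = 1 := by
      have h := hadd 0 0
      rwa [add_zero, right_eq_mul] at h
    exact (GrVec.isSchurFamily hT).identifiesFusionRings (PointedCat.isSchurFamily _)
      ⟨simpleUnit h0⟩ ⟨simpleUnit rfl⟩ (fun x y => ⟨simpleTensor (hadd x y).symm⟩)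
      fun x y => ⟨simpleTensor rfl⟩
  associator x y w := (entry_associator_simple _ _ _).trans (congrArg Units.val (hassoc x y w))
  braiding x y h hY := (entry_braid_simple _ _ hY).trans (congrArg Units.val (hbraid x y))
  tensorator x y := by
    change (tensIso z.actionData (-1) (z.simple (T x)) (z.simple (T y))).hom = _
    refine hom_ext ?_
    rintro ⟨⟨⟩, ⟨⟩⟩ ⟨⟨⟩, ⟨⟩⟩
    rw [entry_smul, entry_id, if_pos rfl, mul_one, ← htens, tensIso, diag_hom]
    exact (entry_mono _ _ _ _ _).trans (if_pos rfl)
  compositor x := by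
    rw [← hcomp]
    exact diag_simple_hom (T x) (z.compositor (-1) (-1) (T x))

lemma isProjectiveCocycle (X : z.Label) (n b : ℂˣ) (h : b * n ^ 2 = z.compositor (-1) (-1) X) :
    IsProjectiveCocycle z.action (z.simple X) (fun g => z.scalarIso X (atNeg n g) g)
      (atNegNeg b) := by
  intro g k
  rw [Iso.inv_comp_eq]
  change (compIso z.actionData g k (z.simple X)).inv ≫
    (diag (z.simple X) fun _ => atNeg n k).hom ≫ (diag (z.simple X) fun _ => atNeg n g).hom =
    (diag (z.simple X) fun _ => atNeg n (k * g)).hom ≫ _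
  rw [Iso.inv_comp_eq]
  change _ = (diag (z.simple X) fun _ => z.compositor g k X).hom ≫ _
  simp only [diag_simple_hom, Linear.comp_smul, Category.comp_id, smul_smul,
    ← Units.val_mul]
  congr 2
  rcases Int.units_eq_one_or g with rfl | rfl <;> rcases Int.units_eq_one_or k with rfl | rfl
  · have := z.actionData.comp_one_left 1 X
    simp_all [atNeg, atNegNeg, actionData]
  · have := z.actionData.comp_one_left (-1) X
    simp_all [atNeg, atNegNeg, actionData]
  · have := z.actionData.comp_one_right (-1) X
    simp_all [atNeg, atNegNeg, actionData]
  · change n * n = b⁻¹ * 1 * z.compositor (-1) (-1) X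
    rw [← h, mul_one, inv_mul_cancel_left, sq]

lemma equivariantisationData {T : ZMod 2 × ZMod 4 → z.Label} {ν β : ZMod 2 × ZMod 4 → ℂˣ}
    {sub : ZMod 4 × ZMod 4 → ℂˣ}
    {assoc : ZMod 4 × ZMod 4 → ZMod 4 × ZMod 4 → ZMod 4 × ZMod 4 → ℂˣ}
    {braid : ZMod 4 × ZMod 4 → ZMod 4 × ZMod 4 → ℂˣ}
    (hT : Function.Bijective T) (hadd : ∀ x y, T (x + y) = T x * T y)
    (hassoc : ∀ x y w, z.cocycle.toFun (T (underlying x)) (T (underlying y)) (T (underlying w)) =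
      assoc x y w)
    (hβ : ∀ y, β y * ν y ^ 2 = z.compositor (-1) (-1) (T y))
    (hsub : ∀ x, sub x ^ 2 = β (underlying x)) (hneg : ∀ x, sub (x + (2, 0)) = -sub x)
    (hmul : ∀ x y, (sub x * ν (underlying x)) * (sub y * ν (underlying y)) =
      z.tensorator (-1) (T (underlying x)).deg (T (underlying y)).deg *
        (sub (x + y) * ν (underlying (x + y))))
    (hbraid : ∀ x y, z.braidScalar (T (underlying x)) (T (underlying y)) *
      atNeg (sub x * ν (underlying x)) (T (underlying y)).deg = braid x y) :
    EquivariantisationData z z.crossedBraiding T ν β sub assoc braid where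
  cocycle y := isProjectiveCocycle (T y) (ν y) (β y) (hβ y)
  projective := hsub
  simples := by
    have ht : ∀ x, (sub x * ν (underlying x)) ^ 2 = z.compositor (-1) (-1) (T (underlying x)) :=
      fun x => by rw [mul_pow, hsub, hβ]
    have hneg' : ∀ x, sub (x + (2, 0)) * ν (underlying (x + (2, 0))) =
        -(sub x * ν (underlying x)) := fun x => by
      rw [hneg, underlying_add_two, neg_mul]
    have h0 : T 0 = 1 := by
      have h := hadd 0 0
      rwa [add_zero, right_eq_mul] at h
    have ht0 : sub 0 * ν (underlying 0) = 1 := by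
      have h := hmul 0 0
      have hu : underlying 0 = 0 := by decide
      rw [add_zero, hu, h0, Label.one_deg] at h
      rwa [show z.tensorator (-1) 1 1 = 1 from z.actionData.tens_one_left (-1) 1, one_mul,
        mul_eq_right] at h
    have hS := chargedSimple_isSchurFamily ht hT hneg'
    refine ⟨ht, hS.identifiesFusionRings (PointedCat.isSchurFamily _)
      ⟨chargedSimpleUnit ht h0 ht0⟩ ⟨simpleUnit rfl⟩
      (fun x y => ⟨chargedSimpleTensor ht hadd hmul x y⟩) (fun x y => ⟨simpleTensor rfl⟩),
      ⟨chargedSimpleUnit ht h0 ht0⟩, fun x y => ⟨chargedSimpleTensor ht hadd hmul x y⟩,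
      fun x y w => ?_, ⟨_, equivariantBraided_isEquivariantBraiding⟩, fun b hb x y => ?_⟩
    · exact (entry_associator_simple _ _ _).trans (congrArg Units.val (hassoc x y w))
    · have hY : z.crossedBraiding.sector (T (underlying y)).deg (chargedSimple ht y).obj :=
        fun _ => rfl
      have h3 := (hb.hom_eq (chargedSimple ht x) hY).trans
        (equivariantBraided_isEquivariantBraiding.hom_eq (chargedSimple ht x) hY).symm
      have h5 : entry (eqBraidIso (chargedSimple ht x) (chargedSimple ht y)).hom
          (pair (base _ _) (base _ _)) (pair (base _ _) (base _ _)) = braid x y := by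
        rw [← hbraid]
        refine (entry_eqBraid (chargedSimple ht x) (chargedSimple ht y) (base _ _) (base _ _)
          (base _ _) (base _ _)).trans ?_
        exact (congrArg (_ * ·) (if_pos rfl)).trans (Units.val_mul _ _).symm
      exact (congrArg (fun f => entry f _ _) h3).trans h5

end ToricZesting

namespace ToricZesting

open ZestingDatum

/-! ### Existence of zesting data -/

lemma nu_sq (z : ToricZesting) : z.nu (-1) (-1) (-1) * z.nu (-1) (-1) (-1) =
    toricBraiding.toFun (z.lam (-1) (-1)) (z.lam (-1) (-1)) := by
  have h := z.nu_pentagon (-1) (-1) (-1) (-1)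
  simpa [z.nu_unit, nu_one_left, nu_one_right] using h

/-- The zesting datum with `λ(-1,-1) = v` and defectification `p`. -/
def ofSquare (v : ZMod 2 × ZMod 2) (p : ℂˣ) (h : p * p = toricBraiding.toFun v v) :
    ToricZesting where
  lam g k := if g = 1 ∨ k = 1 then 0 else v
  nu g k l := if g = 1 ∨ k = 1 ∨ l = 1 then 1 else p
  lam_one_left g := by simp
  lam_one_right g := by simp
  lam_symm g k := by simp only [or_comm]
  lam_cocycle g k l := by
    rcases Int.units_eq_one_or g with rfl | rfl <;> rcases Int.units_eq_one_or k with rfl | rfl <;>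
      rcases Int.units_eq_one_or l with rfl | rfl <;> simp
  nu_unit g k := by simp
  nu_pentagon g k l m := by
    rcases Int.units_eq_one_or g with rfl | rfl <;> rcases Int.units_eq_one_or k with rfl | rfl <;>
      rcases Int.units_eq_one_or l with rfl | rfl <;>
      rcases Int.units_eq_one_or m with rfl | rfl <;>
      simp [h, toricBraiding.zero_left, toricBraiding.zero_right]

lemma exists_iff (v : ZMod 2 × ZMod 2) (p : ℂˣ) :
    (∃ z : ToricZesting, z.lam (-1) (-1) = v ∧ z.nu (-1) (-1) (-1) = p) ↔
      p * p = toricBraiding.toFun v v := by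
  constructor
  · rintro ⟨z, rfl, rfl⟩
    exact z.nu_sq
  · exact fun h => ⟨ofSquare v p h, rfl, rfl⟩

lemma iU_mul_iU : iU * iU = -1 := Units.ext (by simp [iU])

lemma mul_self_eq_mul_self_iff_units (p u : ℂˣ) : p * p = u * u ↔ p = u ∨ p = -u := by
  simp only [Units.ext_iff, Units.val_mul, Units.val_neg]
  exact mul_self_eq_mul_self_iff

/-! ### Scalars in terms of exponents -/

lemma parity_cases : ∀ l : ZMod 4, (parity l = 0 ∧ (-1 : ℤˣ) ^ l.val = 1) ∨
    (parity l = 1 ∧ (-1 : ℤˣ) ^ l.val = -1) := by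
  decide

lemma neg_one_pow_add : ∀ a b : ZMod 4,
    (-1 : ℤˣ) ^ (a + b).val = (-1) ^ a.val * (-1) ^ b.val := by
  decide

lemma atNeg_pow (s : ℂˣ) (a : ZMod 4) : atNeg s ((-1) ^ a.val) = s ^ parity a := by
  rcases parity_cases a with ⟨h, h'⟩ | ⟨h, h'⟩
  · rw [h, h', pow_zero]
    rfl
  · rw [h, h', pow_one]
    rfl

variable (z : ToricZesting)

lemma nu_pow {p : ℂˣ} (hp : z.nu (-1) (-1) (-1) = p) (a b d : ZMod 4) :
    z.nu ((-1) ^ a.val) ((-1) ^ b.val) ((-1) ^ d.val) = p ^ (parity a * parity b * parity d) := by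
  rcases parity_cases a with ⟨h1, h1'⟩ | ⟨h1, h1'⟩ <;>
    rcases parity_cases b with ⟨h2, h2'⟩ | ⟨h2, h2'⟩ <;>
    rcases parity_cases d with ⟨h3, h3'⟩ | ⟨h3, h3'⟩ <;>
    simp [h1, h1', h2, h2', h3, h3', z.nu_unit, nu_one_left, nu_one_right, hp]

lemma lam_pow {v : ZMod 2 × ZMod 2} (hv : z.lam (-1) (-1) = v) (a b : ZMod 4) :
    z.lam ((-1) ^ a.val) ((-1) ^ b.val) = (parity a * parity b) • v := by
  rcases parity_cases a with ⟨h1, h1'⟩ | ⟨h1, h1'⟩ <;>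
    rcases parity_cases b with ⟨h2, h2'⟩ | ⟨h2, h2'⟩ <;>
    simp [h1, h1', h2, h2', z.lam_one_left, z.lam_one_right, hv]

lemma tensorator_pow {p : ℂˣ} (hp : z.nu (-1) (-1) (-1) = p) (a b : ZMod 4) :
    z.tensorator (-1) ((-1) ^ a.val) ((-1) ^ b.val) = p⁻¹ ^ (parity a * parity b) := by
  rcases parity_cases a with ⟨h1, h1'⟩ | ⟨h1, h1'⟩ <;>
    rcases parity_cases b with ⟨h2, h2'⟩ | ⟨h2, h2'⟩ <;>
    simp [h1, h1', h2, h2', tensorator, z.nu_unit, nu_one_left, nu_one_right, hp]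

lemma compositor_pow {v : ZMod 2 × ZMod 2} {p : ℂˣ} (hv : z.lam (-1) (-1) = v)
    (hp : z.nu (-1) (-1) (-1) = p) (a : ZMod 4) (x : ZMod 2 × ZMod 2) :
    z.compositor (-1) (-1) ⟨(-1) ^ a.val, x⟩ = monodromy toricBraiding x v * p ^ parity a := by
  rcases parity_cases a with ⟨h1, h1'⟩ | ⟨h1, h1'⟩ <;>
    simp [h1, h1', compositor, z.nu_unit, nu_one_left, nu_one_right, hp, hv]

lemma pow_congr_of_mod {u : ℂˣ} {N a b : ℕ} (hu : u ^ N = 1) (h : a % N = b % N) :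
    u ^ a = u ^ b := by
  rw [pow_eq_pow_mod a hu, pow_eq_pow_mod b hu, h]

/-! ### Fractionalisation by `e` -/

lemma labelE_bijective : Function.Bijective (labelE z) := by
  have h1 : ∀ x y : ZMod 2 × ZMod 4, (-1 : ℤˣ) ^ x.2.val = (-1) ^ y.2.val →
      (x.1, (halfFloor x.2 : ZMod 2)) = (y.1, (halfFloor y.2 : ZMod 2)) → x = y := by
    decide
  have h2 : ∀ (g : ℤˣ) (b : ZMod 2 × ZMod 2), ∃ x : ZMod 2 × ZMod 4, (-1 : ℤˣ) ^ x.2.val = g ∧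
      (x.1, (halfFloor x.2 : ZMod 2)) = b := by
    decide
  refine ⟨fun x y h => h1 x y (congrArg Label.deg h) (congrArg Label.base h), fun X => ?_⟩
  obtain ⟨x, hx, hx'⟩ := h2 X.deg X.base
  exact ⟨x, Label.ext hx hx'⟩

lemma labelE_add (hv : z.lam (-1) (-1) = (0, 1)) (x y : ZMod 2 × ZMod 4) :
    labelE z (x + y) = labelE z x * labelE z y := by
  have h : ∀ x y : ZMod 2 × ZMod 4, ((x + y).1, (halfFloor (x + y).2 : ZMod 2)) =
      (x.1, (halfFloor x.2 : ZMod 2)) + (y.1, (halfFloor y.2 : ZMod 2)) +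
        (parity x.2 * parity y.2) • (0, 1) := by
    decide
  refine Label.ext (neg_one_pow_add x.2 y.2) ((h x y).trans ?_)
  rw [← z.lam_pow hv]
  rfl

lemma cocycle_labelE {p : ℂˣ} (hv : z.lam (-1) (-1) = (0, 1)) (hp : z.nu (-1) (-1) (-1) = p)
    (x y w : ZMod 2 × ZMod 4) :
    z.cocycle.toFun (labelE z x) (labelE z y) (labelE z w) = assocE p x y w := by
  have h : ∀ (a b : ZMod 4) (d : ZMod 2), Even (((parity a * parity b) •
      ((0, 1) : ZMod 2 × ZMod 2)).2.val * d.val) ↔ Even (a.val * b.val * d.val) := by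
    decide
  change toricBraiding.toFun (z.lam ((-1) ^ x.2.val) ((-1) ^ y.2.val)) _ *
    z.nu ((-1) ^ x.2.val) ((-1) ^ y.2.val) ((-1) ^ w.2.val) = _
  rw [z.lam_pow hv, z.nu_pow hp]
  exact congrArg (· * _) (neg_one_pow_congr (h x.2 y.2 w.1))

lemma braidScalar_labelE (x y : ZMod 2 × ZMod 4) :
    z.braidScalar (labelE z x) (labelE z y) = braidE x y := by
  have h : ∀ (a : ZMod 4) (d : ZMod 2),
      Even ((halfFloor a : ZMod 2).val * d.val) ↔ Even (halfFloor a * d.val) := by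
    decide
  exact neg_one_pow_congr (h x.2 y.1)

lemma compositor_labelE {p : ℂˣ} (hv : z.lam (-1) (-1) = (0, 1))
    (hp : z.nu (-1) (-1) (-1) = p) (x : ZMod 2 × ZMod 4) :
    z.compositor (-1) (-1) (labelE z x) = comp p x := by
  refine (z.compositor_pow hv hp x.2 _).trans (congrArg (· * _) ?_)
  have h : ∀ (a : ZMod 2) (b : ZMod 2), Even (b.val * (0 : ZMod 2).val + (1 : ZMod 2).val * a.val) ↔
      Even a.val := by
    decide
  exact (pow_add _ _ _).symm.trans (neg_one_pow_congr (h x.1 _))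

lemma iU_pow_two : iU ^ 2 = -1 := by rw [sq, iU_mul_iU]

lemma iU_pow_four : iU ^ 4 = 1 := by rw [pow_mul iU 2 2, iU_pow_two, neg_one_sq]

/-- The case `p = (-1)^n`, where the subscript of `m^k e^l` is `i^(k + n π(l))`. -/
lemma equivariantisationData_labelE {p : ℂˣ} (hv : z.lam (-1) (-1) = (0, 1))
    (hp : z.nu (-1) (-1) (-1) = p) (n : Fin 2) (hn : p = (-1) ^ n.val) :
    EquivariantisationData z z.crossedBraiding (labelE z) (fun _ => 1)
      (fun y => (-1) ^ y.1.val * p ^ parity y.2) (fun x => iU ^ (x.1.val + n.val * parity x.2))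
      (fun x y w => assocE p (underlying x) (underlying y) (underlying w))
      (fun x y => (-1) ^ (halfFloor x.2 * y.1.val) *
        iU ^ (parity y.2 * (x.1.val + n.val * parity x.2))) := by
  have hn' : p⁻¹ = (-1) ^ n.val := by rw [hn, ← inv_pow, inv_neg_one]
  refine equivariantisationData (labelE_bijective z) (labelE_add z hv)
    (fun x y w => cocycle_labelE z hv hp _ _ _) (fun y => ?_) (fun x => ?_) (fun x => ?_)
    (fun x y => ?_) (fun x y => ?_)
  · rw [compositor_labelE z hv hp, one_pow, mul_one]
    rfl
  · rw [hn]
    simp only [← iU_pow_two, ← pow_mul, ← pow_add]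
    refine pow_congr_of_mod iU_pow_four ?_
    clear hn hn' hv hp
    revert n x
    decide +kernel
  · rw [neg_eq_neg_one_mul]
    simp only [← iU_pow_two, ← pow_add]
    refine pow_congr_of_mod iU_pow_four ?_
    clear hn hn' hv hp
    revert n x
    decide +kernel
  · refine Eq.trans ?_ (congrArg (· * _) (z.tensorator_pow hp x.2 y.2).symm)
    rw [hn']
    simp only [← iU_pow_two, ← pow_mul, ← pow_add, mul_one]
    refine pow_congr_of_mod iU_pow_four ?_
    clear hn hn' hv hp
    revert n x y
    decide +kernel
  · refine (congrArg₂ (· * ·) (braidScalar_labelE z _ _) (atNeg_pow _ y.2)).trans ?_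
    simp only [braidE, ← iU_pow_two, ← pow_mul, ← pow_add, mul_one]
    refine pow_congr_of_mod iU_pow_four ?_
    clear hn hn' hv hp
    revert n x y
    decide +kernel

/-! ### Fractionalisation by `f` -/

lemma labelF_bijective : Function.Bijective (labelF z) := by
  have h1 : ∀ x y : ZMod 2 × ZMod 4, (-1 : ℤˣ) ^ x.2.val = (-1) ^ y.2.val →
      (x.1 + (halfFloor x.2 : ZMod 2), (halfFloor x.2 : ZMod 2)) =
        (y.1 + (halfFloor y.2 : ZMod 2), (halfFloor y.2 : ZMod 2)) → x = y := by
    decide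
  have h2 : ∀ (g : ℤˣ) (b : ZMod 2 × ZMod 2), ∃ x : ZMod 2 × ZMod 4, (-1 : ℤˣ) ^ x.2.val = g ∧
      (x.1 + (halfFloor x.2 : ZMod 2), (halfFloor x.2 : ZMod 2)) = b := by
    decide
  refine ⟨fun x y h => h1 x y (congrArg Label.deg h) (congrArg Label.base h), fun X => ?_⟩
  obtain ⟨x, hx, hx'⟩ := h2 X.deg X.base
  exact ⟨x, Label.ext hx hx'⟩

lemma labelF_add (hv : z.lam (-1) (-1) = (1, 1)) (x y : ZMod 2 × ZMod 4) :
    labelF z (x + y) = labelF z x * labelF z y := by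
  have h : ∀ x y : ZMod 2 × ZMod 4,
      ((x + y).1 + (halfFloor (x + y).2 : ZMod 2), (halfFloor (x + y).2 : ZMod 2)) =
      (x.1 + (halfFloor x.2 : ZMod 2), (halfFloor x.2 : ZMod 2)) +
        (y.1 + (halfFloor y.2 : ZMod 2), (halfFloor y.2 : ZMod 2)) +
        (parity x.2 * parity y.2) • (1, 1) := by
    decide
  refine Label.ext (neg_one_pow_add x.2 y.2) ((h x y).trans ?_)
  rw [← z.lam_pow hv]
  rfl

lemma cocycle_labelF {p : ℂˣ} (hv : z.lam (-1) (-1) = (1, 1)) (hp : z.nu (-1) (-1) (-1) = p)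
    (x y w : ZMod 2 × ZMod 4) :
    z.cocycle.toFun (labelF z x) (labelF z y) (labelF z w) = assocF p x y w := by
  have h : ∀ (a b : ZMod 4) (w : ZMod 2 × ZMod 4), Even (((parity a * parity b) •
      ((1, 1) : ZMod 2 × ZMod 2)).2.val * (w.1 + (halfFloor w.2 : ZMod 2)).val) ↔
        Even (a.val * b.val * (w.1.val + halfFloor w.2)) := by
    decide
  change toricBraiding.toFun (z.lam ((-1) ^ x.2.val) ((-1) ^ y.2.val)) _ *
    z.nu ((-1) ^ x.2.val) ((-1) ^ y.2.val) ((-1) ^ w.2.val) = _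
  rw [z.lam_pow hv, z.nu_pow hp]
  exact congrArg (· * _) (neg_one_pow_congr (h x.2 y.2 w))

lemma braidScalar_labelF (x y : ZMod 2 × ZMod 4) :
    z.braidScalar (labelF z x) (labelF z y) = braidF x y := by
  have h : ∀ (a : ZMod 4) (y : ZMod 2 × ZMod 4),
      Even ((halfFloor a : ZMod 2).val * (y.1 + (halfFloor y.2 : ZMod 2)).val) ↔
        Even (halfFloor a * (y.1.val + halfFloor y.2)) := by
    decide
  exact neg_one_pow_congr (h x.2 y)

lemma compositor_labelF {p : ℂˣ} (hv : z.lam (-1) (-1) = (1, 1))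
    (hp : z.nu (-1) (-1) (-1) = p) (x : ZMod 2 × ZMod 4) :
    z.compositor (-1) (-1) (labelF z x) = comp p x := by
  refine (z.compositor_pow hv hp x.2 _).trans (congrArg (· * _) ?_)
  have h : ∀ x : ZMod 2 × ZMod 4, Even ((halfFloor x.2 : ZMod 2).val * (1 : ZMod 2).val +
      (1 : ZMod 2).val * (x.1 + (halfFloor x.2 : ZMod 2)).val) ↔ Even x.1.val := by
    decide
  exact (pow_add _ _ _).symm.trans (neg_one_pow_congr (h x))

lemma projectiveScalar_mul_sq {p ζ : ℂˣ} (hζ : ζ ^ 2 = -iU) (b : ZMod 2 × ZMod 4) :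
    (-1) ^ b.1.val * (iU * p) ^ parity b.2 * (ζ ^ parity b.2) ^ 2 = comp p b := by
  have h : iU * p * -iU = p := by rw [mul_neg, mul_right_comm, iU_mul_iU, neg_one_mul, neg_neg]
  rw [← pow_mul, mul_comm (parity b.2), pow_mul, hζ, mul_assoc, ← mul_pow, h]
  rfl

/-- The cases `p = -i` and `p = i`, where the subscript of `m^k f^j` is `i^(k + n π(j))`. -/
lemma equivariantisationData_labelF {p ζ : ℂˣ} (hv : z.lam (-1) (-1) = (1, 1))
    (hp : z.nu (-1) (-1) (-1) = p) (hζ : ζ ^ 2 = -iU) (n : Fin 2) (hn : p = (-1) ^ n.val * -iU) :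
    EquivariantisationData z z.crossedBraiding (labelF z)
      (fun y => (-1) ^ halfFloor y.2 * ζ ^ parity y.2)
      (fun y => (-1) ^ y.1.val * (iU * p) ^ parity y.2)
      (fun x => iU ^ (x.1.val + n.val * parity x.2))
      (fun x y w => assocF p (underlying x) (underlying y) (underlying w))
      (fun x y => (-1) ^ (halfFloor x.2 * (y.1.val + halfFloor y.2 + parity y.2)) *
        ζ ^ (parity x.2 * parity y.2) * iU ^ ((x.1.val + n.val * parity x.2) * parity y.2)) := by
  have h4 : ζ ^ 4 = -1 := by rw [pow_mul ζ 2 2, hζ, neg_sq, iU_pow_two]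
  have h6 : iU = ζ ^ 6 := by rw [pow_add ζ 4 2, h4, hζ, neg_one_mul, neg_neg]
  have h8 : ζ ^ 8 = 1 := by rw [pow_mul ζ 4 2, h4, neg_one_sq]
  have hn' : p = ζ ^ (4 * n.val + 2) := by rw [hn, ← h4, ← hζ, ← pow_mul, ← pow_add]
  have hn'' : p⁻¹ = ζ ^ (4 * n.val + 6) := by
    rw [inv_eq_iff_mul_eq_one, hn', ← pow_add, ← pow_zero ζ]
    refine pow_congr_of_mod h8 ?_
    clear hn hn' hp hv
    revert n
    decide
  refine equivariantisationData (labelF_bijective z) (labelF_add z hv)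
    (fun x y w => cocycle_labelF z hv hp _ _ _) (fun y => ?_) (fun x => ?_) (fun x => ?_)
    (fun x y => ?_) (fun x y => ?_)
  · rw [compositor_labelF z hv hp, mul_pow ((-1) ^ _), ← pow_mul, mul_comm _ 2, pow_mul, neg_one_sq,
      one_pow, one_mul]
    exact projectiveScalar_mul_sq hζ y
  · rw [hn']
    simp only [← h4, h6, ← pow_mul, ← pow_add]
    refine pow_congr_of_mod h8 ?_
    clear hn hn' hn'' hv hp
    revert n x
    decide +kernel
  · rw [neg_eq_neg_one_mul]
    simp only [← h4, h6, ← pow_mul, ← pow_add]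
    refine pow_congr_of_mod h8 ?_
    clear hn hn' hn'' hv hp
    revert n x
    decide +kernel
  · refine Eq.trans ?_ (congrArg (· * _) (z.tensorator_pow hp x.2 y.2).symm)
    rw [hn'']
    simp only [← h4, h6, ← pow_mul, ← pow_add]
    refine pow_congr_of_mod h8 ?_
    clear hn hn' hn'' hv hp
    revert n x y
    decide +kernel
  · refine (congrArg₂ (· * ·) (braidScalar_labelF z _ _) (atNeg_pow _ y.2)).trans ?_
    simp only [braidF, ← h4, h6, ← pow_mul, ← pow_add]
    refine pow_congr_of_mod h8 ?_
    clear hn hn' hn'' hv hp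
    revert n x y
    decide +kernel

end ToricZesting

open ToricZesting

theorem mainTheorem7 :
    -- fractionalisation `λ(-1,-1) = e`
    ((∀ p : ℂˣ, (∃ z : ToricZesting, z.lam (-1) (-1) = (0, 1) ∧ z.nu (-1) (-1) (-1) = p) ↔
        p = 1 ∨ p = -1) ∧
      ∀ (z : ToricZesting) (p : ℂˣ), z.lam (-1) (-1) = (0, 1) → z.nu (-1) (-1) (-1) = p →
        ∃ cb : CrossedBraiding z.action,
          ToricZesting.ExtensionData z cb (ToricZesting.labelE z) (ToricZesting.assocE p)
            ToricZesting.braidE (ToricZesting.tens p) (ToricZesting.comp p) ∧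
          (p = 1 → ToricZesting.EquivariantisationData z cb (ToricZesting.labelE z)
            (fun _ => 1) (fun y => (-1) ^ y.1.val * p ^ parity y.2)
            (fun x => iU ^ x.1.val)
            (fun x y w => ToricZesting.assocE p (underlying x) (underlying y) (underlying w))
            (fun x y => (-1) ^ (halfFloor x.2 * y.1.val) * iU ^ (parity y.2 * x.1.val))) ∧
          (p = -1 → ToricZesting.EquivariantisationData z cb (ToricZesting.labelE z)
            (fun _ => 1) (fun y => (-1) ^ y.1.val * p ^ parity y.2)
            (fun x => iU ^ (x.1.val + parity x.2))
            (fun x y w => ToricZesting.assocE p (underlying x) (underlying y) (underlying w))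
            (fun x y => (-1) ^ (halfFloor x.2 * y.1.val) *
              iU ^ (parity y.2 * (x.1.val + parity x.2))))) ∧
    -- fractionalisation `λ(-1,-1) = f`
    ((∀ p : ℂˣ, (∃ z : ToricZesting, z.lam (-1) (-1) = (1, 1) ∧ z.nu (-1) (-1) (-1) = p) ↔
        p = iU ∨ p = -iU) ∧
      ∀ (z : ToricZesting) (p : ℂˣ), z.lam (-1) (-1) = (1, 1) → z.nu (-1) (-1) (-1) = p →
        ∃ cb : CrossedBraiding z.action,
          ToricZesting.ExtensionData z cb (ToricZesting.labelF z) (ToricZesting.assocF p)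
            ToricZesting.braidF (ToricZesting.tens p) (ToricZesting.comp p) ∧
          ∀ ζ : ℂˣ, ζ ^ 2 = -iU →
            (∀ y, IsProjectiveCocycle z.action (z.simple (ToricZesting.labelF z y))
              (fun g => z.scalarIso (ToricZesting.labelF z y) (atNeg (ζ ^ parity y.2) g) g)
              (atNegNeg ((-1) ^ y.1.val * (iU * p) ^ parity y.2))) ∧
            (p = -iU → ToricZesting.EquivariantisationData z cb (ToricZesting.labelF z)
              (fun y => (-1) ^ halfFloor y.2 * ζ ^ parity y.2)
              (fun y => (-1) ^ y.1.val * (iU * p) ^ parity y.2)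
              (fun x => iU ^ x.1.val)
              (fun x y w => ToricZesting.assocF p (underlying x) (underlying y) (underlying w))
              (fun x y => (-1) ^ (halfFloor x.2 * (y.1.val + halfFloor y.2 + parity y.2)) *
                ζ ^ (parity x.2 * parity y.2) * iU ^ (x.1.val * parity y.2))) ∧
            (p = iU → ToricZesting.EquivariantisationData z cb (ToricZesting.labelF z)
              (fun y => (-1) ^ halfFloor y.2 * ζ ^ parity y.2)
              (fun y => (-1) ^ y.1.val * (iU * p) ^ parity y.2)
              (fun x => iU ^ (x.1.val + parity x.2))
              (fun x y w => ToricZesting.assocF p (underlying x) (underlying y) (underlying w))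
              (fun x y => (-1) ^ (halfFloor x.2 * (y.1.val + halfFloor y.2 + parity y.2)) *
                ζ ^ (parity x.2 * parity y.2) *
                iU ^ ((x.1.val + parity x.2) * parity y.2)))) := by
  refine ⟨⟨fun p => ?_, fun z p hv hp => ?_⟩, ⟨fun p => ?_, fun z p hv hp => ?_⟩⟩
  · rw [exists_iff, ← mul_self_eq_mul_self_iff_units, mul_one]
    rfl
  · refine ⟨z.crossedBraiding, extensionData (labelE_bijective z) (labelE_add z hv)
      (cocycle_labelE z hv hp) (braidScalar_labelE z) (fun x y => z.tensorator_pow hp x.2 y.2)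
      (compositor_labelE z hv hp), fun h => ?_, fun h => ?_⟩
    · have h1 := equivariantisationData_labelE z hv hp 0 (h.trans (pow_zero _).symm)
      simp only [Fin.val_zero, zero_mul, add_zero] at h1
      exact h1
    · have h1 := equivariantisationData_labelE z hv hp 1 (h.trans (pow_one _).symm)
      simp only [Fin.val_one, one_mul] at h1
      exact h1
  · have h : toricBraiding.toFun (1, 1) (1, 1) = iU * iU := (pow_one _).trans iU_mul_iU.symm
    rw [exists_iff, h, mul_self_eq_mul_self_iff_units]
  · refine ⟨z.crossedBraiding, extensionData (labelF_bijective z) (labelF_add z hv)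
      (cocycle_labelF z hv hp) (braidScalar_labelF z) (fun x y => z.tensorator_pow hp x.2 y.2)
      (compositor_labelF z hv hp), fun ζ hζ => ⟨fun y => isProjectiveCocycle _ _ _ ?_,
        fun h => ?_, fun h => ?_⟩⟩
    · rw [compositor_labelF z hv hp]
      exact projectiveScalar_mul_sq hζ y
    · have h1 := equivariantisationData_labelF z hv hp hζ 0
        (h.trans (by rw [Fin.val_zero, pow_zero, one_mul]))
      simp only [Fin.val_zero, zero_mul, add_zero] at h1
      exact h1
    · have h1 := equivariantisationData_labelF z hv hp hζ 1
        (h.trans (by rw [Fin.val_one, pow_one, neg_one_mul, neg_neg]))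
      simp only [Fin.val_one, one_mul] at h1
      exact h1

end
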